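/- **Setting.** Let $a,b,c,d$ be positive integers with $a+b=c+d=:N$ and $\gcd(a,b,c,d)=1$. Let $S=\mathbb C[\alpha,\beta,\gamma,\delta]$, where $z\in\mathbb C^*$ multiplies $\alpha,\beta,\gamma,\delta$ by $z^{a},z^{b},z^{-c},z^{-d}$. Let $R=S^{\mathbb C^*}$, let $S(m)$ be the $R$-module of all $f\in S$ with $z\cdot f=z^m f$ for all $z$, and let $\mathcal S=\bigoplus_{m=0}^{N-1}S(m)$. For $0\le k,l<N$ let $\mathrm{rad}(S(k),S(l))$ be the span of the $R$-linear maps $S(k)\to S(l)$ that are multiplication by a monomial and are not isomorphisms. Let $\mathrm{rad}^2(S(k),S(l))=\sum_{m=0}^{N-1}\mathrm{rad}(S(m),S(l))\,\mathrm{rad}(S(k),S(m))$ and $\mathrm{Irr}(S(k),S(l))=\mathrm{rad}(S(k),S(l))/\mathrm{rad}^2(S(k),S(l))$. For $(i,j)\in\mathbb Z^2$ let the height $h(i,j)$ be the unique integer $n$ with $n+i+j$ even (that is, $(n,i,j)$ lies in the face-centred cubic lattice) and $$0\le \frac{(2a-N)i+(2c-N)j+nN}{2}<N,$$ and let the label $\pi(i,j)$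 be the value of this fraction at $n=h(i,j)$; it is an integer. Assign to the variables the steps $(\Delta n,\Delta i,\Delta j)$: $$\alpha:(1,1,0),\quad \beta:(1,-1,0),\quad \gamma:(-1,0,-1),\quad \delta:(-1,0,1),$$ and write $\Delta x=(\Delta i,\Delta j)$ for the displacement of the variable $x$. Let $\widetilde Q$ be the quiver with vertex set $\mathbb Z^2$ and the following arrows. * An arrow named $x\in\{\alpha,\beta,\gamma,\delta\}$ from $p$ to $p+\Delta x$ whenever $h(p+\Delta x)=h(p)+\Delta n(x)$. * An arrow named $xy$, with $x\in\{\alpha,\beta\}$ and $y\in\{\gamma,\delta\}$, from $p$ to $p+\Delta x+\Delta y$ whenever $h(p+\Delta y)-h(p+\Delta x)=2$. The faces of $\widetilde Q$ are the unit squares, and the halves of unit squares cut by a diagonal, whose boundary is a directed closed walk in $\widetilde Q$. Let $Q$ be the quiver obtained from $\widetilde Q$ by identifying points of $\mathbb Z^2$ with the same label, arrows with the same name and identified tails, and faces accordingly. Let $\mathbb CQ$ be its path algebra (products are written like compositions of maps) and let $$W=\sum_{F\ \text{clockwise}}w_F-\sum_{F\ \text{counterclockwise}}w_F\in\mathbb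 CQ/[\mathbb CQ,\mathbb CQ]$$ be the sum over the faces of $Q$, where $w_F$ is the boundary word of $F$. Let $(\partial W)$ be the two-sided ideal generated by the cyclic derivatives of $W$ with respect to all arrows. **Theorem.** 1. *(Periodicity.)* The labels are exactly $0,\dots,N-1$. There is a sublattice $L\subset\mathbb Z^2$ of rank two such that $\pi(p)=\pi(q)$ if and only if $q-p\in L$. Translations by $L$ preserve height differences and map $\widetilde Q$ to itself. Every arrow of $\widetilde Q$ lies on the boundary of exactly one clockwise and exactly one counterclockwise face. 2. *(Single variables.)* For a variable $x$ of weight $\mathrm{wt}(x)$ (one of $a,b,-c,-d$) and a point $p$ one has $0\le\pi(p)+\mathrm{wt}(x)\le N-1$, so that multiplication by $x$ maps $S(\pi(p))$ to a summand of $\mathcal S$, if and only if $h(p+\Delta x)=h(p)+\Delta n(x)$. Along every arrow of $\widetilde Q$, single or diagonal, the label changes by the weight of its monomial. 3. *(Irreducible morphisms.)* For all $0\le k,l<N$ the multiplications by the monomials naming the arrows from $k$ to $l$ in $Q$ represent a basis of $\mathrm{Irr}(S(k),S(l))$. Moreover, a map $S(k)\to S(l)$ that is multiplication by a monomial $u$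 is a non-isomorphism that is not a composite of two non-isomorphisms $S(k)\to S(m)\to S(l)$ with $0\le m<N$ if and only if $u$ is the name of an arrow from $k$ to $l$ in $Q$. 4. *(The endomorphism algebra.)* There is an isomorphism of $\mathbb C$-algebras $$\Phi:\ \mathbb CQ/(\partial W)\ \xrightarrow{\ \sim\ }\ \mathrm{End}_R\Big(\bigoplus_{m=0}^{N-1}S(m)\Big)$$ that sends the trivial path at $k$ to the projection onto $S(k)$ and an arrow $k\to l$ named $u$ to multiplication by the monomial $u$ from $S(k)$ to $S(l)$. It sends the boundary word of every face, read from its base vertex $k$ (the tail of its arrow $\alpha$ for a square, the tail of its diagonal arrow for a triangle), to multiplication by $\alpha\beta\gamma\delta$ on $S(k)$. -/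

import Mathlib

/-! ## Path algebras, superpotentials and superpotential algebras of quivers -/

namespace PathAlg

open Quiver

/-- The path algebra `ℂQ` of a quiver: the vector space with basis the paths of `Q`
(those of length zero included). -/
def PathAlgebra (V : Type*) [Quiver V] : Type _ := (Σ u v : V, Path u v) →₀ ℂ

noncomputable section

variable {V : Type*} [Quiver V]

instance : AddCommGroup (PathAlgebra V) :=
  inferInstanceAs (AddCommGroup ((Σ u v : V, Path u v) →₀ ℂ))

instance : Module ℂ (PathAlgebra V) :=
  inferInstanceAs (Module ℂ ((Σ u v : V, Path u v) →₀ ℂ))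

/-- The basis element of `ℂQ` given by a path. -/
def ofPath {u v : V} (p : Path u v) : PathAlgebra V :=
  Finsupp.single (⟨u, v, p⟩ : Σ u v : V, Path u v) (1 : ℂ)

theorem induction_on {P : PathAlgebra V → Prop} (x : PathAlgebra V) (h0 : P 0)
    (hadd : ∀ x y, P x → P y → P (x + y))
    (hsmul : ∀ (c : ℂ) (u v : V) (p : Path u v), P (c • ofPath p)) : P x := by
  refine Finsupp.induction_linear (motive := P) x h0 hadd ?_
  rintro ⟨u, v, p⟩ c
  have h := hsmul c u v p
  have e : c • ofPath p = Finsupp.single (⟨u, v, p⟩ : Σ u v : V, Path u v) c := by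
    change c • Finsupp.single (⟨u, v, p⟩ : Σ u v : V, Path u v) (1 : ℂ) = _
    rw [Finsupp.smul_single, smul_eq_mul, mul_one]
  rw [e] at h
  exact h

open Classical in
/-- The product of two paths: `pathMul p q` is the path `q` followed by the path `p` if `q` ends
where `p` starts, and zero otherwise. Products are thus written like compositions of maps. -/
def pathMul (p q : Σ u v : V, Path u v) : PathAlgebra V :=
  if h : q.2.1 = p.1 then ofPath (q.2.2.comp (p.2.2.cast h.symm rfl)) else 0

/-- The bilinear extension of `pathMul`. -/
def mulLin : PathAlgebra V →ₗ[ℂ] PathAlgebra V →ₗ[ℂ] PathAlgebra V :=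
  Finsupp.linearCombination ℂ fun p =>
    (Finsupp.linearCombination ℂ fun q => pathMul p q : PathAlgebra V →ₗ[ℂ] PathAlgebra V)

instance : Mul (PathAlgebra V) := ⟨fun x y => mulLin x y⟩

theorem mul_def' (x y : PathAlgebra V) : x * y = mulLin x y := rfl

theorem ofPath_mul {u v w z : V} (p : Path u v) (q : Path w z) :
    ofPath p * ofPath q = pathMul ⟨u, v, p⟩ ⟨w, z, q⟩ := by
  rw [mul_def', mulLin, ofPath, ofPath]
  erw [Finsupp.linearCombination_single, one_smul, Finsupp.linearCombination_single, one_smul]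

theorem ofPath_mul_comp {u v w : V} (p : Path v w) (q : Path u v) :
    ofPath p * ofPath q = ofPath (q.comp p) := by
  simp [ofPath_mul, pathMul]

theorem ofPath_mul_ne {u v w z : V} (p : Path u v) (q : Path w z) (h : z ≠ u) :
    ofPath p * ofPath q = 0 := by
  simp [ofPath_mul, pathMul, h]

instance : NonUnitalNonAssocRing (PathAlgebra V) where
  left_distrib x y z := by simp [mul_def']
  right_distrib x y z := by simp [mul_def']
  zero_mul x := by simp [mul_def']
  mul_zero x := by simp [mul_def']

theorem smul_mul' (c : ℂ) (x y : PathAlgebra V) : (c • x) * y = c • (x * y) := by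
  simp [mul_def']

theorem mul_smul' (c : ℂ) (x y : PathAlgebra V) : x * (c • y) = c • (x * y) := by
  simp [mul_def']

theorem ofPath_assoc {u v u' v' u'' v'' : V} (p : Path u v) (q : Path u' v') (r : Path u'' v'') :
    ofPath p * ofPath q * ofPath r = ofPath p * (ofPath q * ofPath r) := by
  by_cases h : v' = u
  · subst h
    rw [ofPath_mul_comp]
    by_cases h' : v'' = u'
    · subst h'
      simp only [ofPath_mul_comp, Path.comp_assoc]
    · rw [ofPath_mul_ne _ _ h', ofPath_mul_ne _ _ h', mul_zero]
  · rw [ofPath_mul_ne _ _ h, zero_mul]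
    by_cases h' : v'' = u'
    · subst h'
      rw [ofPath_mul_comp, ofPath_mul_ne _ _ h]
    · rw [ofPath_mul_ne _ _ h', mul_zero]

theorem mul_assoc' (x y z : PathAlgebra V) : x * y * z = x * (y * z) := by
  induction x using induction_on with
  | h0 => simp
  | hadd x x' h h' => simp only [add_mul, h, h']
  | hsmul c u v p =>
    induction y using induction_on with
    | h0 => simp
    | hadd y y' h h' => simp only [add_mul, mul_add, h, h']
    | hsmul c' u' v' q =>
      induction z using induction_on with
      | h0 => simp
      | hadd z z' h h' => simp only [mul_add, h, h']
      | hsmul c'' u'' v'' r => simp only [smul_mul', mul_smul', ofPath_assoc]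

/-- The identity of `ℂQ`, for a quiver with finitely many vertices: the sum of the
paths of length zero. -/
instance [Fintype V] : One (PathAlgebra V) := ⟨∑ v : V, ofPath (Path.nil : Path v v)⟩

theorem one_def' [Fintype V] :
    (1 : PathAlgebra V) = ∑ v : V, ofPath (Path.nil : Path v v) := rfl

theorem one_mul_ofPath [Fintype V] {u v : V} (p : Path u v) : 1 * ofPath p = ofPath p := by
  classical
  rw [one_def', Finset.sum_mul, Finset.sum_eq_single v]
  · rw [ofPath_mul_comp, Path.comp_nil]
  · intro w _ hw
    exact ofPath_mul_ne _ _ (Ne.symm hw)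
  · simp

theorem ofPath_mul_one [Fintype V] {u v : V} (p : Path u v) : ofPath p * 1 = ofPath p := by
  classical
  rw [one_def', Finset.mul_sum, Finset.sum_eq_single u]
  · rw [ofPath_mul_comp, Path.nil_comp]
  · intro w _ hw
    exact ofPath_mul_ne _ _ hw
  · simp

instance [Fintype V] : Ring (PathAlgebra V) where
  mul_assoc := mul_assoc'
  one_mul x := by
    induction x using induction_on with
    | h0 => simp
    | hadd x y hx hy => rw [mul_add, hx, hy]
    | hsmul c u v p => rw [mul_smul', one_mul_ofPath]
  mul_one x := by
    induction x using induction_on with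
    | h0 => simp
    | hadd x y hx hy => rw [add_mul, hx, hy]
    | hsmul c u v p => rw [smul_mul', ofPath_mul_one]
  zsmul := (· • ·)
  neg_add_cancel := neg_add_cancel
  sub_eq_add_neg := sub_eq_add_neg
  zsmul_zero' := SubNegMonoid.zsmul_zero'
  zsmul_succ' := SubNegMonoid.zsmul_succ'
  zsmul_neg' := SubNegMonoid.zsmul_neg'

instance [Fintype V] : Algebra ℂ (PathAlgebra V) := Algebra.ofModule smul_mul' mul_smul'

variable (V) in
/-- The subspace `[ℂQ, ℂQ]` spanned by the commutators. -/
def commutators : Submodule ℂ (PathAlgebra V) :=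
  Submodule.span ℂ {z | ∃ x y : PathAlgebra V, z = x * y - y * x}

variable (V) in
/-- The space `ℂQ / [ℂQ, ℂQ]` of superpotentials. -/
abbrev Superpotential : Type _ := PathAlgebra V ⧸ commutators V

open Classical in
/-- For a path `p` and an element `y`: the sum of `q * (y * r)` over all the ways to write `p` as
"first `q`, then the arrow `a`, then `r`". -/
def derivAux (a : Total V) {u : V} : {v : V} → Path u v → PathAlgebra V → PathAlgebra V
  | _, .nil, _ => 0
  | _, .cons q e, y => (if a = ⟨_, _, e⟩ then ofPath q * y else 0) + derivAux a q (y * ofPath e.toPath)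

/-- The cyclic derivative `∂_a` with respect to the arrow `a`, on a path: the sum, over all the
occurrences of `a` in the path, "first `q`, then `a`, then `r`", of the path "first `r`, then `q`".
It is zero on a path that is not closed. -/
def derivPath (a : Total V) (p : Σ u v : V, Path u v) : PathAlgebra V :=
  derivAux a p.2.2 (ofPath (Path.nil : Path p.2.1 p.2.1))

/-- The cyclic derivative `∂_a` on `ℂQ`. -/
def derivLin (a : Total V) : PathAlgebra V →ₗ[ℂ] PathAlgebra V :=
  Finsupp.linearCombination ℂ (derivPath a)

theorem derivLin_ofPath (a : Total V) {u v : V} (p : Path u v) :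
    derivLin a (ofPath p) = derivAux a p (ofPath (Path.nil : Path v v)) := by
  rw [derivLin, ofPath]
  erw [Finsupp.linearCombination_single, one_smul]
  rfl

theorem derivAux_comp (a : Total V) {u v w : V} (p : Path u v) (q : Path v w) (y : PathAlgebra V)
    (hy : y * ofPath (Path.nil : Path w w) = y) :
    derivAux a (p.comp q) y = derivAux a q (ofPath p * y) + derivAux a p (y * ofPath q) := by
  induction q generalizing y with
  | nil => rw [hy, Path.comp_nil]; simp [derivAux]
  | cons q e ih =>
    have h1 : ofPath (q.cons e) = ofPath e.toPath * ofPath q := by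
      rw [ofPath_mul_comp]; rfl
    have h2 := ih (y * ofPath e.toPath) (by rw [mul_assoc', ofPath_mul_comp, Path.nil_comp])
    rw [Path.comp_cons, derivAux, derivAux, h2, h1, ← ofPath_mul_comp]
    simp only [mul_assoc', add_assoc]

theorem derivAux_start (a : Total V) {u v : V} (p : Path u v) (y : PathAlgebra V) :
    derivAux a p y = derivAux a p (ofPath (Path.nil : Path u u) * y) := by
  induction p generalizing y with
  | nil => rfl
  | cons q e ih =>
    rw [derivAux, derivAux, ih, ← mul_assoc', ← mul_assoc', ofPath_mul_comp q, Path.nil_comp]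

theorem derivAux_zero (a : Total V) {u v : V} (p : Path u v) : derivAux a p 0 = 0 := by
  induction p with
  | nil => rfl
  | cons q e ih => simp [derivAux, ih]

theorem derivLin_ofPath_mul_comm (a : Total V) {u v u' v' : V} (p : Path u v) (q : Path u' v') :
    derivLin a (ofPath p * ofPath q) = derivLin a (ofPath q * ofPath p) := by
  have key : ∀ {u v w : V} (p : Path u v) (q : Path v w), w ≠ u →
      derivLin a (ofPath q * ofPath p) = 0 := by
    intro u v w p q h
    rw [ofPath_mul_comp, derivLin_ofPath, derivAux_comp _ _ _ _ (by rw [ofPath_mul_comp]; rfl),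
      ofPath_mul_ne _ _ h, derivAux_zero, derivAux_start a p, ofPath_mul_comp, Path.comp_nil,
      ofPath_mul_ne _ _ h, derivAux_zero, add_zero]
  by_cases h : v' = u <;> by_cases h' : v = u'
  · subst h h'
    rw [ofPath_mul_comp, ofPath_mul_comp, derivLin_ofPath, derivLin_ofPath,
      derivAux_comp _ _ _ _ (by rw [ofPath_mul_comp]; rfl),
      derivAux_comp _ _ _ _ (by rw [ofPath_mul_comp]; rfl)]
    simp only [ofPath_mul_comp, Path.nil_comp, Path.comp_nil]
    exact add_comm _ _
  · subst h
    rw [ofPath_mul_ne _ _ h', map_zero]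
    exact key q p h'
  · subst h'
    rw [ofPath_mul_ne _ _ h, map_zero]
    exact (key p q h).symm
  · rw [ofPath_mul_ne _ _ h, ofPath_mul_ne _ _ h']

theorem derivLin_mul_comm (a : Total V) (x y : PathAlgebra V) :
    derivLin a (x * y) = derivLin a (y * x) := by
  induction x using induction_on with
  | h0 => simp
  | hadd x x' h h' => simp only [add_mul, mul_add, map_add, h, h']
  | hsmul c u v p =>
    induction y using induction_on with
    | h0 => simp
    | hadd y y' h h' => simp only [add_mul, mul_add, map_add, h, h']
    | hsmul c' u' v' q =>
      simp only [smul_mul', mul_smul', map_smul, derivLin_ofPath_mul_comm a p q]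
      exact smul_comm _ _ _

/-- The cyclic derivative `∂_a` of a superpotential, an element of `ℂQ`. -/
def cyclicDeriv (a : Total V) : Superpotential V →ₗ[ℂ] PathAlgebra V :=
  (commutators V).liftQ (derivLin a) (by
    rw [commutators, Submodule.span_le]
    rintro _ ⟨x, y, rfl⟩
    simp [derivLin_mul_comm a x y])

/-- The Jacobian ideal `(∂W)`: the two-sided ideal generated by the cyclic derivatives of `W`. -/
def jacobianIdeal [Fintype V] (W : Superpotential V) : TwoSidedIdeal (PathAlgebra V) :=
  TwoSidedIdeal.span (Set.range fun a : Total V => cyclicDeriv a W)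

/-- The superpotential algebra `ℂQ / (∂W)`. -/
abbrev SuperpotentialAlgebra [Fintype V] (W : Superpotential V) : Type _ :=
  (jacobianIdeal W).ringCon.Quotient

/-- The class in `ℂQ / (∂W)` of an element of `ℂQ`. -/
def toSuperpotentialAlgebra [Fintype V] (W : Superpotential V) :
    PathAlgebra V →+* SuperpotentialAlgebra W :=
  (jacobianIdeal W).ringCon.mk'

end

end PathAlg

/-! ## Torus action, semi-invariants and irreducible morphisms -/

namespace LabcQuiver

open Quiver PathAlg

/-- The two variables of positive weight. -/
inductive Hor
  | α
  | β
  deriving DecidableEq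

instance : Fintype Hor := ⟨{Hor.α, Hor.β}, by intro x; cases x <;> simp⟩

/-- The two variables of negative weight. -/
inductive Ver
  | γ
  | δ
  deriving DecidableEq

instance : Fintype Ver := ⟨{Ver.γ, Ver.δ}, by intro x; cases x <;> simp⟩

/-- The variables of the polynomial ring `S = ℂ[α, β, γ, δ]`. -/
abbrev Var : Type := Hor ⊕ Ver

/-- The polynomial ring `S = ℂ[α, β, γ, δ]`. -/
abbrev S : Type := MvPolynomial Var ℂ

/-- Positive integers `a, b, c, d` without common divisor such that `a + b = c + d`. -/
structure Weights where
  a : ℕ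
  b : ℕ
  c : ℕ
  d : ℕ
  a_pos : 0 < a
  b_pos : 0 < b
  c_pos : 0 < c
  d_pos : 0 < d
  sum_eq : a + b = c + d
  gcd_eq : Nat.gcd (Nat.gcd a b) (Nat.gcd c d) = 1

noncomputable section

namespace Weights

variable (w : Weights)

/-- `N = a + b = c + d`. -/
def N : ℕ := w.a + w.b

/-- The weights `a, b, -c, -d` of the variables `α, β, γ, δ`. -/
def wt : Var → ℤ
  | .inl .α => w.a
  | .inl .β => w.b
  | .inr .γ => -w.c
  | .inr .δ => -w.d

/-- The action of `z ∈ ℂˣ` on `S`: a variable `x` is multiplied by `z` to the power `wt x`. -/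
def torusAct (z : ℂˣ) : S →ₐ[ℂ] S :=
  MvPolynomial.aeval fun x => MvPolynomial.C ((z ^ w.wt x : ℂˣ) : ℂ) * MvPolynomial.X x

/-- The ring of invariants `R`. -/
def R : Subalgebra ℂ S where
  carrier := {f | ∀ z : ℂˣ, w.torusAct z f = f}
  mul_mem' hf hg z := by rw [map_mul, hf z, hg z]
  add_mem' hf hg z := by rw [map_add, hf z, hg z]
  algebraMap_mem' r z := AlgHom.commutes _ r

/-- The `R`-module `S(m)` of the semi-invariants of weight `m`. -/
def semi (m : ℤ) : Submodule w.R S where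
  carrier := {f | ∀ z : ℂˣ, w.torusAct z f = ((z ^ m : ℂˣ) : ℂ) • f}
  add_mem' hf hg z := by rw [map_add, hf z, hg z, smul_add]
  zero_mem' z := by rw [map_zero, smul_zero]
  smul_mem' r f hf z := by
    rw [Subalgebra.smul_def, smul_eq_mul, map_mul, r.2 z, hf z, mul_smul_comm]

/-- The summand `S(k)` of the tilting module, for `k = 0, …, N - 1`. -/
def Summand (k : Fin w.N) : Type := w.semi (k : ℤ)

section

variable (k l : Fin w.N)

instance : AddCommGroup (w.Summand k) := inferInstanceAs (AddCommGroup (w.semi (k : ℤ)))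

instance : Module w.R (w.Summand k) := (w.semi (k : ℤ)).module

instance : Module ℂ (w.Summand k) := (w.semi (k : ℤ)).module'

instance : IsScalarTower ℂ w.R (w.Summand k) := (w.semi (k : ℤ)).isScalarTower

instance : SMulCommClass w.R ℂ (w.Summand k) := IsScalarTower.to_smulCommClass'

instance : SMulCommClass ℂ w.R (w.Summand k) := IsScalarTower.to_smulCommClass

/-- An element of `S(k)` as a polynomial. -/
def toPoly {w : Weights} {k : Fin w.N} (s : w.Summand k) : S := Subtype.val s

/-- The morphisms `S(k) → S(l)`. -/
abbrev Mor : Type := w.Summand k →ₗ[w.R] w.Summand l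

instance : AddCommGroup (w.Mor k l) := LinearMap.addCommGroup

instance : Module ℂ (w.Mor k l) := LinearMap.module

end

/-- The module `S(0) ⊕ ⋯ ⊕ S(N - 1)`. -/
abbrev Tilting : Type := DirectSum (Fin w.N) w.Summand

/-- The map `φ : S(k) → S(l)` is multiplication by the polynomial `f`. -/
def IsMulBy {w : Weights} {k l : Fin w.N} (φ : w.Mor k l) (f : S) : Prop :=
  ∀ s : w.Summand k, toPoly (φ s) = f * toPoly s

/-- The space `rad(S(k), S(l))`: the span of the morphisms that are multiplication by a monomial
and are not isomorphisms. -/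
def rad (k l : Fin w.N) : Submodule ℂ (w.Mor k l) :=
  Submodule.span ℂ {φ | (∃ e : Var →₀ ℕ, IsMulBy φ (MvPolynomial.monomial e 1)) ∧
    ¬ Function.Bijective φ}

/-- The space `rad²(S(k), S(l)) = ∑ₘ rad(S(m), S(l)) rad(S(k), S(m))`. -/
def radSq (k l : Fin w.N) : Submodule ℂ (w.Mor k l) :=
  ⨆ m : Fin w.N, Submodule.span ℂ {φ | ∃ ψ ∈ w.rad m l, ∃ χ ∈ w.rad k m, φ = ψ ∘ₗ χ}

/-- The space of irreducible morphisms `Irr(S(k), S(l)) = rad / rad²`. -/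
abbrev Irr (k l : Fin w.N) : Type :=
  w.rad k l ⧸ (w.radSq k l).comap (w.rad k l).subtype

/-- A morphism `S(k) → S(l)` is indecomposable if it is not an isomorphism and is not the composite
of two non-isomorphisms `S(k) → S(m) → S(l)` between summands. -/
def IndecMor {w : Weights} {k l : Fin w.N} (φ : w.Mor k l) : Prop :=
  ¬ Function.Bijective φ ∧
    ∀ (m : Fin w.N) (χ : w.Mor k m) (ψ : w.Mor m l),
      φ = ψ ∘ₗ χ → Function.Bijective χ ∨ Function.Bijective ψ

/-! ## The height function -/

theorem exists_unique_height (p : ℤ × ℤ) :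
    ∃! n : ℤ, Even (n + p.1 + p.2) ∧
      0 ≤ ((2 * w.a - w.N) * p.1 + (2 * w.c - w.N) * p.2 + n * w.N : ℚ) / 2 ∧
      ((2 * w.a - w.N) * p.1 + (2 * w.c - w.N) * p.2 + n * w.N : ℚ) / 2 < w.N := by
  have hN : (0 : ℤ) < w.N := by have := w.a_pos; simp only [N]; omega
  have key : ∀ n k : ℤ, n = p.1 + p.2 + 2 * k →
      ((2 * w.a - w.N) * p.1 + (2 * w.c - w.N) * p.2 + n * w.N : ℚ) / 2 =
        ((w.a * p.1 + w.c * p.2 + w.N * k : ℤ) : ℚ) := by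
    rintro n k rfl
    push_cast
    ring
  have hd := Int.emod_add_mul_ediv (w.a * p.1 + w.c * p.2) w.N
  have h0 := Int.emod_nonneg (w.a * p.1 + w.c * p.2) hN.ne'
  have h1 := Int.emod_lt_of_pos (w.a * p.1 + w.c * p.2) hN
  refine ⟨p.1 + p.2 + 2 * (-((w.a * p.1 + w.c * p.2) / w.N)), ⟨?_, ?_, ?_⟩, ?_⟩
  · exact ⟨p.1 + p.2 - (w.a * p.1 + w.c * p.2) / w.N, by ring⟩
  · rw [key _ _ rfl]
    exact_mod_cast (by linarith :
      (0 : ℤ) ≤ w.a * p.1 + w.c * p.2 + w.N * (-((w.a * p.1 + w.c * p.2) / w.N)))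
  · rw [key _ _ rfl]
    exact_mod_cast (by linarith :
      w.a * p.1 + w.c * p.2 + w.N * (-((w.a * p.1 + w.c * p.2) / w.N)) < (w.N : ℤ))
  · rintro n ⟨⟨m, hm⟩, hn0, hn1⟩
    have hk : n = p.1 + p.2 + 2 * (m - p.1 - p.2) := by linarith
    rw [key n _ hk] at hn0 hn1
    have hn0' : (0 : ℤ) ≤ w.a * p.1 + w.c * p.2 + w.N * (m - p.1 - p.2) := by exact_mod_cast hn0
    have hn1' : w.a * p.1 + w.c * p.2 + w.N * (m - p.1 - p.2) < (w.N : ℤ) := by exact_mod_cast hn1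
    have e : (w.a * p.1 + w.c * p.2) / (w.N : ℤ) = -(m - p.1 - p.2) := by
      rw [Int.ediv_eq_iff_of_pos hN]
      constructor <;> nlinarith
    rw [hk, e]
    ring

/-- The height `h(i, j)`: the unique `n` such that `(n, i, j)` lies in the face-centred cubic
lattice and `0 ≤ ((2a - N) i + (2c - N) j + n N) / 2 < N`. -/
def height (p : ℤ × ℤ) : ℤ := (w.exists_unique_height p).choose

/-- The label `π(i, j) = ((2a - N) i + (2c - N) j + h(i, j) N) / 2`; the numerator is even. -/
def label (p : ℤ × ℤ) : ℤ :=
  ((2 * w.a - w.N) * p.1 + (2 * w.c - w.N) * p.2 + w.height p * w.N) / 2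

theorem label_cast (p : ℤ × ℤ) :
    (w.label p : ℚ) =
      ((2 * w.a - w.N) * p.1 + (2 * w.c - w.N) * p.2 + w.height p * w.N : ℚ) / 2 := by
  obtain ⟨⟨m, hm⟩, -, -⟩ := (w.exists_unique_height p).choose_spec.1
  have hm' : w.height p = 2 * m - p.1 - p.2 := by
    have : w.height p + p.1 + p.2 = m + m := hm
    linarith
  have e : (2 * w.a - w.N) * p.1 + (2 * w.c - w.N) * p.2 + w.height p * w.N =
      (w.a * p.1 + w.c * p.2 + w.N * (m - p.1 - p.2)) * (2 : ℤ) := by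
    rw [hm']
    ring
  rw [label, e, Int.mul_ediv_cancel _ two_ne_zero, hm']
  push_cast
  ring

theorem label_nonneg (p : ℤ × ℤ) : 0 ≤ w.label p := by
  have h := (w.exists_unique_height p).choose_spec.1.2.1
  have h' : (0 : ℚ) ≤ w.label p := by rw [label_cast]; exact h
  exact_mod_cast h'

theorem label_lt (p : ℤ × ℤ) : w.label p < w.N := by
  have h := (w.exists_unique_height p).choose_spec.1.2.2
  have h' : (w.label p : ℚ) < w.N := by rw [label_cast]; exact h
  exact_mod_cast h'

end Weights

/-! ## The periodic quiver -/

/-- The displacement `(Δi, Δj)` of a variable. -/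
def varDisp : Var → ℤ × ℤ
  | .inl .α => (1, 0)
  | .inl .β => (-1, 0)
  | .inr .γ => (0, -1)
  | .inr .δ => (0, 1)

/-- The height step `Δn` of a variable. -/
def varStep : Var → ℤ
  | .inl _ => 1
  | .inr _ => -1

/-- The possible names of arrows: the four variables `α, β, γ, δ` and the four diagonal products
`αγ, αδ, βγ, βδ`. -/
inductive Step
  | single (x : Var)
  | diag (x : Hor) (y : Ver)
  deriving DecidableEq

/-- The displacement of an arrow. -/
def Step.disp : Step → ℤ × ℤ
  | .single x => varDisp x
  | .diag x y => varDisp (.inl x) + varDisp (.inr y)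

/-- The monomial by which an arrow multiplies. -/
def Step.poly : Step → S
  | .single x => MvPolynomial.X x
  | .diag x y => MvPolynomial.X (.inl x) * MvPolynomial.X (.inr y)

namespace Weights

variable (w : Weights)

/-- The weight of the monomial of an arrow. -/
def stepWt : Step → ℤ
  | .single x => w.wt x
  | .diag x y => w.wt (.inl x) + w.wt (.inr y)

/-- The arrows of the doubly periodic quiver on `ℤ²`: the quiver has an arrow named `s` from `p` to
`p + s.disp` if the following holds. For a variable: the height changes by the height step of the
variable. For a diagonal product `xy`, which is the diagonal of the unit square with
the other two corners `p + Δx` and `p + Δy`: the height of `p + Δy` exceeds that of `p + Δx` by `2`. -/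
def IsArrow (p : ℤ × ℤ) : Step → Prop
  | .single x => w.height (p + varDisp x) = w.height p + varStep x
  | .diag x y => w.height (p + varDisp (.inr y)) - w.height (p + varDisp (.inl x)) = 2

/-- The vertices of the quotient `Q` of the doubly periodic quiver: points of `ℤ²` with the same
label are identified, and the vertices are the labels `0, …, N - 1`. -/
def Vertex : Type := Fin w.N

instance : Fintype w.Vertex := inferInstanceAs (Fintype (Fin w.N))

/-- The index of the summand `S(k)` belonging to a vertex `k`. -/
def idx {w : Weights} (k : w.Vertex) : Fin w.N := k

/-- The vertex of `Q` below a point of `ℤ²`. -/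
def vertex (p : ℤ × ℤ) : w.Vertex :=
  (⟨(w.label p).toNat, by have := w.label_nonneg p; have := w.label_lt p; omega⟩ : Fin w.N)

/-- The quiver `Q`: its arrows are the images of the arrows of the doubly periodic quiver. -/
instance : Quiver w.Vertex where
  Hom k l := {s : Step // ∃ p : ℤ × ℤ, w.vertex p = k ∧ w.vertex (p + s.disp) = l ∧ w.IsArrow p s}

/-- The name of an arrow of `Q`. -/
def stepOf {w : Weights} {k l : w.Vertex} (x : k ⟶ l) : Step := x.1

/-- The list of names describes a directed walk from `p` in the doubly periodic quiver. -/
def IsWalk (p : ℤ × ℤ) : List Step → Prop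
  | [] => True
  | s :: t => w.IsArrow p s ∧ IsWalk (p + s.disp) t

/-- The end of a walk. -/
def walkEnd (p : ℤ × ℤ) : List Step → ℤ × ℤ
  | [] => p
  | s :: t => walkEnd (p + s.disp) t

/-- The arrows of a walk, given by their tails and their names. -/
def walkArrows (p : ℤ × ℤ) : List Step → List ((ℤ × ℤ) × Step)
  | [] => []
  | s :: t => (p, s) :: walkArrows (p + s.disp) t

/-- The image in `Q` of a walk in the doubly periodic quiver. -/
def walkPath : (p : ℤ × ℤ) → (l : List Step) → w.IsWalk p l →
    Path (w.vertex p) (w.vertex (walkEnd p l))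
  | _, [], _ => Path.nil
  | p, s :: t, h =>
    (Hom.toPath (⟨s, p, rfl, rfl, h.1⟩ : w.vertex p ⟶ w.vertex (p + s.disp))).comp
      (walkPath (p + s.disp) t h.2)

end Weights

/-! ## Faces and the superpotential -/

/-- The variable with the opposite displacement. -/
def Hor.opp : Hor → Hor
  | .α => .β
  | .β => .α

/-- The variable with the opposite displacement. -/
def Ver.opp : Ver → Ver
  | .γ => .δ
  | .δ => .γ

/-- The possible oriented boundaries of faces, up to translation: a unit square, traversed in one
of the two directions, or one of the two halves of a unit square cut by a diagonal. -/
inductive Cell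
  | square (y : Ver)
  | triHV (x : Hor) (y : Ver)
  | triVH (x : Hor) (y : Ver)
  deriving DecidableEq, Fintype

/-- The boundary of a face. A square is based at the tail of its arrow `α`, a triangle at the
tail of its diagonal arrow. -/
def Cell.word : Cell → List Step
  | .square y => [.single (.inl .α), .single (.inr y), .single (.inl .β), .single (.inr y.opp)]
  | .triHV x y => [.diag x y, .single (.inl x.opp), .single (.inr y.opp)]
  | .triVH x y => [.diag x y, .single (.inr y.opp), .single (.inl x.opp)]

/-- Minus the cross product of the first two edges of a convex polygon: positive if the polygon is
traversed clockwise, negative if it is traversed counterclockwise. -/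
def turn : List Step → ℤ
  | s :: t :: _ => s.disp.2 * t.disp.1 - s.disp.1 * t.disp.2
  | _ => 0

/-- The sign of a face: `1` if it is oriented clockwise, `-1` if it is oriented
counterclockwise. -/
def Cell.sign (F : Cell) : ℤ := turn F.word

namespace Weights

variable (w : Weights)

/-- There is a face of the doubly periodic quiver with base point `p` and shape `F`: the boundary
is a directed walk. (The boundary of a unit square that is cut by a diagonal arrow is never a
directed walk.) -/
def IsFace (p : ℤ × ℤ) (F : Cell) : Prop := w.IsWalk p F.word

/-- The word `w_F` of a face, as an element of the path algebra of `Q`. -/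
def faceWord (p : ℤ × ℤ) (F : Cell) (h : w.IsFace p F) : PathAlgebra w.Vertex :=
  ofPath (w.walkPath p F.word h)

open Classical in
/-- The superpotential: the sum of the words of the clockwise faces of `Q` minus the sum
of the words of the counterclockwise ones. A face of `Q` is given by its base vertex `k` and its
shape, and its word is computed on a lift. -/
def superpotential : Superpotential w.Vertex :=
  (commutators w.Vertex).mkQ (∑ k : w.Vertex, ∑ F : Cell,
    if h : ∃ p : ℤ × ℤ, w.vertex p = k ∧ w.IsFace p F then
      (F.sign : ℂ) • w.faceWord h.choose F h.choose_spec.2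
    else 0)

/-- The superpotential algebra `ℂQ / (∂W)` of the periodic quiver. -/
abbrev QuiverAlgebra : Type := SuperpotentialAlgebra w.superpotential

/-- The class in `ℂQ / (∂W)` of a path of `Q`. -/
def pathClass {k l : w.Vertex} (p : Path k l) : w.QuiverAlgebra :=
  toSuperpotentialAlgebra w.superpotential (ofPath p)

/-- The endomorphism `θ` of `S(0) ⊕ ⋯ ⊕ S(N - 1)` is multiplication by the polynomial `f` from
`S(k)` to `S(l)` and zero on the other summands. -/
def IsMulEnd {w : Weights} (θ : Module.End w.R w.Tilting) (k l : Fin w.N) (f : S) : Prop :=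
  ∀ (y : w.Tilting) (m : Fin w.N), toPoly (θ y m) = if m = l then f * toPoly (y k) else 0

end Weights

end

end LabcQuiver

open LabcQuiver

namespace LabcQuiver

open Quiver PathAlg

noncomputable section

namespace Weights

variable (w : Weights)

/-! ### Labels and heights -/

/-! Everything is governed by residues modulo `N`. The label of `(i, j)` is the residue of `a i + c
j` in `[0, N)`, and the height is `i + j - 2 f` with `f` the quotient. Since `b ≡ -a` and `-d ≡ c`,
the step of a variable changes the label by its weight modulo `N`, and the height moves by the
prescribed step exactly when there is no wrap-around. Hence the label alone decides whether an arrow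
or a walk starts at a point (`isArrow_iff_legal`, `isWalk_iff_legalWord`): a variable has to keep
the label in `[0, N)`, and `xy` is an arrow precisely when neither `x` nor `y` alone does so.
Statements about faces thereby become linear inequalities in one label.

Irreducible morphisms: every weight is attained by a monomial free of any prescribed variable, so
that each morphism `S(k) → S(l)` is multiplication by a polynomial (`exists_isMulBy`), all of whose
monomials have weight `l - k`. A nonconstant monomial of this kind is divisible by an arrow from `k`
(`exists_legal_le`), whereas the monomial of an arrow has no proper factor that stays in range
(`not_range_of_add_eq_exp`). So modulo `radSq` exactly the arrow monomials survive.

Endomorphism algebra: each arrow lies on one face of each sign (`existsUnique_cell`), so the cyclic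
derivative of the superpotential is the difference of the two complements of the arrow. Every face
word has the exponent of `αβγδ`, hence both complements act as the same monomial and the
representation factors through the Jacobian ideal. It is surjective because every admissible
monomial is read off along a walk (`exists_walk`). Injectivity is the main point: walks from one
point with the same exponent agree modulo the relations (`walkClass_eq_of_wordExp_eq`). This is a
diamond argument by induction on the degree. Two possible first steps are extended, perhaps through
a third one, to two complements of a common arrow ending at the starting point (`exists_linked`); a
common continuation exists, and walks that share their first step are compared by induction. -/

theorem wt_hor_pos (x : Hor) : 0 < w.wt (.inl x) := by
  have := w.a_pos; have := w.b_pos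
  cases x <;> simp [wt] <;> omega

theorem wt_ver_neg (y : Ver) : w.wt (.inr y) < 0 := by
  have := w.c_pos; have := w.d_pos
  cases y <;> simp [wt] <;> omega

theorem wt_hor_opp (x : Hor) : w.wt (.inl x.opp) = w.N - w.wt (.inl x) := by
  cases x <;> simp [wt, Hor.opp, N]

theorem wt_ver_opp (y : Ver) : w.wt (.inr y.opp) = -w.N - w.wt (.inr y) := by
  have := w.sum_eq
  cases y <;> simp [wt, Ver.opp, N] <;> omega

theorem wt_hor_lt (x : Hor) : w.wt (.inl x) < w.N := by
  have := w.wt_hor_pos x.opp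
  rw [w.wt_hor_opp] at this
  omega

theorem neg_N_lt_wt_ver (y : Ver) : -(w.N : ℤ) < w.wt (.inr y) := by
  have := w.wt_ver_neg y.opp
  rw [w.wt_ver_opp] at this
  omega

theorem N_pos : (0 : ℤ) < w.N := by
  have := w.wt_hor_pos .α
  have := w.wt_hor_lt .α
  omega

/-- Here `f` is the quotient of `a i + c j` by `N`, the label being the remainder. This replaces the
fractions in the definitions by integer division. -/
theorem exists_height_label_eq (p : ℤ × ℤ) : ∃ f : ℤ, w.height p = p.1 + p.2 - 2 * f ∧
    w.label p = w.a * p.1 + w.c * p.2 - w.N * f := by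
  obtain ⟨⟨m, hm⟩, -, -⟩ := (w.exists_unique_height p).choose_spec.1
  have hm' : w.height p = 2 * m - p.1 - p.2 := by
    have : w.height p + p.1 + p.2 = m + m := hm
    linarith
  refine ⟨p.1 + p.2 - m, by linarith, ?_⟩
  have h := w.label_cast p
  rw [hm'] at h
  have h2 : (w.label p : ℚ) = ((w.a * p.1 + w.c * p.2 - w.N * (p.1 + p.2 - m) : ℤ) : ℚ) := by
    rw [h]; push_cast; ring
  exact_mod_cast h2

/-- Adding `t` with `0 < t < n` to a residue produces at most one carry, and `f' - f` is this carry.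
-/
theorem eq_or_eq_of_label_shift {k k' t n f f' : ℤ} (hk : 0 ≤ k) (hkn : k < n) (hk' : 0 ≤ k')
    (hkn' : k' < n) (ht : 0 < t) (htn : t < n) (e : k' + n * f' = k + n * f + t) :
    (f' = f ∧ k' = k + t) ∨ (f' = f + 1 ∧ k' = k + t - n) := by
  have h1 : n * (f' - f) = k + t - k' := by linarith
  have h2 : -1 < f' - f := by
    by_contra h
    have : f' - f ≤ -1 := by omega
    nlinarith
  have h3 : f' - f < 2 := by
    by_contra h
    have : 2 ≤ f' - f := by omega
    nlinarith
  have h4 : f' = f ∨ f' = f + 1 := by omega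
  rcases h4 with rfl | rfl
  · left; exact ⟨rfl, by linarith⟩
  · right; exact ⟨rfl, by linarith⟩

/-- The effect on height and label of a step in the direction of a variable of positive weight. -/
theorem hor_shift (p : ℤ × ℤ) (x : Hor) :
    (w.height (p + varDisp (.inl x)) = w.height p + 1 ∧
      w.label (p + varDisp (.inl x)) = w.label p + w.wt (.inl x)) ∨
    (w.height (p + varDisp (.inl x)) = w.height p - 1 ∧
      w.label (p + varDisp (.inl x)) = w.label p + w.wt (.inl x) - w.N) := by
  obtain ⟨f, h1, h2⟩ := w.exists_height_label_eq p
  obtain ⟨f', h1', h2'⟩ := w.exists_height_label_eq (p + varDisp (.inl x))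
  have b1 := w.label_nonneg p
  have b2 := w.label_lt p
  have b1' := w.label_nonneg (p + varDisp (.inl x))
  have b2' := w.label_lt (p + varDisp (.inl x))
  have ha := w.wt_hor_pos .α
  have ha' := w.wt_hor_lt .α
  have hb : w.wt (.inl .β) = w.N - w.wt (.inl .α) := w.wt_hor_opp .α
  have haw : w.wt (.inl .α) = w.a := rfl
  cases x
  · simp only [varDisp, Prod.fst_add, Prod.snd_add] at *
    have := eq_or_eq_of_label_shift b1 b2 b1' b2' ha ha' (f := f) (f' := f')
      (by rw [h2, h2', haw]; ring)
    omega
  · simp only [varDisp, Prod.fst_add, Prod.snd_add] at *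
    -- The displacement of `β` is opposite to that of `α`: the shift by `a` leads from the head back
    -- to the tail, so the two points exchange roles.
    have := eq_or_eq_of_label_shift b1' b2' b1 b2 ha ha' (f := f') (f' := f)
      (by rw [h2, h2', haw]; ring)
    omega

/-- The effect on height and label of a step in the direction of a variable of negative weight. -/
theorem ver_shift (p : ℤ × ℤ) (y : Ver) :
    (w.height (p + varDisp (.inr y)) = w.height p - 1 ∧
      w.label (p + varDisp (.inr y)) = w.label p + w.wt (.inr y)) ∨
    (w.height (p + varDisp (.inr y)) = w.height p + 1 ∧
      w.label (p + varDisp (.inr y)) = w.label p + w.wt (.inr y) + w.N) := by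
  obtain ⟨f, h1, h2⟩ := w.exists_height_label_eq p
  obtain ⟨f', h1', h2'⟩ := w.exists_height_label_eq (p + varDisp (.inr y))
  have b1 := w.label_nonneg p
  have b2 := w.label_lt p
  have b1' := w.label_nonneg (p + varDisp (.inr y))
  have b2' := w.label_lt (p + varDisp (.inr y))
  have hc : 0 < -w.wt (.inr .γ) := by have := w.wt_ver_neg .γ; omega
  have hc' : -w.wt (.inr .γ) < w.N := by have := w.neg_N_lt_wt_ver .γ; omega
  have hd : w.wt (.inr .δ) = -w.N - w.wt (.inr .γ) := w.wt_ver_opp .γ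
  have hcw : -w.wt (.inr .γ) = w.c := neg_neg _
  cases y
  · simp only [varDisp, Prod.fst_add, Prod.snd_add] at *
    have := eq_or_eq_of_label_shift b1' b2' b1 b2 hc hc' (f := f') (f' := f)
      (by rw [h2, h2', hcw]; ring)
    omega
  · simp only [varDisp, Prod.fst_add, Prod.snd_add] at *
    have := eq_or_eq_of_label_shift b1 b2 b1' b2' hc hc' (f := f) (f' := f')
      (by rw [h2, h2', hcw]; ring)
    omega

/-- The condition on a label `k` for an arrow named `s` to start at a point of this label. -/
def Legal (k : ℤ) : Step → Prop
  | .single (.inl x) => k + w.wt (.inl x) < w.N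
  | .single (.inr y) => 0 ≤ k + w.wt (.inr y)
  | .diag x y => w.N ≤ k + w.wt (.inl x) ∧ k + w.wt (.inr y) < 0

/-- A wrap-around moves the height in the wrong direction, which settles the variables. For a
diagonal, both neighbouring heights differ from that of `p` by one, so their difference is `2` only
if the steps `x` and `y` both wrap around. -/
theorem isArrow_iff_legal (p : ℤ × ℤ) (s : Step) : w.IsArrow p s ↔ w.Legal (w.label p) s := by
  have b1 := w.label_nonneg p
  have b2 := w.label_lt p
  rcases s with (x | y) | ⟨x, y⟩
  · have b1' := w.label_nonneg (p + varDisp (.inl x))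
    have b2' := w.label_lt (p + varDisp (.inl x))
    have := w.hor_shift p x
    simp only [IsArrow, Legal, varStep]
    omega
  · have b1' := w.label_nonneg (p + varDisp (.inr y))
    have b2' := w.label_lt (p + varDisp (.inr y))
    have := w.ver_shift p y
    simp only [IsArrow, Legal, varStep]
    omega
  · have b1' := w.label_nonneg (p + varDisp (.inl x))
    have b2' := w.label_lt (p + varDisp (.inl x))
    have b3' := w.label_nonneg (p + varDisp (.inr y))
    have b4' := w.label_lt (p + varDisp (.inr y))
    have := w.hor_shift p x
    have := w.ver_shift p y
    simp only [IsArrow, Legal]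
    omega

theorem label_add_disp (p : ℤ × ℤ) (s : Step) (h : w.IsArrow p s) :
    w.label (p + s.disp) = w.label p + w.stepWt s := by
  have b1 := w.label_nonneg p
  have b2 := w.label_lt p
  have b1' := w.label_nonneg (p + s.disp)
  have b2' := w.label_lt (p + s.disp)
  rw [isArrow_iff_legal] at h
  rcases s with (x | y) | ⟨x, y⟩
  · have := w.hor_shift p x
    simp only [Legal, Step.disp, stepWt] at *
    omega
  · have := w.ver_shift p y
    simp only [Legal, Step.disp, stepWt] at *
    omega
  · have := w.hor_shift p x
    have := w.ver_shift (p + varDisp (.inl x)) y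
    have := w.label_nonneg (p + varDisp (.inl x))
    have := w.label_lt (p + varDisp (.inl x))
    have := w.neg_N_lt_wt_ver y
    have := w.wt_hor_lt x
    simp only [Legal, Step.disp, stepWt, ← add_assoc] at *
    omega

theorem single_iff (p : ℤ × ℤ) (x : Var) : (0 ≤ w.label p + w.wt x ∧ w.label p + w.wt x < w.N) ↔
    w.height (p + varDisp x) = w.height p + varStep x := by
  have h := w.isArrow_iff_legal p (.single x)
  rw [IsArrow] at h
  rw [h]
  have b1 := w.label_nonneg p
  have b2 := w.label_lt p
  rcases x with x | y
  · have := w.wt_hor_pos x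
    simp only [Legal]; omega
  · have := w.wt_ver_neg y
    simp only [Legal]; omega

/-! ### Periodicity -/

theorem idx_vertex (p : ℤ × ℤ) : ((idx (w.vertex p) : ℕ) : ℤ) = w.label p :=
  Int.toNat_of_nonneg (w.label_nonneg p)

theorem vertex_ext {k l : w.Vertex} (h : ((idx k : ℕ) : ℤ) = (idx l : ℕ)) : k = l :=
  Fin.ext (by exact_mod_cast h)

theorem vertex_eq_iff_label_eq (p q : ℤ × ℤ) :
    w.vertex p = w.vertex q ↔ w.label p = w.label q := by
  constructor
  · intro h
    rw [← idx_vertex, ← idx_vertex, h]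
  · intro h
    exact w.vertex_ext (by rw [idx_vertex, idx_vertex, h])

/-- Labels lie in `[0, N)`, so congruent ones are equal; the right-hand side is linear in `q - p`
and exhibits the period lattice. -/
theorem vertex_eq_iff_dvd (p q : ℤ × ℤ) :
    w.vertex p = w.vertex q ↔ (w.N : ℤ) ∣ w.a * (q - p).1 + w.c * (q - p).2 := by
  rw [vertex_eq_iff_label_eq]
  obtain ⟨f, -, h⟩ := w.exists_height_label_eq p
  obtain ⟨f', -, h'⟩ := w.exists_height_label_eq q
  have e : w.a * (q - p).1 + w.c * (q - p).2 = w.label q - w.label p + w.N * (f' - f) := by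
    rw [h, h']; simp only [Prod.fst_sub, Prod.snd_sub]; ring
  rw [e]
  constructor
  · intro hk
    rw [hk]
    exact ⟨f' - f, by ring⟩
  · intro hk
    rw [Int.dvd_add_left (Dvd.intro _ rfl)] at hk
    have b1 := w.label_nonneg p
    have b2 := w.label_lt p
    have b1' := w.label_nonneg q
    have b2' := w.label_lt q
    have := Int.eq_zero_of_abs_lt_dvd hk (by rw [abs_lt]; omega)
    omega

theorem vertex_add_right {p q : ℤ × ℤ} (h : w.vertex p = w.vertex q) (r : ℤ × ℤ) :
    w.vertex (p + r) = w.vertex (q + r) := by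
  rw [vertex_eq_iff_dvd] at h ⊢
  simpa using h

theorem height_sub_eq {p q : ℤ × ℤ} (h : w.vertex p = w.vertex q) (r : ℤ × ℤ) :
    w.height (p + r) - w.height p = w.height (q + r) - w.height q := by
  have h2 := (w.vertex_eq_iff_label_eq _ _).1 (w.vertex_add_right h r)
  rw [vertex_eq_iff_label_eq] at h
  obtain ⟨f1, a1, b1⟩ := w.exists_height_label_eq p
  obtain ⟨f2, a2, b2⟩ := w.exists_height_label_eq q
  obtain ⟨f3, a3, b3⟩ := w.exists_height_label_eq (p + r)
  obtain ⟨f4, a4, b4⟩ := w.exists_height_label_eq (q + r)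
  simp only [Prod.fst_add, Prod.snd_add] at *
  have e : (w.N : ℤ) * (f3 - f1) = w.N * (f4 - f2) := by linarith
  have := mul_left_cancel₀ w.N_pos.ne' e
  rw [a1, a2, a3, a4]
  linarith

theorem isArrow_iff_of_vertex_eq {p q : ℤ × ℤ} (h : w.vertex p = w.vertex q) (s : Step) :
    w.IsArrow p s ↔ w.IsArrow q s := by
  rw [isArrow_iff_legal, isArrow_iff_legal, (w.vertex_eq_iff_label_eq _ _).1 h]

/-- This is where coprimality enters: a common divisor of `a`, `c` and `N = a + b = c + d` also
divides `b` and `d`. -/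
theorem exists_bezout : ∃ x y z : ℤ, w.a * x + w.c * y + w.N * z = 1 := by
  have h : Int.gcd (Int.gcd w.a w.N : ℕ) w.c = 1 := by
    have h1 : (Int.gcd (Int.gcd w.a w.N : ℕ) w.c : ℕ) ∣ 1 := by
      rw [← w.gcd_eq]
      simp only [Int.gcd_natCast_natCast]
      have da : Nat.gcd (Nat.gcd w.a w.N) w.c ∣ w.a :=
        (Nat.gcd_dvd_left _ _).trans (Nat.gcd_dvd_left _ _)
      have dN : Nat.gcd (Nat.gcd w.a w.N) w.c ∣ w.a + w.b :=
        (Nat.gcd_dvd_left _ _).trans (Nat.gcd_dvd_right _ _)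
      have dc : Nat.gcd (Nat.gcd w.a w.N) w.c ∣ w.c := Nat.gcd_dvd_right _ _
      exact Nat.dvd_gcd (Nat.dvd_gcd da ((Nat.dvd_add_right da).1 dN))
        (Nat.dvd_gcd dc ((Nat.dvd_add_right dc).1 (w.sum_eq ▸ dN)))
    exact Nat.dvd_one.1 h1
  have e1 := Int.gcd_eq_gcd_ab w.a w.N
  have e2 := Int.gcd_eq_gcd_ab (Int.gcd w.a w.N : ℕ) w.c
  rw [h] at e2
  rw [Nat.cast_one] at e2
  exact ⟨Int.gcdA w.a w.N * Int.gcdA (Int.gcd w.a w.N : ℕ) w.c,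
    Int.gcdB (Int.gcd w.a w.N : ℕ) w.c, Int.gcdB w.a w.N * Int.gcdA (Int.gcd w.a w.N : ℕ) w.c,
    by linear_combination (-Int.gcdA (Int.gcd w.a w.N : ℕ) w.c) * e1 - e2⟩

theorem exists_vertex_eq (k : w.Vertex) : ∃ p : ℤ × ℤ, w.vertex p = k := by
  obtain ⟨x, y, z, h⟩ := w.exists_bezout
  set m : ℤ := ((idx k : ℕ) : ℤ) with hm
  have hm0 : 0 ≤ m := by omega
  have hm1 : m < w.N := by rw [hm]; exact_mod_cast (idx k).2
  refine ⟨(m * x, m * y), w.vertex_ext ?_⟩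
  rw [idx_vertex]
  obtain ⟨f, -, h'⟩ := w.exists_height_label_eq (m * x, m * y)
  have b1 := w.label_nonneg (m * x, m * y)
  have b2 := w.label_lt (m * x, m * y)
  simp only at h'
  have e : m - w.label (m * x, m * y) = w.N * (m * z + f) := by
    rw [h']; linear_combination (-m) * h
  have := Int.eq_zero_of_abs_lt_dvd (m := (w.N : ℤ)) (x := m - w.label (m * x, m * y)) ⟨_, e⟩
    (by rw [abs_lt]; omega)
  omega

theorem exists_period_lattice : ∃ u v : ℤ × ℤ, LinearIndependent ℤ ![u, v] ∧
    ∀ p q : ℤ × ℤ, w.vertex p = w.vertex q ↔ q - p ∈ Submodule.span ℤ {u, v} := by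
  obtain ⟨x, y, z, h⟩ := w.exists_bezout
  set g : ℤ := ((Int.gcd w.a w.N : ℕ) : ℤ) with hg
  obtain ⟨s, r, hsr⟩ : ∃ s r : ℤ, g = w.a * s + w.N * r := ⟨_, _, Int.gcd_eq_gcd_ab w.a w.N⟩
  obtain ⟨a', ha'⟩ : g ∣ w.a := Int.gcd_dvd_left _ _
  obtain ⟨n', hn'⟩ : g ∣ w.N := Int.gcd_dvd_right _ _
  have hN := w.N_pos
  have hg0 : g ≠ 0 := by
    rintro h0
    rw [h0] at hn'
    omega
  have hn0 : n' ≠ 0 := by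
    rintro h0
    rw [h0] at hn'
    omega
  -- With `g = gcd(a, N) = a s + N r`, the lattice meets the line `j = 0` in the multiples of `(N /
  -- g, 0)`. Its second coordinates are multiples of `g` because `g` is prime to `c`, and `-c s`
  -- fits with `g` since `a (-c s) + c g = c N r`.
  refine ⟨(n', 0), (-w.c * s, g), ?_, fun p q => ?_⟩
  · rw [LinearIndependent.pair_iff]
    intro t t' e
    simp only [Prod.smul_mk, smul_eq_mul, Prod.mk_add_mk, Prod.mk_eq_zero, mul_zero, zero_add] at e
    have ht' : t' = 0 := by
      rcases mul_eq_zero.1 e.2 with h | h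
      · exact h
      · exact absurd h hg0
    subst ht'
    have := e.1
    simp only [zero_mul, add_zero] at this
    rcases mul_eq_zero.1 this with h | h
    · exact ⟨h, rfl⟩
    · exact absurd h hn0
  · rw [vertex_eq_iff_dvd, Submodule.mem_span_pair]
    obtain ⟨i, j⟩ := q - p
    simp only [Prod.smul_mk, smul_eq_mul, Prod.mk_add_mk, Prod.mk.injEq, mul_zero, zero_add]
    constructor
    · rintro ⟨m, hm⟩
      have hj : g ∣ j := by
        -- The witness is the Bezout identity multiplied by `j`, with `c j` replaced by `N m - a i`
        -- and each term then divided by `g`.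
        refine ⟨j * a' * x + (m * n' - a' * i) * y + j * n' * z, ?_⟩
        linear_combination (-j) * h + (j * x - i * y) * ha' + y * hm + (m * y + j * z) * hn'
      obtain ⟨j', rfl⟩ := hj
      refine ⟨(i + w.c * s * j') * r + s * (m - w.c * j' * r), j', ?_, by ring⟩
      have hsr' : 1 = a' * s + n' * r := by
        apply mul_left_cancel₀ hg0
        linear_combination hsr + s * ha' + r * hn'
      have hm' : a' * i + w.c * j' = n' * m := by
        apply mul_left_cancel₀ hg0
        linear_combination hm - i * ha' + m * hn'
      linear_combination (-i) * hsr' - s * hm'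
    · rintro ⟨t, t', rfl, rfl⟩
      refine ⟨a' * t + w.c * t' * r, ?_⟩
      linear_combination (t * n') * ha' - (t * a') * hn' + w.c * t' * hsr

end Weights

/-! ### Words on the boundary of a face, and walks -/

@[simp] theorem Hor.opp_opp (x : Hor) : x.opp.opp = x := by cases x <;> rfl

@[simp] theorem Ver.opp_opp (y : Ver) : y.opp.opp = y := by cases y <;> rfl

theorem Hor.eq_or_eq_opp (x x' : Hor) : x' = x ∨ x' = x.opp := by
  cases x <;> cases x' <;> simp [Hor.opp]

theorem Ver.eq_or_eq_opp (y y' : Ver) : y' = y ∨ y' = y.opp := by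
  cases y <;> cases y' <;> simp [Ver.opp]

/-- The total displacement of a word. -/
def wordDisp (L : List Step) : ℤ × ℤ := (L.map Step.disp).sum

@[simp] theorem wordDisp_nil : wordDisp [] = 0 := rfl

@[simp] theorem wordDisp_cons (s : Step) (L : List Step) :
    wordDisp (s :: L) = s.disp + wordDisp L := by simp [wordDisp]

@[simp] theorem wordDisp_append (L L' : List Step) :
    wordDisp (L ++ L') = wordDisp L + wordDisp L' := by simp [wordDisp]

/-- The part of the boundary of a face before the arrow named `s`. -/
def Cell.before (F : Cell) (s : Step) : List Step := F.word.takeWhile (· ≠ s)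

/-- The part of the boundary of a face after the arrow named `s`. -/
def Cell.after (F : Cell) (s : Step) : List Step := (F.word.dropWhile (· ≠ s)).tail

/-- The boundary of a face with the arrow named `s` removed, read from the head of this arrow. -/
def Cell.compl (F : Cell) (s : Step) : List Step := F.after s ++ F.before s

theorem Cell.word_eq {F : Cell} {s : Step} (h : s ∈ F.word) :
    F.word = F.before s ++ s :: F.after s := by
  have h1 : F.word.dropWhile (· ≠ s) ≠ [] := by
    intro h0
    rw [List.dropWhile_eq_nil_iff] at h0
    simpa using h0 s h
  have h2 : (F.word.dropWhile (· ≠ s)).head h1 = s := by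
    have := List.head_dropWhile_not (fun t => decide (t ≠ s)) h1
    simpa using this
  conv_lhs => rw [← List.takeWhile_append_dropWhile (p := fun t => decide (t ≠ s)) (l := F.word)]
  rw [Cell.before, Cell.after]
  congr 1
  conv_rhs => enter [1]; rw [← h2]
  exact (List.cons_head_tail h1).symm

/-- Since a name occurs only once on a boundary, the cyclic derivative of a face word has at most
one term. -/
theorem Cell.word_nodup (F : Cell) : F.word.Nodup := by
  rcases F with y | ⟨x, y⟩ | ⟨x, y⟩
  · cases y <;> simp [Cell.word, Ver.opp]
  · simp [Cell.word]
  · simp [Cell.word]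

theorem Cell.wordDisp_word (F : Cell) : wordDisp F.word = 0 := by
  rcases F with y | ⟨x, y⟩ | ⟨x, y⟩
  · cases y <;> rfl
  all_goals cases x <;> cases y <;> rfl

theorem Cell.before_disp {F : Cell} {s : Step} (h : s ∈ F.word) :
    wordDisp (F.before s) = -(s.disp + wordDisp (F.after s)) := by
  have := F.wordDisp_word
  rw [Cell.word_eq h, wordDisp_append, wordDisp_cons] at this
  exact eq_neg_of_add_eq_zero_left this

theorem Cell.not_mem_before {F : Cell} {s : Step} : s ∉ F.before s := by
  intro h
  simpa using List.mem_takeWhile_imp h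

theorem Cell.not_mem_after {F : Cell} {s : Step} (h : s ∈ F.word) : s ∉ F.after s := by
  have := F.word_nodup
  rw [Cell.word_eq h, List.nodup_append] at this
  exact (List.nodup_cons.1 this.2.1).1

namespace Weights

variable (w : Weights)

theorem walkEnd_eq (p : ℤ × ℤ) (L : List Step) : walkEnd p L = p + wordDisp L := by
  induction L generalizing p with
  | nil => simp [walkEnd]
  | cons s L ih => rw [walkEnd, ih, wordDisp_cons, add_assoc]

theorem isWalk_append (p : ℤ × ℤ) (L L' : List Step) :
    w.IsWalk p (L ++ L') ↔ w.IsWalk p L ∧ w.IsWalk (p + wordDisp L) L' := by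
  induction L generalizing p with
  | nil => simp [IsWalk]
  | cons s L ih => simp only [List.cons_append, IsWalk, ih, wordDisp_cons, add_assoc, and_assoc]

/-- The boundary closes up, so it may be rotated until `s` comes first; what follows is the
complement, read from the head of `s`. -/
theorem isFace_iff_isWalk_compl {p q : ℤ × ℤ} {F : Cell} {s : Step} (hs : s ∈ F.word)
    (hq : q + wordDisp (F.before s) = p) :
    w.IsFace q F ↔ w.IsArrow p s ∧ w.IsWalk (p + s.disp) (F.compl s) := by
  have h1 := Cell.before_disp hs
  have h2 : p + s.disp + wordDisp (F.after s) = q := by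
    rw [← hq, h1]; abel
  rw [IsFace, Cell.word_eq hs, isWalk_append, hq, IsWalk, Cell.compl, isWalk_append, h2]
  tauto

theorem mem_walkArrows_append (p q : ℤ × ℤ) (s : Step) (L L' : List Step) :
    (p, s) ∈ walkArrows q (L ++ L') ↔
      (p, s) ∈ walkArrows q L ∨ (p, s) ∈ walkArrows (q + wordDisp L) L' := by
  induction L generalizing q with
  | nil => simp [walkArrows]
  | cons t L ih => simp [walkArrows, ih, or_assoc, add_assoc]

theorem mem_of_mem_walkArrows {p q : ℤ × ℤ} {s : Step} {L : List Step}
    (h : (p, s) ∈ walkArrows q L) : s ∈ L := by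
  induction L generalizing q with
  | nil => simp [walkArrows] at h
  | cons t L ih =>
    simp only [walkArrows, List.mem_cons, Prod.mk.injEq] at h ⊢
    rcases h with h | h
    · exact Or.inl h.2
    · exact Or.inr (ih h)

/-- The name determines the position on the boundary, and so the arrow and the shape determine the
base point. Uniqueness of a face through an arrow is thus uniqueness of its shape. -/
theorem mem_walkArrows_word_iff (p q : ℤ × ℤ) (s : Step) (F : Cell) :
    (p, s) ∈ walkArrows q F.word ↔ s ∈ F.word ∧ q + wordDisp (F.before s) = p := by
  constructor
  · intro h
    have hs := mem_of_mem_walkArrows h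
    refine ⟨hs, ?_⟩
    rw [Cell.word_eq hs, mem_walkArrows_append, walkArrows, List.mem_cons] at h
    rcases h with h | h | h
    · exact absurd (mem_of_mem_walkArrows h) Cell.not_mem_before
    · exact (Prod.ext_iff.1 h).1.symm
    · exact absurd (mem_of_mem_walkArrows h) (Cell.not_mem_after hs)
  · rintro ⟨hs, rfl⟩
    rw [Cell.word_eq hs, mem_walkArrows_append, walkArrows]
    exact Or.inr List.mem_cons_self

/-! ### The two faces through an arrow -/

/-- The condition on a label `k` for a walk with the given names to start at a point of this
label. -/
def LegalWord (k : ℤ) : List Step → Prop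
  | [] => True
  | s :: t => w.Legal k s ∧ LegalWord (k + w.stepWt s) t

theorem isWalk_iff_legalWord (p : ℤ × ℤ) (L : List Step) :
    w.IsWalk p L ↔ w.LegalWord (w.label p) L := by
  induction L generalizing p with
  | nil => rfl
  | cons s L ih =>
    rw [IsWalk, LegalWord, ← isArrow_iff_legal]
    refine and_congr_right fun h => ?_
    rw [ih, w.label_add_disp p s h]

/-- Exactly one of three propositions holds. -/
def ExactlyOne (P Q R : Prop) : Prop := P ∧ ¬Q ∧ ¬R ∨ ¬P ∧ Q ∧ ¬R ∨ ¬P ∧ ¬Q ∧ R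

/-- Suppose `x` is legal. Either `y` is legal after it and then `x.opp` closes the word, or `y`
still underflows, and then `x.opp` overflows because the weights of `x` and `x.opp` add up to `N`,
which makes `x.opp y` a diagonal arrow. If `x` is not legal, then `xy` is a diagonal arrow, and
`x.opp` is legal after it. -/
theorem exactlyOne_hor {k : ℤ} (hk : 0 ≤ k) (x : Hor) {y : Ver}
    (hy : k + w.wt (.inr y) < 0) :
    ExactlyOne (w.LegalWord k [.single (.inl x), .single (.inr y), .single (.inl x.opp)])
      (w.LegalWord k [.single (.inl x), .diag x.opp y])
      (w.LegalWord k [.diag x y, .single (.inl x.opp)]) := by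
  have := w.wt_hor_opp x
  have := w.wt_hor_pos x
  simp only [ExactlyOne, LegalWord, Legal, stepWt, and_true]
  omega

theorem exactlyOne_ver {k : ℤ} (hkN : k < w.N) (y : Ver) {x : Hor}
    (hx : w.N ≤ k + w.wt (.inl x)) :
    ExactlyOne (w.LegalWord k [.single (.inr y), .single (.inl x), .single (.inr y.opp)])
      (w.LegalWord k [.single (.inr y), .diag x y.opp])
      (w.LegalWord k [.diag x y, .single (.inr y.opp)]) := by
  have := w.wt_ver_opp y
  have := w.wt_ver_neg y
  simp only [ExactlyOne, LegalWord, Legal, stepWt, and_true]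
  omega

theorem existsUnique_of_exactlyOne {P : Cell → Prop} {Q : Cell → Prop} {F G H : Cell}
    (hP : ∀ C, P C ↔ C = F ∨ C = G ∨ C = H) (hQ : ExactlyOne (Q F) (Q G) (Q H)) :
    ∃! C, P C ∧ Q C := by
  rcases hQ with h | h | h
  · refine ⟨F, ⟨(hP _).2 (by simp), h.1⟩, fun C hC => ?_⟩
    rcases (hP C).1 hC.1 with rfl | rfl | rfl
    exacts [rfl, absurd hC.2 h.2.1, absurd hC.2 h.2.2]
  · refine ⟨G, ⟨(hP _).2 (by simp), h.2.1⟩, fun C hC => ?_⟩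
    rcases (hP C).1 hC.1 with rfl | rfl | rfl
    exacts [absurd hC.2 h.1, rfl, absurd hC.2 h.2.2]
  · refine ⟨H, ⟨(hP _).2 (by simp), h.2.2⟩, fun C hC => ?_⟩
    rcases (hP C).1 hC.1 with rfl | rfl | rfl
    exacts [absurd hC.2 h.1, absurd hC.2 h.2.1, rfl]

theorem existsUnique_cell {k : ℤ} (hk : 0 ≤ k) (hkN : k < w.N) {s : Step} (hs : w.Legal k s)
    {ε : ℤ} (hε : ε = 1 ∨ ε = -1) :
    ∃! F : Cell, (s ∈ F.word ∧ F.sign = ε) ∧ w.LegalWord (k + w.stepWt s) (F.compl s) := by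
  have a1 := w.wt_hor_opp
  have a2 := w.wt_hor_pos
  have a3 := w.wt_ver_opp
  have a4 := w.wt_ver_neg
  rcases s with (x | y) | ⟨x, y⟩
  · have e1 := w.exactlyOne_ver (k := k + w.wt (.inl x)) (x := x.opp) hs
      .γ (by linarith [a1 x])
    have e2 := w.exactlyOne_ver (k := k + w.wt (.inl x)) (x := x.opp) hs
      .δ (by linarith [a1 x])
    -- For each variable and sign, `decide` finds the three shapes that contain the variable. Their
    -- complements are definitionally the three alternatives in `e1` or `e2`.
    cases x <;> rcases hε with rfl | rfl
    · exact existsUnique_of_exactlyOne (F := .square .γ) (G := .triHV .β .δ)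
        (H := .triVH .β .γ) (by decide) e1
    · exact existsUnique_of_exactlyOne (F := .square .δ) (G := .triHV .β .γ)
        (H := .triVH .β .δ) (by decide) e2
    · exact existsUnique_of_exactlyOne (F := .square .γ) (G := .triHV .α .γ)
        (H := .triVH .α .δ) (by decide) e2
    · exact existsUnique_of_exactlyOne (F := .square .δ) (G := .triHV .α .δ)
        (H := .triVH .α .γ) (by decide) e1
  · have e1 := w.exactlyOne_hor (k := k + w.wt (.inr y)) (y := y.opp) hs
      .α (by linarith [a3 y])
    have e2 := w.exactlyOne_hor (k := k + w.wt (.inr y)) (y := y.opp) hs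
      .β (by linarith [a3 y])
    cases y <;> rcases hε with rfl | rfl
    · exact existsUnique_of_exactlyOne (F := .square .γ) (G := .triVH .α .δ)
        (H := .triHV .β .δ) (by decide) e2
    · exact existsUnique_of_exactlyOne (F := .square .δ) (G := .triVH .β .δ)
        (H := .triHV .α .δ) (by decide) e1
    · exact existsUnique_of_exactlyOne (F := .square .γ) (G := .triVH .β .γ)
        (H := .triHV .α .γ) (by decide) e1
    · exact existsUnique_of_exactlyOne (F := .square .δ) (G := .triVH .α .γ)
        (H := .triHV .β .γ) (by decide) e2
  · have e1 : w.LegalWord (k + w.stepWt (.diag x y))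
        [.single (.inl x.opp), .single (.inr y.opp)] := by
      have := a1 x; have := a3 y; have := a2 x; have := a4 y
      simp only [Legal, stepWt, LegalWord, and_true] at *
      omega
    have e2 : w.LegalWord (k + w.stepWt (.diag x y))
        [.single (.inr y.opp), .single (.inl x.opp)] := by
      have := a1 x; have := a3 y; have := a2 x; have := a4 y
      simp only [Legal, stepWt, LegalWord, and_true] at *
      omega
    have key : ∀ F : Cell, (∀ C : Cell, (.diag x y ∈ C.word ∧ C.sign = ε) ↔ C = F) →
        w.LegalWord (k + w.stepWt (.diag x y)) (F.compl (.diag x y)) →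
        ∃! F : Cell, (.diag x y ∈ F.word ∧ F.sign = ε) ∧
          w.LegalWord (k + w.stepWt (.diag x y)) (F.compl (.diag x y)) :=
      fun F h h' => ⟨F, ⟨(h F).2 rfl, h'⟩, fun C hC => (h C).1 hC.1⟩
    cases x <;> cases y <;> rcases hε with rfl | rfl
    · exact key (.triHV .α .γ) (by decide) e1
    · exact key (.triVH .α .γ) (by decide) e2
    · exact key (.triVH .α .δ) (by decide) e2
    · exact key (.triHV .α .δ) (by decide) e1
    · exact key (.triVH .β .γ) (by decide) e2
    · exact key (.triHV .β .γ) (by decide) e1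
    · exact key (.triHV .β .δ) (by decide) e1
    · exact key (.triVH .β .δ) (by decide) e2

theorem existsUnique_cell_isWalk {p : ℤ × ℤ} {s : Step} (hs : w.IsArrow p s) {ε : ℤ}
    (hε : ε = 1 ∨ ε = -1) :
    ∃! F : Cell, (s ∈ F.word ∧ F.sign = ε) ∧ w.IsWalk (p + s.disp) (F.compl s) := by
  simp only [isWalk_iff_legalWord, w.label_add_disp p s hs]
  exact w.existsUnique_cell (w.label_nonneg p) (w.label_lt p) ((w.isArrow_iff_legal p s).1 hs) hε

theorem existsUnique_face (p : ℤ × ℤ) (s : Step) (hs : w.IsArrow p s) (ε : ℤ)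
    (hε : ε = 1 ∨ ε = -1) :
    ∃! F : (ℤ × ℤ) × Cell, w.IsFace F.1 F.2 ∧ F.2.sign = ε ∧
      (p, s) ∈ walkArrows F.1 F.2.word := by
  obtain ⟨F, ⟨⟨h1, h2⟩, h3⟩, hu⟩ := w.existsUnique_cell_isWalk hs hε
  refine ⟨(p - wordDisp (F.before s), F), ⟨?_, h2, ?_⟩, ?_⟩
  · exact (w.isFace_iff_isWalk_compl h1 (sub_add_cancel _ _)).2 ⟨hs, h3⟩
  · exact (mem_walkArrows_word_iff _ _ _ _).2 ⟨h1, sub_add_cancel _ _⟩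
  · rintro ⟨q, C⟩ ⟨g1, g2, g3⟩
    obtain ⟨g4, g5⟩ := (mem_walkArrows_word_iff _ _ _ _).1 g3
    have : C = F := hu C ⟨⟨g4, g2⟩, ((w.isFace_iff_isWalk_compl g4 g5).1 g1).2⟩
    subst this
    exact Prod.ext (eq_sub_of_add_eq g5) rfl

end Weights

/-! ### Exponents -/

/-- The exponent of the monomial by which an arrow multiplies. -/
def Step.exp : Step → Var →₀ ℕ
  | .single x => Finsupp.single x 1
  | .diag x y => Finsupp.single (.inl x) 1 + Finsupp.single (.inr y) 1

theorem Step.poly_eq (s : Step) : s.poly = MvPolynomial.monomial s.exp 1 := by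
  rcases s with x | ⟨x, y⟩
  · rfl
  · simp [Step.poly, Step.exp, MvPolynomial.X, MvPolynomial.monomial_mul]

theorem Step.exp_ne_zero (s : Step) : s.exp ≠ 0 := by
  rcases s with x | ⟨x, y⟩ <;> simp [Step.exp]

theorem Step.exp_injective : Function.Injective Step.exp := by
  intro s t h
  have h1 : ∀ x, s.exp x = t.exp x := fun x => by rw [h]
  have hα := h1 (.inl .α)
  have hβ := h1 (.inl .β)
  have hγ := h1 (.inr .γ)
  have hδ := h1 (.inr .δ)
  clear h h1
  rcases s with ((_ | _) | (_ | _)) | ⟨_ | _, _ | _⟩ <;>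
    rcases t with ((_ | _) | (_ | _)) | ⟨_ | _, _ | _⟩ <;>
      first
      | rfl
      | simp [Step.exp] at hα hβ hγ hδ

instance : Finite Step := by
  have : Function.Injective (fun s : Step => match s with
      | .single x => (Sum.inl x : Var ⊕ Hor × Ver)
      | .diag x y => .inr (x, y)) := by
    intro s t h
    rcases s with _ | _ <;> rcases t with _ | _ <;> simp_all
  exact Finite.of_injective _ this

theorem sum_var (f : Var → ℤ) :
    ∑ x, f x = f (.inl .α) + f (.inl .β) + f (.inr .γ) + f (.inr .δ) := by
  have h1 : (Finset.univ : Finset Hor) = {.α, .β} := rfl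
  have h2 : (Finset.univ : Finset Ver) = {.γ, .δ} := rfl
  rw [Fintype.sum_sum_type, h1, h2, Finset.sum_pair (by simp), Finset.sum_pair (by simp)]
  ring

namespace Weights

variable (w : Weights)

/-- The weight of a monomial. -/
def expWt (e : Var →₀ ℕ) : ℤ := ∑ x, e x * w.wt x

theorem expWt_eq (e : Var →₀ ℕ) : w.expWt e =
    e (.inl .α) * w.a + e (.inl .β) * w.b - e (.inr .γ) * w.c - e (.inr .δ) * w.d := by
  rw [expWt, sum_var]
  simp only [wt]
  ring

@[simp] theorem expWt_zero : w.expWt 0 = 0 := by simp [expWt]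

@[simp] theorem expWt_add (e e' : Var →₀ ℕ) : w.expWt (e + e') = w.expWt e + w.expWt e' := by
  simp [expWt, add_mul, Finset.sum_add_distrib]

@[simp] theorem expWt_single (x : Var) : w.expWt (Finsupp.single x 1) = w.wt x := by
  classical
  simp [expWt, Finsupp.single_apply]

@[simp] theorem expWt_exp (s : Step) : w.expWt s.exp = w.stepWt s := by
  rcases s with x | ⟨x, y⟩ <;> simp [Step.exp, stepWt]

/-! ### Divisibility by the monomials of arrows -/

theorem single_le_iff {x : Var} {e : Var →₀ ℕ} : Finsupp.single x 1 ≤ e ↔ e x ≠ 0 := by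
  rw [Finsupp.single_le_iff, Nat.one_le_iff_ne_zero]

theorem diag_le_iff {x : Hor} {y : Ver} {e : Var →₀ ℕ} :
    (Step.diag x y).exp ≤ e ↔ e (.inl x) ≠ 0 ∧ e (.inr y) ≠ 0 := by
  constructor
  · intro h
    have h1 := h (.inl x)
    have h2 := h (.inr y)
    simp [Step.exp] at h1 h2
    omega
  · rintro ⟨h1, h2⟩ z
    rcases z with z | z
    · by_cases hz : x = z
      · subst hz; simp [Step.exp]; omega
      · simp [Step.exp, hz]
    · by_cases hz : y = z
      · subst hz; simp [Step.exp]; omega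
      · simp [Step.exp, hz]

/-- Every nontrivial monomial that maps `S(k)` to `S(l)` is divisible by an arrow starting
at `k`. -/
theorem exists_legal_le {k l : ℤ} (hk : 0 ≤ k) (hkN : k < w.N) (hl : 0 ≤ l) (hlN : l < w.N)
    {e : Var →₀ ℕ} (he : e ≠ 0) (h : w.expWt e = l - k) :
    ∃ s : Step, w.Legal k s ∧ s.exp ≤ e := by
  -- If no arrow from `k` divides the monomial, then every positive variable in it overflows and
  -- every negative one underflows. One of each kind would form a diagonal arrow, so only one kind
  -- occurs, and the target leaves `[0, N)`.
  by_contra! hc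
  have hH : ∀ x : Hor, e (.inl x) ≠ 0 → w.N ≤ k + w.wt (.inl x) := fun x hx => by
    by_contra hlt
    exact hc (.single (.inl x)) (not_le.1 hlt) (single_le_iff.2 hx)
  have hV : ∀ y : Ver, e (.inr y) ≠ 0 → k + w.wt (.inr y) < 0 := fun y hy => by
    by_contra hlt
    exact hc (.single (.inr y)) (not_lt.1 hlt) (single_le_iff.2 hy)
  have hor : ∀ x : Hor, ∀ y : Ver, e (.inl x) = 0 ∨ e (.inr y) = 0 := fun x y => by
    by_contra! hxy
    exact hc (.diag x y) ⟨hH x hxy.1, hV y hxy.2⟩ (diag_le_iff.2 hxy)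
  have hsum : w.expWt e = e (.inl .α) * w.wt (.inl .α) + e (.inl .β) * w.wt (.inl .β) +
      e (.inr .γ) * w.wt (.inr .γ) + e (.inr .δ) * w.wt (.inr .δ) := by
    rw [expWt, sum_var]
  have pos : ∀ x : Hor, 0 ≤ (e (.inl x) : ℤ) * w.wt (.inl x) := fun x =>
    mul_nonneg (by positivity) (w.wt_hor_pos x).le
  have neg : ∀ y : Ver, (e (.inr y) : ℤ) * w.wt (.inr y) ≤ 0 := fun y =>
    mul_nonpos_of_nonneg_of_nonpos (by positivity) (w.wt_ver_neg y).le
  have pos' : ∀ x : Hor, e (.inl x) ≠ 0 → w.N - k ≤ (e (.inl x) : ℤ) * w.wt (.inl x) :=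
    fun x hx => by
      have h1 := hH x hx
      have h2 : (1 : ℤ) ≤ e (.inl x) := by omega
      nlinarith [w.wt_hor_pos x]
  have neg' : ∀ y : Ver, e (.inr y) ≠ 0 → (e (.inr y) : ℤ) * w.wt (.inr y) < -k :=
    fun y hy => by
      have h1 := hV y hy
      have h2 : (1 : ℤ) ≤ e (.inr y) := by omega
      nlinarith [w.wt_ver_neg y]
  obtain ⟨z, hz⟩ := Finsupp.ne_iff.1 he
  rcases z with x | y
  · have h0 : ∀ y, e (.inr y) = 0 := fun y => (hor x y).resolve_left hz
    rw [h0, h0] at hsum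
    simp only [Nat.cast_zero, zero_mul] at hsum
    have := pos .α
    have := pos .β
    have := pos' x hz
    cases x <;> linarith
  · have h0 : ∀ x, e (.inl x) = 0 := fun x => (hor x y).resolve_right hz
    rw [h0, h0] at hsum
    simp only [Nat.cast_zero, zero_mul] at hsum
    have := neg .γ
    have := neg .δ
    have := neg' y hz
    cases y <;> linarith

theorem legal_range {k : ℤ} (hk : 0 ≤ k) (hkN : k < w.N) {s : Step} (h : w.Legal k s) :
    0 ≤ k + w.stepWt s ∧ k + w.stepWt s < w.N := by
  rcases s with (x | y) | ⟨x, y⟩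
  · have := w.wt_hor_pos x
    simp only [Legal, stepWt] at *
    omega
  · have := w.wt_ver_neg y
    simp only [Legal, stepWt] at *
    omega
  · have := w.wt_hor_lt x
    have := w.neg_N_lt_wt_ver y
    simp only [Legal, stepWt] at *
    omega

/-- The monomial of an arrow from `k` is not a product of two nontrivial monomials that map `S(k)`
to another summand and on. -/
theorem not_range_of_add_eq_exp {k : ℤ} {s : Step} (h : w.Legal k s) {e e' : Var →₀ ℕ}
    (he : e ≠ 0) (he' : e' ≠ 0) (hs : e + e' = s.exp) :
    ¬(0 ≤ k + w.expWt e ∧ k + w.expWt e < w.N) := by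
  obtain ⟨z, hz⟩ := Finsupp.ne_iff.1 he
  obtain ⟨z', hz'⟩ := Finsupp.ne_iff.1 he'
  have hs' : ∀ z, e z + e' z = s.exp z := fun z => by rw [← hs]; rfl
  simp only [Finsupp.coe_zero, Pi.zero_apply] at hz hz'
  -- A variable has no nontrivial factorization. The only proper factors of `xy` are `x` and `y`,
  -- and a diagonal arrow exists only where each of them leaves the range.
  rcases s with x | ⟨x, y⟩
  · have h0 : ∀ u, u ≠ x → e u = 0 ∧ e' u = 0 := fun u hu => by
      have := hs' u
      simpa [Step.exp, Finsupp.single_apply, hu.symm] using this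
    have h1 : z = x := by_contra fun hx => hz (h0 z hx).1
    have h2 : z' = x := by_contra fun hx => hz' (h0 z' hx).2
    have h3 := hs' x
    rw [h1] at hz
    rw [h2] at hz'
    simp [Step.exp] at h3
    omega
  · have hle : e ≤ (Step.diag x y).exp := hs ▸ le_self_add
    have hle' : e' ≤ (Step.diag x y).exp := hs ▸ le_add_self
    have hout : ∀ u, u ≠ .inl x → u ≠ .inr y → e u = 0 := fun u hx hy => by
      have := hle u
      simpa [Step.exp, Finsupp.single_apply, hx.symm, hy.symm] using this
    have hout' : ∀ u, u ≠ .inl x → u ≠ .inr y → e' u = 0 := fun u hx hy => by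
      have := hle' u
      simpa [Step.exp, Finsupp.single_apply, hx.symm, hy.symm] using this
    have h1 : e (.inl x) + e' (.inl x) = 1 := by rw [hs']; simp [Step.exp]
    have h2 : e (.inr y) + e' (.inr y) = 1 := by rw [hs']; simp [Step.exp]
    have hA : e (.inl x) ≠ 0 ∨ e (.inr y) ≠ 0 := by
      by_contra! hc
      by_cases hx : z = .inl x
      · exact hz (hx ▸ hc.1)
      · by_cases hy : z = .inr y
        · exact hz (hy ▸ hc.2)
        · exact hz (hout z hx hy)
    have hA' : e' (.inl x) ≠ 0 ∨ e' (.inr y) ≠ 0 := by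
      by_contra! hc
      by_cases hx : z' = .inl x
      · exact hz' (hx ▸ hc.1)
      · by_cases hy : z' = .inr y
        · exact hz' (hy ▸ hc.2)
        · exact hz' (hout' z' hx hy)
    have hwt : w.expWt e = e (.inl x) * w.wt (.inl x) + e (.inr y) * w.wt (.inr y) := by
      rw [expWt, Fintype.sum_sum_type]
      rw [Finset.sum_eq_single x, Finset.sum_eq_single y]
      · intro u _ hu; rw [hout _ (by simp) (by simpa using hu)]; simp
      · simp
      · intro u _ hu; rw [hout _ (by simpa using hu) (by simp)]; simp
      · simp
    have hc : e (.inl x) = 1 ∧ e (.inr y) = 0 ∨ e (.inl x) = 0 ∧ e (.inr y) = 1 := by omega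
    simp only [Legal] at h
    rcases hc with hc | hc <;> rw [hwt, hc.1, hc.2] <;> push_cast <;> omega

/-- Every weight is the weight of a monomial that does not contain a given variable. -/
theorem exists_exp_expWt_eq (x : Var) (k : ℤ) : ∃ e : Var →₀ ℕ, e x = 0 ∧ w.expWt e = k := by
  obtain ⟨u, v, t, h⟩ := w.exists_bezout
  have ha : (0 : ℤ) < w.a := by exact_mod_cast w.a_pos
  have hb : (0 : ℤ) < w.b := by exact_mod_cast w.b_pos
  have hc : (0 : ℤ) < w.c := by exact_mod_cast w.c_pos
  have hd : (0 : ℤ) < w.d := by exact_mod_cast w.d_pos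
  have hN : (w.N : ℤ) = w.a + w.b := by simp [N]
  have hs : (w.a : ℤ) + w.b = w.c + w.d := by exact_mod_cast w.sum_eq
  have key : ∀ fα fβ fγ fδ : ℤ, 0 ≤ fα → 0 ≤ fβ → 0 ≤ fγ → 0 ≤ fδ →
      (match x with | .inl .α => fα | .inl .β => fβ | .inr .γ => fγ | .inr .δ => fδ) = 0 →
      fα * w.a + fβ * w.b - fγ * w.c - fδ * w.d = k →
      ∃ e : Var →₀ ℕ, e x = 0 ∧ w.expWt e = k := by
    intro fα fβ fγ fδ hα hβ hγ hδ hx hk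
    refine ⟨Finsupp.equivFunOnFinite.symm (fun z => match z with
      | .inl .α => fα.toNat
      | .inl .β => fβ.toNat
      | .inr .γ => fγ.toNat
      | .inr .δ => fδ.toNat), ?_, ?_⟩
    · rcases x with (_ | _) | (_ | _) <;> simp at hx ⊢ <;> exact hx.le
    · rw [expWt_eq, ← hk]
      simp only [Finsupp.coe_equivFunOnFinite_symm, Int.toNat_of_nonneg, *]
  have big : ∀ m q : ℤ, 0 < q → ∀ n, |m| ≤ n → 0 ≤ m + n * q := fun m q hq n hn => by
    have := neg_abs_le m
    have := abs_nonneg m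
    nlinarith
  have shift : ∀ m₁ m₂ m₃ q₁ q₂ q₃ : ℤ, 0 < q₁ → 0 < q₂ → 0 < q₃ →
      ∃ n : ℤ, 0 ≤ m₁ + n * q₁ ∧ 0 ≤ m₂ + n * q₂ ∧ 0 ≤ m₃ + n * q₃ :=
    fun m₁ m₂ m₃ q₁ q₂ q₃ h₁ h₂ h₃ =>
    ⟨|m₁| + |m₂| + |m₃|, big _ _ h₁ _ (by linarith [abs_nonneg m₂, abs_nonneg m₃]),
      big _ _ h₂ _ (by linarith [abs_nonneg m₁, abs_nonneg m₃]),
      big _ _ h₃ _ (by linarith [abs_nonneg m₂, abs_nonneg m₁])⟩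
  rcases x with (_ | _) | (_ | _)
  -- Bezout gives an integral solution without the excluded variable. The other three weights still
  -- have both signs and satisfy a relation with positive coefficients, here `(c + d) b - b c - b d
  -- = 0`; a large multiple of it makes all exponents nonnegative.
  · obtain ⟨n, h1, h2, h3⟩ := shift (-k * u) (-k * (u + v + t)) (-k * (u + t))
      (w.c + w.d) w.b w.b (by omega) hb hb
    refine key _ _ _ _ le_rfl h1 h2 h3 rfl ?_
    linear_combination k * h - k * t * (hs + hN) - k * u * hs
  · obtain ⟨n, h1, h2, h3⟩ := shift (k * u) (-k * (v + t)) (-k * t)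
      (w.c + w.d) w.a w.a (by omega) ha ha
    refine key _ _ _ _ h1 le_rfl h2 h3 rfl ?_
    linear_combination k * h - k * t * (hs + hN)
  · obtain ⟨n, h1, h2, h3⟩ := shift (k * (u + v + t)) (k * (v + t)) (k * v)
      w.d w.d (w.a + w.b) hd hd (by omega)
    refine key _ _ _ _ h1 h2 le_rfl h3 rfl ?_
    linear_combination k * h - k * t * hN + k * v * hs
  · obtain ⟨n, h1, h2, h3⟩ := shift (k * (u + t)) (k * t) (-k * v)
      w.c w.c (w.a + w.b) hc hc (by omega)
    refine key _ _ _ _ h1 h2 h3 le_rfl rfl ?_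
    linear_combination k * h - k * t * hN

/-! ### Semi-invariants -/

theorem zpow_sum {G ι : Type*} [CommGroup G] (z : G) (s : Finset ι) (f : ι → ℤ) :
    z ^ (∑ i ∈ s, f i) = ∏ i ∈ s, z ^ f i := by
  induction s using Finset.cons_induction with
  | empty => simp
  | cons i s hi ih => rw [Finset.sum_cons, Finset.prod_cons, zpow_add, ih]

theorem coeff_torusAct (z : ℂˣ) (f : S) (e : Var →₀ ℕ) :
    (w.torusAct z f).coeff e = ((z ^ w.expWt e : ℂˣ) : ℂ) * f.coeff e := by
  induction f using MvPolynomial.induction_on' with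
  | monomial d c =>
    have h : w.torusAct z (MvPolynomial.monomial d c) =
        MvPolynomial.C ((z ^ w.expWt d : ℂˣ) : ℂ) * MvPolynomial.monomial d c := by
      rw [torusAct, MvPolynomial.aeval_monomial, Finsupp.prod_fintype _ _ (by simp),
        MvPolynomial.monomial_eq, Finsupp.prod_fintype _ _ (by simp)]
      simp only [mul_pow, Finset.prod_mul_distrib, ← map_pow, ← map_prod]
      have : ∏ x, ((z ^ w.wt x : ℂˣ) : ℂ) ^ d x = ((z ^ w.expWt d : ℂˣ) : ℂ) := by
        rw [expWt]
        have : z ^ (∑ x, (d x : ℤ) * w.wt x) = ∏ x, (z ^ w.wt x) ^ d x := by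
          rw [zpow_sum]
          refine Finset.prod_congr rfl fun x _ => ?_
          rw [mul_comm, zpow_mul, zpow_natCast]
        rw [this]
        push_cast
        rfl
      rw [this, MvPolynomial.algebraMap_eq]
      ring
    rw [h, MvPolynomial.coeff_C_mul, MvPolynomial.coeff_monomial]
    split_ifs with hd
    · rw [hd]
    · simp
  | add f g hf hg => rw [map_add, MvPolynomial.coeff_add, hf, hg, MvPolynomial.coeff_add, mul_add]

theorem mem_semi_iff {m : ℤ} {f : S} :
    f ∈ w.semi m ↔ ∀ e, f.coeff e ≠ 0 → w.expWt e = m := by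
  constructor
  · intro h e he
    -- The single element `z = 2` separates all weights, since its integral powers have distinct
    -- absolute values.
    have h2 := congrArg (MvPolynomial.coeff e) (h (Units.mk0 2 two_ne_zero))
    rw [coeff_torusAct, MvPolynomial.coeff_smul, smul_eq_mul] at h2
    have h3 := mul_right_cancel₀ he h2
    simp only [Units.val_zpow_eq_zpow_val, Units.val_mk0] at h3
    have h4 : (2 : ℝ) ^ w.expWt e = (2 : ℝ) ^ m := by simpa using congrArg norm h3
    exact zpow_right_injective₀ (by norm_num) (by norm_num) h4
  · intro h z
    ext e
    rw [coeff_torusAct, MvPolynomial.coeff_smul, smul_eq_mul]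
    by_cases he : f.coeff e = 0
    · simp [he]
    · rw [h e he]

theorem mem_R_iff {f : S} : f ∈ w.R ↔ f ∈ w.semi 0 := by
  have : f ∈ w.semi 0 ↔ ∀ z : ℂˣ, w.torusAct z f = ((z ^ (0 : ℤ) : ℂˣ) : ℂ) • f := Iff.rfl
  rw [this]
  simp only [zpow_zero, Units.val_one, one_smul]
  rfl

theorem monomial_mem_semi {e : Var →₀ ℕ} (c : ℂ) :
    MvPolynomial.monomial e c ∈ w.semi (w.expWt e) := by
  rw [mem_semi_iff]
  intro d hd
  rw [MvPolynomial.coeff_monomial] at hd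
  split_ifs at hd with h
  · rw [h]
  · exact absurd rfl hd

theorem mul_mem_semi {m n : ℤ} {f g : S} (hf : f ∈ w.semi m) (hg : g ∈ w.semi n) :
    f * g ∈ w.semi (m + n) := by
  intro z
  rw [map_mul, hf z, hg z, zpow_add, Units.val_mul, smul_mul_smul_comm]

/-! ### Morphisms between the summands -/

variable {w}

theorem idx_nonneg (k : Fin w.N) : (0 : ℤ) ≤ (k : ℕ) := by positivity

theorem idx_lt (k : Fin w.N) : ((k : ℕ) : ℤ) < w.N := by exact_mod_cast k.2

theorem toPoly_injective {k : Fin w.N} : Function.Injective (toPoly : w.Summand k → S) :=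
  Subtype.val_injective

theorem toPoly_mem {k : Fin w.N} (s : w.Summand k) : toPoly s ∈ w.semi (k : ℤ) := Subtype.prop s

theorem toPoly_add {k : Fin w.N} (s t : w.Summand k) : toPoly (s + t) = toPoly s + toPoly t := rfl

@[simp] theorem toPoly_zero {k : Fin w.N} : toPoly (0 : w.Summand k) = 0 := rfl

theorem toPoly_smul_R {k : Fin w.N} (r : w.R) (s : w.Summand k) :
    toPoly (r • s) = (r : S) * toPoly s := rfl

theorem toPoly_smul {k : Fin w.N} (c : ℂ) (s : w.Summand k) :
    toPoly (c • s) = c • toPoly s := rfl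

/-- An element of `S(k)` given by a polynomial. -/
def ofPoly {k : Fin w.N} (f : S) (hf : f ∈ w.semi (k : ℤ)) : w.Summand k := ⟨f, hf⟩

@[simp] theorem toPoly_ofPoly {k : Fin w.N} (f : S) (hf : f ∈ w.semi (k : ℤ)) :
    toPoly (ofPoly f hf) = f := rfl

/-- Multiplication by a semi-invariant, as a morphism `S(k) → S(l)`. -/
def mulMor (k l : Fin w.N) (f : S) (hf : f ∈ w.semi ((l : ℤ) - (k : ℤ))) : w.Mor k l where
  toFun s := ofPoly (f * toPoly s) (by
    have := w.mul_mem_semi hf (toPoly_mem s)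
    rwa [sub_add_cancel] at this)
  map_add' s t := toPoly_injective (by simp [toPoly_add, mul_add])
  map_smul' r s := toPoly_injective (by simp [toPoly_smul_R, mul_left_comm])

theorem isMulBy_mulMor (k l : Fin w.N) (f : S) (hf : f ∈ w.semi ((l : ℤ) - (k : ℤ))) :
    IsMulBy (mulMor k l f hf) f := fun _ => rfl

theorem exists_monomial (k : Fin w.N) (x : Var) : ∃ (e : Var →₀ ℕ) (s : w.Summand k),
    e x = 0 ∧ toPoly s = MvPolynomial.monomial e 1 := by
  obtain ⟨e, he, hk⟩ := w.exists_exp_expWt_eq x (k : ℤ)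
  exact ⟨e, ofPoly _ (hk ▸ w.monomial_mem_semi 1), he, rfl⟩

theorem IsMulBy.unique {k l : Fin w.N} {φ : w.Mor k l} {f g : S} (hf : IsMulBy φ f)
    (hg : IsMulBy φ g) : f = g := by
  obtain ⟨e, s, -, hs⟩ := exists_monomial k (.inl .α)
  have h := (hf s).symm.trans (hg s)
  rw [hs] at h
  exact mul_right_cancel₀ (by simp) h

theorem IsMulBy.ext {k l : Fin w.N} {φ ψ : w.Mor k l} {f : S} (hφ : IsMulBy φ f)
    (hψ : IsMulBy ψ f) : φ = ψ :=
  LinearMap.ext fun s => toPoly_injective ((hφ s).trans (hψ s).symm)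

theorem IsMulBy.mem_semi {k l : Fin w.N} {φ : w.Mor k l} {f : S} (hf : IsMulBy φ f) :
    f ∈ w.semi ((l : ℤ) - (k : ℤ)) := by
  obtain ⟨e, s, -, hs⟩ := exists_monomial k (.inl .α)
  have hk : w.expWt e = (k : ℤ) :=
    w.mem_semi_iff.1 (hs ▸ toPoly_mem s) e (by simp)
  have hl := toPoly_mem (φ s)
  rw [hf s, hs] at hl
  rw [mem_semi_iff] at hl ⊢
  intro d hd
  have := hl (d + e) (by rwa [MvPolynomial.coeff_mul_monomial, mul_one])
  rw [expWt_add, hk] at this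
  linarith

/-- A monomial `m` of weight `-k` turns `m s` and `m t` into invariants. Applying the `R`-linear map
to `(m t) s = (m s) t` and cancelling `m` gives the identity, so the quotient `φ(s) / s` does not
depend on `s`. -/
theorem toPoly_map_mul {k l : Fin w.N} (φ : w.Mor k l) (s t : w.Summand k) :
    toPoly (φ s) * toPoly t = toPoly (φ t) * toPoly s := by
  obtain ⟨e, -, he⟩ := w.exists_exp_expWt_eq (.inl .α) (-(k : ℤ))
  have hm : MvPolynomial.monomial e (1 : ℂ) ∈ w.semi (-(k : ℤ)) := he ▸ w.monomial_mem_semi 1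
  have hR : ∀ s : w.Summand k, MvPolynomial.monomial e (1 : ℂ) * toPoly s ∈ w.R := fun s => by
    rw [mem_R_iff, ← neg_add_cancel (k : ℤ)]
    exact w.mul_mem_semi hm (toPoly_mem s)
  have h : (⟨_, hR t⟩ : w.R) • s = (⟨_, hR s⟩ : w.R) • t :=
    toPoly_injective (by simp only [toPoly_smul_R]; ring)
  have h2 := congrArg (fun u => toPoly (φ u)) h
  simp only [map_smul, toPoly_smul_R] at h2
  have h3 : MvPolynomial.monomial e (1 : ℂ) ≠ 0 := by simp
  apply mul_left_cancel₀ h3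
  linear_combination h2

/-- Every morphism `S(k) → S(l)` is the multiplication by a polynomial. -/
theorem exists_isMulBy {k l : Fin w.N} (φ : w.Mor k l) : ∃ f, IsMulBy φ f := by
  obtain ⟨e, s, -, hs⟩ := exists_monomial k (.inl .α)
  -- The monomial `s` divides `φ(s)`, tested one variable at a time: choose a monomial `t` of weight
  -- `k` without the variable `x`. Then `s` divides `φ(s) t`, and `t` contributes nothing to the
  -- exponent of `x`.
  have hle : ∀ d, (toPoly (φ s)).coeff d ≠ 0 → e ≤ d := by
    intro d hd x
    obtain ⟨e', t, ht0, ht⟩ := exists_monomial k x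
    have h := toPoly_map_mul φ s t
    rw [hs, ht] at h
    have h2 := congrArg (MvPolynomial.coeff (d + e')) h
    rw [MvPolynomial.coeff_mul_monomial, MvPolynomial.coeff_mul_monomial', mul_one, mul_one] at h2
    split_ifs at h2 with h3
    · have := h3 x
      rwa [Finsupp.add_apply, ht0, add_zero] at this
    · exact absurd h2 hd
  have hdvd : toPoly (φ s) = (toPoly (φ s)).divMonomial e * MvPolynomial.monomial e 1 := by
    ext d
    rw [MvPolynomial.coeff_mul_monomial', mul_one]
    split_ifs with h
    · rw [MvPolynomial.coeff_divMonomial, add_tsub_cancel_of_le h]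
    · by_contra hd
      exact h (hle d hd)
  refine ⟨(toPoly (φ s)).divMonomial e, fun t => ?_⟩
  have h := toPoly_map_mul φ s t
  rw [hdvd, hs] at h
  have h3 : MvPolynomial.monomial e (1 : ℂ) ≠ 0 := by simp
  apply mul_right_cancel₀ h3
  linear_combination -h

/-- The polynomial by which a morphism `S(k) → S(l)` multiplies. -/
def multiplier (k l : Fin w.N) : w.Mor k l →ₗ[ℂ] S where
  toFun φ := (exists_isMulBy φ).choose
  map_add' φ ψ := IsMulBy.unique (exists_isMulBy _).choose_spec fun s => by
    rw [LinearMap.add_apply, toPoly_add, (exists_isMulBy φ).choose_spec s,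
      (exists_isMulBy ψ).choose_spec s, add_mul]
  map_smul' c φ := IsMulBy.unique (exists_isMulBy _).choose_spec fun s => by
    rw [LinearMap.smul_apply, toPoly_smul, (exists_isMulBy φ).choose_spec s]
    simp

theorem isMulBy_multiplier {k l : Fin w.N} (φ : w.Mor k l) : IsMulBy φ (multiplier k l φ) :=
  (exists_isMulBy φ).choose_spec

theorem isMulBy_iff {k l : Fin w.N} {φ : w.Mor k l} {f : S} :
    IsMulBy φ f ↔ multiplier k l φ = f :=
  ⟨fun h => (isMulBy_multiplier φ).unique h, fun h => h ▸ isMulBy_multiplier φ⟩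

theorem multiplier_injective (k l : Fin w.N) : Function.Injective (multiplier k l) :=
  fun φ _ h => (isMulBy_multiplier φ).ext (isMulBy_iff.2 h.symm)

theorem multiplier_mem_semi {k l : Fin w.N} (φ : w.Mor k l) :
    multiplier k l φ ∈ w.semi ((l : ℤ) - (k : ℤ)) := (isMulBy_multiplier φ).mem_semi

@[simp] theorem multiplier_mulMor {k l : Fin w.N} (f : S)
    (hf : f ∈ w.semi ((l : ℤ) - (k : ℤ))) : multiplier k l (mulMor k l f hf) = f :=
  isMulBy_iff.1 (isMulBy_mulMor k l f hf)

theorem IsMulBy.comp {k m l : Fin w.N} {ψ : w.Mor m l} {χ : w.Mor k m} {f g : S}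
    (hψ : IsMulBy ψ f) (hχ : IsMulBy χ g) : IsMulBy (ψ ∘ₗ χ) (f * g) := fun s => by
  rw [LinearMap.comp_apply, hψ, hχ, mul_assoc]

theorem multiplier_comp {k m l : Fin w.N} (ψ : w.Mor m l) (χ : w.Mor k m) :
    multiplier k l (ψ ∘ₗ χ) = multiplier m l ψ * multiplier k m χ :=
  isMulBy_iff.1 ((isMulBy_multiplier ψ).comp (isMulBy_multiplier χ))

theorem expWt_of_coeff_ne_zero {k l : Fin w.N} {φ : w.Mor k l} {e : Var →₀ ℕ}
    (h : (multiplier k l φ).coeff e ≠ 0) : w.expWt e = (l : ℤ) - (k : ℤ) :=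
  w.mem_semi_iff.1 (multiplier_mem_semi φ) e h

/-- Multiplication by a monomial is bijective if and only if the monomial is constant. -/
theorem bijective_iff_of_isMulBy_monomial {k l : Fin w.N} {φ : w.Mor k l} {e : Var →₀ ℕ} {c : ℂ}
    (hc : c ≠ 0) (h : IsMulBy φ (MvPolynomial.monomial e c)) :
    Function.Bijective φ ↔ e = 0 := by
  constructor
  · rintro ⟨-, hs⟩
    by_contra he
    obtain ⟨x, hx⟩ := Finsupp.ne_iff.1 he
    -- A monomial in `S(l)` that is free of `x` cannot lie in the image of multiplication by a
    -- multiple of `x`.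
    obtain ⟨d, t, hd, ht⟩ := exists_monomial l x
    obtain ⟨s, rfl⟩ := hs t
    rw [h s] at ht
    have h1 : (MvPolynomial.X x : S) ∣ MvPolynomial.monomial d 1 := by
      rw [← ht]
      exact (MvPolynomial.X_dvd_monomial.2 (Or.inr hx)).mul_right _
    rcases MvPolynomial.X_dvd_monomial.1 h1 with h2 | h2
    · exact one_ne_zero h2
    · exact h2 hd
  · rintro rfl
    have hkl : k = l := by
      have := w.mem_semi_iff.1 h.mem_semi 0 (by simpa using hc)
      rw [expWt_zero] at this
      exact Fin.ext (by omega)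
    subst hkl
    have hφ : ∀ s, φ s = c • s := fun s => toPoly_injective (by
      rw [h s, toPoly_smul, ← MvPolynomial.C_apply, MvPolynomial.smul_eq_C_mul])
    refine ⟨fun s t hst => ?_, fun t => ⟨c⁻¹ • t, ?_⟩⟩
    · rw [hφ, hφ] at hst
      exact smul_right_injective _ hc hst
    · rw [hφ, smul_inv_smul₀ hc]

/-! ### The radical, its square and indecomposable morphisms -/

theorem mem_rad_of_isMulBy_monomial {k l : Fin w.N} {φ : w.Mor k l} {e : Var →₀ ℕ}
    (he : e ≠ 0) (h : IsMulBy φ (MvPolynomial.monomial e 1)) : φ ∈ w.rad k l :=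
  Submodule.subset_span ⟨⟨e, h⟩, fun hb =>
    he ((bijective_iff_of_isMulBy_monomial one_ne_zero h).1 hb)⟩

theorem coeff_zero_of_mem_rad {k l : Fin w.N} {φ : w.Mor k l} (h : φ ∈ w.rad k l) :
    (multiplier k l φ).coeff 0 = 0 := by
  have : w.rad k l ≤ LinearMap.ker (MvPolynomial.lcoeff ℂ 0 ∘ₗ multiplier k l) := by
    rw [rad, Submodule.span_le]
    rintro ψ ⟨⟨e, he⟩, hb⟩
    rw [bijective_iff_of_isMulBy_monomial one_ne_zero he] at hb
    simp [isMulBy_iff.1 he, MvPolynomial.coeff_monomial, hb]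
  exact this h

/-- Radical morphisms have no constant term. A contribution to this coefficient would split the
arrow monomial into two nonconstant factors through some `S(m)`, contrary to
`not_range_of_add_eq_exp`. -/
theorem coeff_exp_of_mem_radSq {k l : Fin w.N} {φ : w.Mor k l} (h : φ ∈ w.radSq k l) {s : Step}
    (hs : w.Legal (k : ℤ) s) : (multiplier k l φ).coeff s.exp = 0 := by
  have : w.radSq k l ≤ LinearMap.ker (MvPolynomial.lcoeff ℂ s.exp ∘ₗ multiplier k l) := by
    refine iSup_le fun m => Submodule.span_le.2 ?_
    rintro φ ⟨ψ, hψ, χ, hχ, rfl⟩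
    simp only [SetLike.mem_coe, LinearMap.mem_ker, LinearMap.comp_apply, MvPolynomial.lcoeff_apply,
      multiplier_comp, MvPolynomial.coeff_mul]
    refine Finset.sum_eq_zero fun d hd => ?_
    rw [Finset.HasAntidiagonal.mem_antidiagonal] at hd
    by_contra hne
    obtain ⟨h1, h2⟩ := mul_ne_zero_iff.1 hne
    have h3 : d.1 ≠ 0 := fun h0 => h1 (h0 ▸ coeff_zero_of_mem_rad hψ)
    have h4 : d.2 ≠ 0 := fun h0 => h2 (h0 ▸ coeff_zero_of_mem_rad hχ)
    refine w.not_range_of_add_eq_exp hs h4 h3 (by rw [add_comm, hd]) ?_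
    rw [expWt_of_coeff_ne_zero h2]
    have := idx_nonneg m
    have := idx_lt m
    omega
  exact this h

theorem mem_radSq_of_add {k l m : Fin w.N} {φ : w.Mor k l} {e e' : Var →₀ ℕ} (he : e ≠ 0)
    (he' : e' ≠ 0) (hm : w.expWt e = (m : ℤ) - (k : ℤ))
    (h : IsMulBy φ (MvPolynomial.monomial (e + e') 1)) : φ ∈ w.radSq k l := by
  have hm' : w.expWt e' = (l : ℤ) - (m : ℤ) := by
    have := w.mem_semi_iff.1 h.mem_semi (e + e') (by simp)
    rw [expWt_add] at this
    linarith
  have h1 := isMulBy_mulMor k m _ (hm ▸ w.monomial_mem_semi (e := e) 1)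
  have h2 := isMulBy_mulMor m l _ (hm' ▸ w.monomial_mem_semi (e := e') 1)
  refine Submodule.mem_iSup_of_mem m (Submodule.subset_span
    ⟨_, mem_rad_of_isMulBy_monomial he' h2, _, mem_rad_of_isMulBy_monomial he h1, ?_⟩)
  refine h.ext ?_
  have := h2.comp h1
  rwa [MvPolynomial.monomial_mul, mul_one, add_comm] at this

/-- A subspace contains a morphism if it contains the multiplications by its monomials. -/
theorem mem_of_forall_monomial {k l : Fin w.N} {V : Submodule ℂ (w.Mor k l)} {φ : w.Mor k l}
    (h : ∀ (e : Var →₀ ℕ) (ψ : w.Mor k l), (multiplier k l φ).coeff e ≠ 0 →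
      IsMulBy ψ (MvPolynomial.monomial e 1) → ψ ∈ V) : φ ∈ V := by
  set f := multiplier k l φ with hf
  have hwt : ∀ e : f.support, w.expWt e = (l : ℤ) - (k : ℤ) := fun e =>
    expWt_of_coeff_ne_zero (MvPolynomial.mem_support_iff.1 e.2)
  have hφ : φ = ∑ e : f.support, f.coeff e • mulMor k l (MvPolynomial.monomial (e : Var →₀ ℕ) 1)
      (hwt e ▸ w.monomial_mem_semi 1) := by
    apply multiplier_injective
    rw [map_sum]
    simp only [map_smul, multiplier_mulMor]
    rw [← hf]
    conv_lhs => rw [f.as_sum, ← Finset.sum_coe_sort]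
    refine Finset.sum_congr rfl fun e _ => ?_
    rw [MvPolynomial.smul_monomial, smul_eq_mul, mul_one]
  rw [hφ]
  exact Submodule.sum_mem _ fun e _ => Submodule.smul_mem _ _
    (h e _ (MvPolynomial.mem_support_iff.1 e.2) (isMulBy_mulMor k l _ _))

/-- By `exists_legal_le`, each remaining monomial is a proper multiple of an arrow monomial, and it
factors through the summand to which this arrow leads. -/
theorem mem_radSq_of_coeff {k l : Fin w.N} {φ : w.Mor k l} (h : φ ∈ w.rad k l)
    (hs : ∀ s : Step, w.Legal (k : ℤ) s → (multiplier k l φ).coeff s.exp = 0) :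
    φ ∈ w.radSq k l := by
  refine mem_of_forall_monomial fun e ψ hc hψ => ?_
  have he0 : e ≠ 0 := fun h0 => hc (h0 ▸ coeff_zero_of_mem_rad h)
  obtain ⟨s, hs1, hs2⟩ := w.exists_legal_le (idx_nonneg k) (idx_lt k) (idx_nonneg l) (idx_lt l)
    he0 (expWt_of_coeff_ne_zero hc)
  obtain ⟨e', rfl⟩ := exists_add_of_le hs2
  have he'0 : e' ≠ 0 := by
    rintro rfl
    rw [add_zero] at hc
    exact hc (hs s hs1)
  have hr := w.legal_range (idx_nonneg k) (idx_lt k) hs1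
  exact mem_radSq_of_add (m := ⟨((k : ℤ) + w.stepWt s).toNat, by omega⟩) s.exp_ne_zero he'0
    (by rw [expWt_exp]; simp only; omega) hψ

/-- A monomial morphism is indecomposable if and only if the monomial is that of an arrow. -/
theorem indecMor_iff {k l : Fin w.N} {φ : w.Mor k l} {e : Var →₀ ℕ}
    (h : IsMulBy φ (MvPolynomial.monomial e 1)) :
    IndecMor φ ↔ ∃ s : Step, w.Legal (k : ℤ) s ∧ e = s.exp := by
  have hwt := w.mem_semi_iff.1 h.mem_semi e (by simp)
  rw [IndecMor, bijective_iff_of_isMulBy_monomial one_ne_zero h]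
  constructor
  · rintro ⟨he0, hd⟩
    obtain ⟨s, hs1, hs2⟩ := w.exists_legal_le (idx_nonneg k) (idx_lt k) (idx_nonneg l) (idx_lt l)
      he0 hwt
    obtain ⟨e', rfl⟩ := exists_add_of_le hs2
    refine ⟨s, hs1, ?_⟩
    have hr := w.legal_range (idx_nonneg k) (idx_lt k) hs1
    rw [expWt_add, expWt_exp] at hwt
    let m : Fin w.N := ⟨((k : ℤ) + w.stepWt s).toNat, by omega⟩
    have hm : ((m : ℕ) : ℤ) = k + w.stepWt s := by simp only [m]; omega
    have hm1 : w.expWt s.exp = (m : ℤ) - (k : ℤ) := by rw [expWt_exp]; omega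
    have hm2 : w.expWt e' = (l : ℤ) - (m : ℤ) := by omega
    have h1 := isMulBy_mulMor k m _ (hm1 ▸ w.monomial_mem_semi (e := s.exp) 1)
    have h2 := isMulBy_mulMor m l _ (hm2 ▸ w.monomial_mem_semi (e := e') 1)
    have h12 := h2.comp h1
    rw [MvPolynomial.monomial_mul, mul_one, add_comm] at h12
    rcases hd m _ _ (h.ext h12) with hb | hb
    · exact absurd ((bijective_iff_of_isMulBy_monomial one_ne_zero h1).1 hb) s.exp_ne_zero
    · rw [(bijective_iff_of_isMulBy_monomial one_ne_zero h2).1 hb, add_zero]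
  · rintro ⟨s, hs, rfl⟩
    refine ⟨s.exp_ne_zero, fun m χ ψ hc => ?_⟩
    have hm := multiplier_comp ψ χ
    rw [← hc, isMulBy_iff.1 h] at hm
    -- The factors are arbitrary morphisms, but divisors of a monomial are scalar multiples of
    -- monomials, so only exponents have to be compared.
    obtain ⟨d, c, hd, -, hψ⟩ := (MvPolynomial.dvd_monomial_iff_exists one_ne_zero).1
      (Dvd.intro _ hm.symm)
    obtain ⟨d', c', hd', -, hχ⟩ := (MvPolynomial.dvd_monomial_iff_exists one_ne_zero).1
      (Dvd.intro_left _ hm.symm)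
    rw [hψ, hχ, MvPolynomial.monomial_mul] at hm
    have hcc : c * c' ≠ 0 := by
      intro h0
      rw [h0] at hm
      simp at hm
    have hsum : s.exp = d + d' := by
      rcases (MvPolynomial.monomial_eq_monomial_iff _ _ _ _).1 hm with h | h
      exacts [h.1, absurd h.1 one_ne_zero]
    rw [bijective_iff_of_isMulBy_monomial (right_ne_zero_of_mul hcc) (isMulBy_iff.2 hχ),
      bijective_iff_of_isMulBy_monomial (left_ne_zero_of_mul hcc) (isMulBy_iff.2 hψ)]
    by_contra! hne
    refine w.not_range_of_add_eq_exp hs hne.1 hne.2 (by rw [hsum, add_comm]) ?_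
    rw [w.mem_semi_iff.1 (isMulBy_iff.2 hχ).mem_semi d'
      (by simpa using right_ne_zero_of_mul hcc)]
    have := idx_nonneg m
    have := idx_lt m
    omega

/-! ### Arrows of the quiver -/

theorem legal_stepOf {k l : w.Vertex} (x : k ⟶ l) : w.Legal ((idx k : ℕ) : ℤ) (stepOf x) := by
  obtain ⟨s, p, rfl, hl, h⟩ := x
  rw [idx_vertex]
  exact (w.isArrow_iff_legal p s).1 h

theorem idx_eq_add_stepWt {k l : w.Vertex} (x : k ⟶ l) :
    ((idx l : ℕ) : ℤ) = (idx k : ℕ) + w.stepWt (stepOf x) := by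
  obtain ⟨s, p, rfl, rfl, h⟩ := x
  rw [idx_vertex, idx_vertex]
  exact w.label_add_disp p s h

theorem exists_stepOf_eq {k l : w.Vertex} {s : Step} (hs : w.Legal ((idx k : ℕ) : ℤ) s)
    (hl : ((idx l : ℕ) : ℤ) = (idx k : ℕ) + w.stepWt s) : ∃ x : k ⟶ l, stepOf x = s := by
  obtain ⟨p, rfl⟩ := w.exists_vertex_eq k
  rw [idx_vertex] at hs hl
  have hp := (w.isArrow_iff_legal p s).2 hs
  exact ⟨⟨s, p, rfl, w.vertex_ext (by rw [idx_vertex, w.label_add_disp p s hp, hl]), hp⟩, rfl⟩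

theorem stepOf_injective {k l : w.Vertex} : Function.Injective (stepOf : (k ⟶ l) → Step) :=
  Subtype.val_injective

instance (k l : w.Vertex) : Finite (k ⟶ l) := Finite.of_injective stepOf stepOf_injective

theorem indecMor_iff_exists_arrow (k l : w.Vertex) (e : Var →₀ ℕ) (φ : w.Mor (idx k) (idx l))
    (h : IsMulBy φ (MvPolynomial.monomial e 1)) :
    IndecMor φ ↔ ∃ x : k ⟶ l, (stepOf x).poly = MvPolynomial.monomial e 1 := by
  have hwt := w.mem_semi_iff.1 h.mem_semi e (by simp)
  rw [indecMor_iff h]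
  constructor
  · rintro ⟨s, hs, rfl⟩
    rw [expWt_exp] at hwt
    obtain ⟨x, hx⟩ := exists_stepOf_eq (k := k) (l := l) hs (by omega)
    exact ⟨x, by rw [hx, Step.poly_eq]⟩
  · rintro ⟨x, hx⟩
    rw [Step.poly_eq] at hx
    refine ⟨stepOf x, legal_stepOf x, ?_⟩
    exact (MvPolynomial.monomial_left_injective one_ne_zero hx).symm

/-- The coefficients of a morphism in the radical at the monomials of the arrows. -/
def arrowCoeff (k l : w.Vertex) : w.rad (idx k) (idx l) →ₗ[ℂ] ((k ⟶ l) → ℂ) :=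
  LinearMap.pi fun x => MvPolynomial.lcoeff ℂ (stepOf x).exp ∘ₗ
    multiplier (idx k) (idx l) ∘ₗ (w.rad (idx k) (idx l)).subtype

theorem arrowCoeff_apply (k l : w.Vertex) (φ : w.rad (idx k) (idx l)) (x : k ⟶ l) :
    arrowCoeff k l φ x = (multiplier (idx k) (idx l) φ.1).coeff (stepOf x).exp := rfl

/-- Coefficients at the legal steps from `k` detect `radSq`. The weight of a monomial that occurs
fixes its target, so a legal step with nonzero coefficient is indeed an arrow from `k` to `l`. -/
theorem ker_arrowCoeff (k l : w.Vertex) : LinearMap.ker (arrowCoeff k l) =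
    (w.radSq (idx k) (idx l)).comap (w.rad (idx k) (idx l)).subtype := by
  ext φ
  rw [LinearMap.mem_ker, Submodule.mem_comap]
  constructor
  · intro h
    refine mem_radSq_of_coeff φ.2 fun s hs => ?_
    by_contra hne
    have hwt := expWt_of_coeff_ne_zero hne
    rw [expWt_exp] at hwt
    obtain ⟨x, rfl⟩ := exists_stepOf_eq (k := k) (l := l) hs (by omega)
    exact hne (congrFun h x)
  · intro h
    ext x
    exact coeff_exp_of_mem_radSq h (legal_stepOf x)

/-- The multiplication by the monomial of an arrow. -/
def arrowMor {k l : w.Vertex} (x : k ⟶ l) : w.rad (idx k) (idx l) :=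
  ⟨mulMor (idx k) (idx l) (MvPolynomial.monomial (stepOf x).exp 1) (by
    have : ((idx l : ℕ) : ℤ) - (idx k : ℕ) = w.expWt (stepOf x).exp := by
      rw [expWt_exp, idx_eq_add_stepWt x]; ring
    rw [this]
    exact w.monomial_mem_semi 1),
    mem_rad_of_isMulBy_monomial (stepOf x).exp_ne_zero (isMulBy_mulMor _ _ _ _)⟩

open Classical in
theorem arrowCoeff_arrowMor {k l : w.Vertex} (x : k ⟶ l) :
    arrowCoeff k l (arrowMor x) = Pi.single x 1 := by
  ext y
  rw [arrowCoeff_apply, arrowMor, multiplier_mulMor, MvPolynomial.coeff_monomial, Pi.single_apply]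
  congr 1
  rw [Step.exp_injective.eq_iff, stepOf_injective.eq_iff, eq_comm (a := y)]

theorem isMulBy_arrowMor {k l : w.Vertex} (x : k ⟶ l) :
    IsMulBy (arrowMor x).1 (stepOf x).poly := by
  rw [Step.poly_eq]
  exact fun _ => rfl

theorem exists_basis_irr (k l : w.Vertex) :
    ∃ B : Module.Basis (k ⟶ l) ℂ (w.Irr (idx k) (idx l)),
      ∀ x : k ⟶ l, ∃ φ : w.rad (idx k) (idx l),
        IsMulBy φ.1 (stepOf x).poly ∧ B x = Submodule.Quotient.mk φ := by
  classical
  have := Fintype.ofFinite (k ⟶ l)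
  have hsurj : LinearMap.range (arrowCoeff k l) = ⊤ := by
    rw [LinearMap.range_eq_top]
    intro c
    refine ⟨∑ x, c x • arrowMor x, ?_⟩
    rw [map_sum]
    simp only [map_smul, arrowCoeff_arrowMor]
    ext y
    simp [Finset.sum_apply, Pi.single_apply]
  let E : w.Irr (idx k) (idx l) ≃ₗ[ℂ] ((k ⟶ l) → ℂ) :=
    (Submodule.quotEquivOfEq _ _ (ker_arrowCoeff k l).symm).trans
      ((arrowCoeff k l).quotKerEquivOfSurjective (LinearMap.range_eq_top.1 hsurj))
  refine ⟨Module.Basis.ofEquivFun E, fun x => ⟨arrowMor x, isMulBy_arrowMor x, ?_⟩⟩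
  rw [Module.Basis.coe_ofEquivFun, LinearEquiv.symm_apply_eq]
  exact (arrowCoeff_arrowMor x).symm

end Weights

/-! ### Words -/

/-- The exponent of the product of the monomials of the arrows in a word. -/
def wordExp (L : List Step) : Var →₀ ℕ := (L.map Step.exp).sum

@[simp] theorem wordExp_nil : wordExp [] = 0 := rfl

@[simp] theorem wordExp_cons (s : Step) (L : List Step) :
    wordExp (s :: L) = s.exp + wordExp L := by simp [wordExp]

@[simp] theorem wordExp_append (L L' : List Step) :
    wordExp (L ++ L') = wordExp L + wordExp L' := by simp [wordExp]

theorem wordExp_reverse (L : List Step) : wordExp L.reverse = wordExp L := by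
  rw [wordExp, List.map_reverse, List.sum_reverse, wordExp]

theorem disp_eq (s : Step) : s.disp =
    ((s.exp (.inl .α) : ℤ) - s.exp (.inl .β), (s.exp (.inr .δ) : ℤ) - s.exp (.inr .γ)) := by
  rcases s with ((_ | _) | (_ | _)) | ⟨_ | _, _ | _⟩ <;>
    simp [Step.disp, Step.exp, varDisp]

/-- The displacement is linear in the exponent; consequently walks with the same start and the same
exponent also have the same end in `ℤ²`. -/
theorem wordDisp_eq (L : List Step) : wordDisp L =
    ((wordExp L (.inl .α) : ℤ) - wordExp L (.inl .β),
      (wordExp L (.inr .δ) : ℤ) - wordExp L (.inr .γ)) := by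
  induction L with
  | nil => simp [Prod.ext_iff]
  | cons s L ih =>
    rw [wordDisp_cons, ih, disp_eq, wordExp_cons]
    simp only [Prod.mk_add_mk, Finsupp.add_apply, Prod.mk.injEq]
    push_cast
    constructor <;> ring

/-- The exponent of `αβγδ`. -/
def fullExp : Var →₀ ℕ :=
  Finsupp.single (.inl .α) 1 + Finsupp.single (.inl .β) 1 + Finsupp.single (.inr .γ) 1 +
    Finsupp.single (.inr .δ) 1

theorem Cell.wordExp_word (F : Cell) : wordExp F.word = fullExp := by
  rcases F with (_ | _) | ⟨_ | _, _ | _⟩ | ⟨_ | _, _ | _⟩ <;>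
    simp only [Cell.word, wordExp_cons, wordExp_nil, Step.exp, Hor.opp, Ver.opp, fullExp] <;> abel

/-- All complements of a given arrow therefore have the same exponent, which is why the
representation annihilates the cyclic derivatives. -/
theorem Cell.wordExp_compl {F : Cell} {s : Step} (h : s ∈ F.word) :
    wordExp (F.compl s) + s.exp = fullExp := by
  rw [← F.wordExp_word, Cell.word_eq h, Cell.compl, wordExp_append, wordExp_append, wordExp_cons]
  abel

theorem Cell.wordDisp_compl {F : Cell} {s : Step} (h : s ∈ F.word) :
    wordDisp (F.compl s) = -s.disp := by
  rw [Cell.compl, wordDisp_append, Cell.before_disp h]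
  abel

theorem Cell.not_mem_compl {F : Cell} {s : Step} (h : s ∈ F.word) : s ∉ F.compl s := by
  rw [Cell.compl, List.mem_append, not_or]
  exact ⟨Cell.not_mem_after h, Cell.not_mem_before⟩

theorem Cell.sign_eq (F : Cell) : F.sign = 1 ∨ F.sign = -1 := by
  revert F
  decide

/-! ### Walks as elements of the path algebra -/

namespace Weights

variable {w : Weights}

/-- The names of the arrows of a path, the last one first. -/
def pathSteps {k : w.Vertex} : {l : w.Vertex} → Path k l → List Step
  | _, .nil => []
  | _, .cons p x => stepOf x :: pathSteps p

theorem pathSteps_comp {k l m : w.Vertex} (p : Path k l) (q : Path l m) :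
    pathSteps (p.comp q) = pathSteps q ++ pathSteps p := by
  induction q with
  | nil => rfl
  | cons q x ih => rw [Path.comp_cons, pathSteps, ih]; rfl

theorem pathSteps_walkPath (p : ℤ × ℤ) (L : List Step) (h : w.IsWalk p L) :
    pathSteps (w.walkPath p L h) = L.reverse := by
  induction L generalizing p with
  | nil => rfl
  | cons s L ih =>
    exact (pathSteps_comp _ _).trans
      ((congrArg (· ++ [s]) (ih _ h.2)).trans List.reverse_cons.symm)

variable (w)

open Classical in
/-- The element of the path algebra given by the arrow of the periodic quiver from `p` named `s`,
zero if there is no such arrow. -/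
def arrElt (p : ℤ × ℤ) (s : Step) : PathAlgebra w.Vertex :=
  if h : w.IsArrow p s then
    ofPath (Hom.toPath (⟨s, p, rfl, rfl, h⟩ : w.vertex p ⟶ w.vertex (p + s.disp)))
  else 0

/-- The element of the path algebra given by a walk in the periodic quiver, zero if the word does
not describe a walk. -/
def walkElt (p : ℤ × ℤ) : List Step → PathAlgebra w.Vertex
  | [] => ofPath (Path.nil : Path (w.vertex p) (w.vertex p))
  | s :: t => walkElt (p + s.disp) t * w.arrElt p s

variable {w}

theorem ofPath_toPath_congr {k l k' l' : w.Vertex} (x : k ⟶ l) (x' : k' ⟶ l') (hk : k = k')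
    (hl : l = l') (h : stepOf x = stepOf x') : ofPath x.toPath = ofPath x'.toPath := by
  subst hk hl
  rw [stepOf_injective h]

theorem total_ext {k l k' l' : w.Vertex} (x : k ⟶ l) (x' : k' ⟶ l') (hk : k = k')
    (hl : l = l') (h : stepOf x = stepOf x') : (⟨k, l, x⟩ : Total w.Vertex) = ⟨k', l', x'⟩ := by
  subst hk hl
  rw [stepOf_injective h]

theorem arrElt_of_isArrow {p : ℤ × ℤ} {s : Step} (h : w.IsArrow p s) : w.arrElt p s =
    ofPath (Hom.toPath (⟨s, p, rfl, rfl, h⟩ : w.vertex p ⟶ w.vertex (p + s.disp))) := dif_pos h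

theorem arrElt_congr {p q : ℤ × ℤ} (h : w.vertex p = w.vertex q) (s : Step) :
    w.arrElt p s = w.arrElt q s := by
  by_cases hp : w.IsArrow p s
  · rw [arrElt_of_isArrow hp, arrElt_of_isArrow ((w.isArrow_iff_of_vertex_eq h s).1 hp)]
    exact ofPath_toPath_congr _ _ h (w.vertex_add_right h _) rfl
  · rw [arrElt, arrElt, dif_neg hp, dif_neg (mt (w.isArrow_iff_of_vertex_eq h s).2 hp)]

/-- This is the independence of the chosen lift: only the vertex of the quotient quiver below the
starting point matters. -/
theorem walkElt_congr {p q : ℤ × ℤ} (h : w.vertex p = w.vertex q) (L : List Step) :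
    w.walkElt p L = w.walkElt q L := by
  induction L generalizing p q with
  | nil => rw [walkElt, walkElt, h]
  | cons s L ih => rw [walkElt, walkElt, ih (w.vertex_add_right h _), arrElt_congr h]

theorem walkElt_of_isWalk {p : ℤ × ℤ} {L : List Step} (h : w.IsWalk p L) :
    w.walkElt p L = ofPath (w.walkPath p L h) := by
  induction L generalizing p with
  | nil => rfl
  | cons s L ih =>
    rw [walkElt, ih h.2, arrElt_of_isArrow h.1, ofPath_mul_comp]
    rfl

theorem walkElt_of_not_isWalk {p : ℤ × ℤ} {L : List Step} (h : ¬w.IsWalk p L) :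
    w.walkElt p L = 0 := by
  induction L generalizing p with
  | nil => exact absurd trivial h
  | cons s L ih =>
    rw [walkElt]
    by_cases hs : w.IsArrow p s
    · rw [ih fun h' => h ⟨hs, h'⟩, zero_mul]
    · rw [arrElt, dif_neg hs, mul_zero]

theorem walkElt_mul_nil (p : ℤ × ℤ) (L : List Step) :
    w.walkElt p L * ofPath (Path.nil : Path (w.vertex p) (w.vertex p)) = w.walkElt p L := by
  by_cases h : w.IsWalk p L
  · rw [walkElt_of_isWalk h, ofPath_mul_comp, Path.nil_comp]
  · rw [walkElt_of_not_isWalk h, zero_mul]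

theorem walkElt_append (p : ℤ × ℤ) (L L' : List Step) :
    w.walkElt p (L ++ L') = w.walkElt (p + wordDisp L) L' * w.walkElt p L := by
  induction L generalizing p with
  | nil => rw [List.nil_append, wordDisp_nil, add_zero, walkElt, walkElt_mul_nil]
  | cons s L ih => rw [List.cons_append, walkElt, ih, walkElt, wordDisp_cons, add_assoc, mul_assoc]

/-! ### The cyclic derivatives of the superpotential -/

theorem derivAux_eq_zero {k l : w.Vertex} (x : k ⟶ l) {u v : w.Vertex} (p : Path u v)
    (h : stepOf x ∉ pathSteps p) (y : PathAlgebra w.Vertex) : derivAux ⟨k, l, x⟩ p y = 0 := by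
  induction p generalizing y with
  | nil => rfl
  | cons p e ih =>
    rw [pathSteps, List.mem_cons, not_or] at h
    rw [derivAux, ih h.2, add_zero, if_neg]
    intro he
    apply h.1
    cases he
    rfl

theorem derivLin_walkElt_of_not_mem {k l : w.Vertex} (x : k ⟶ l) (p : ℤ × ℤ) {L : List Step}
    (h : stepOf x ∉ L) : derivLin ⟨k, l, x⟩ (w.walkElt p L) = 0 := by
  by_cases hL : w.IsWalk p L
  · rw [walkElt_of_isWalk hL, derivLin_ofPath, derivAux_eq_zero]
    rwa [pathSteps_walkPath, List.mem_reverse]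
  · rw [walkElt_of_not_isWalk hL, map_zero]

open Classical in
theorem derivLin_ofPath_comp {k l u v u' : w.Vertex} (x : k ⟶ l) (e : u ⟶ v) (p : Path v u')
    (hu : u' = u) (h : stepOf x ∉ pathSteps p) :
    derivLin ⟨k, l, x⟩ (ofPath p * ofPath e.toPath) =
      if (⟨k, l, x⟩ : Total w.Vertex) = ⟨u, v, e⟩ then ofPath p else 0 := by
  subst hu
  rw [ofPath_mul_comp, derivLin_ofPath, derivAux_comp _ _ _ _ (by rw [ofPath_mul_comp]; rfl),
    derivAux_eq_zero x p h, zero_add, Hom.toPath, derivAux, derivAux, add_zero]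
  simp only [ofPath_mul_comp, Path.comp_nil]

open Classical in
-- The name of `x` occurs once in the word, at one position. The condition tests whether the arrow
-- at this position is `x` itself, and deleting it leaves the complement.
theorem derivLin_walkElt_word {k l : w.Vertex} (x : k ⟶ l) (q : ℤ × ℤ) {F : Cell}
    (hF : stepOf x ∈ F.word) :
    derivLin ⟨k, l, x⟩ (w.walkElt q F.word) =
      if w.vertex (q + wordDisp (F.before (stepOf x))) = k then
        w.walkElt (q + wordDisp (F.before (stepOf x)) + (stepOf x).disp) (F.compl (stepOf x))
      else 0 := by
  set s := stepOf x with hs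
  set q' := q + wordDisp (F.before s) with hq'
  have hq : q' + s.disp + wordDisp (F.after s) = q := by
    rw [hq', Cell.before_disp hF]; abel
  -- Cyclic invariance moves the part before `s` behind the part after it, so that the arrow is
  -- traversed first.
  have h1 : derivLin ⟨k, l, x⟩ (w.walkElt q F.word) =
      derivLin ⟨k, l, x⟩ (w.walkElt (q' + s.disp) (F.compl s) * w.arrElt q' s) := by
    rw [Cell.word_eq hF, walkElt_append, derivLin_mul_comm, walkElt, Cell.compl, walkElt_append, hq,
      mul_assoc]
  rw [h1]
  by_cases hw : w.IsWalk (q' + s.disp) (F.compl s)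
  · by_cases ha : w.IsArrow q' s
    · have hend : w.vertex (walkEnd (q' + s.disp) (F.compl s)) = w.vertex q' := by
        rw [walkEnd_eq, Cell.wordDisp_compl hF]
        congr 1
        abel
      rw [arrElt_of_isArrow ha, walkElt_of_isWalk hw, derivLin_ofPath_comp x _ _ hend]
      · congr 1
        apply propext
        constructor
        · intro h
          have := congrArg Total.left h
          exact this.symm
        · intro hk
          have hk' : ((idx k : ℕ) : ℤ) = w.label q' := by rw [← idx_vertex, hk]
          exact total_ext _ _ hk.symm (w.vertex_ext (by
            rw [idx_eq_add_stepWt x, hk', idx_vertex, w.label_add_disp _ _ ha])) rfl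
      · rw [pathSteps_walkPath, List.mem_reverse]
        exact Cell.not_mem_compl hF
    · rw [arrElt, dif_neg ha, mul_zero, map_zero, if_neg]
      intro hk
      apply ha
      rw [isArrow_iff_legal, ← idx_vertex, hk]
      exact legal_stepOf x
  · rw [walkElt_of_not_isWalk hw, zero_mul, map_zero, ite_self]

/-- As `walkElt` vanishes on words that are not walks, the sum may run over all vertices and all
shapes without a case distinction, and any lift of a vertex can be used. -/
theorem superpotential_eq : w.superpotential = (commutators w.Vertex).mkQ
    (∑ k : w.Vertex, ∑ F : Cell,
      (F.sign : ℂ) • w.walkElt (w.exists_vertex_eq k).choose F.word) := by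
  rw [superpotential]
  congr 1
  refine Finset.sum_congr rfl fun k _ => Finset.sum_congr rfl fun F _ => ?_
  have hk := (w.exists_vertex_eq k).choose_spec
  split_ifs with h
  · have e : w.faceWord h.choose F h.choose_spec.2 = w.walkElt h.choose F.word :=
      (walkElt_of_isWalk h.choose_spec.2).symm
    rw [e]
    congr 1
    exact walkElt_congr (h.choose_spec.1.trans hk.symm) _
  · rw [walkElt_of_not_isWalk, smul_zero]
    exact fun hw => h ⟨_, hk, hw⟩

open Classical in
theorem cyclicDeriv_superpotential {p : ℤ × ℤ} {l : w.Vertex} (x : w.vertex p ⟶ l) :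
    cyclicDeriv ⟨w.vertex p, l, x⟩ w.superpotential =
      ∑ F : Cell, if stepOf x ∈ F.word then
        (F.sign : ℂ) • w.walkElt (p + (stepOf x).disp) (F.compl (stepOf x)) else 0 := by
  rw [superpotential_eq, cyclicDeriv, Submodule.mkQ_apply, Submodule.liftQ_apply, map_sum]
  simp only [map_sum, map_smul]
  rw [Finset.sum_comm]
  refine Finset.sum_congr rfl fun F _ => ?_
  split_ifs with hF
  · simp only [derivLin_walkElt_word x _ hF]
    rw [← Finset.smul_sum]
    congr 1
    -- For a fixed shape, only one base vertex puts the tail of `x` at the position of its name.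
    rw [Finset.sum_eq_single (w.vertex (p - wordDisp (F.before (stepOf x))))]
    · have hk := (w.exists_vertex_eq (w.vertex (p - wordDisp (F.before (stepOf x))))).choose_spec
      have h2 := w.vertex_add_right hk (wordDisp (F.before (stepOf x)))
      rw [sub_add_cancel] at h2
      rw [if_pos h2]
      exact walkElt_congr (w.vertex_add_right h2 _) _
    · intro k _ hk
      rw [if_neg]
      intro h
      apply hk
      have h2 := w.vertex_add_right h (-wordDisp (F.before (stepOf x)))
      rw [add_neg_cancel_right, ← sub_eq_add_neg] at h2
      rw [← h2]
      exact (w.exists_vertex_eq k).choose_spec.symm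
    · simp
  · refine Finset.sum_eq_zero fun k _ => ?_
    rw [derivLin_walkElt_of_not_mem x _ hF, smul_zero]

/-- The cyclic derivative with respect to an arrow is the difference of the complements of the
arrow in the two faces on which it lies. -/
theorem cyclicDeriv_superpotential_eq_sub {p : ℤ × ℤ} {l : w.Vertex} (x : w.vertex p ⟶ l)
    {F G : Cell} (hF : stepOf x ∈ F.word) (hG : stepOf x ∈ G.word) (hF1 : F.sign = 1)
    (hG1 : G.sign = -1) (hFw : w.IsWalk (p + (stepOf x).disp) (F.compl (stepOf x)))
    (hGw : w.IsWalk (p + (stepOf x).disp) (G.compl (stepOf x))) :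
    cyclicDeriv ⟨w.vertex p, l, x⟩ w.superpotential =
      w.walkElt (p + (stepOf x).disp) (F.compl (stepOf x)) -
        w.walkElt (p + (stepOf x).disp) (G.compl (stepOf x)) := by
  classical
  have hx : w.IsArrow p (stepOf x) := by
    rw [isArrow_iff_legal, ← idx_vertex]
    exact legal_stepOf x
  have hu : ∀ {ε : ℤ} {C D : Cell}, ε = 1 ∨ ε = -1 → stepOf x ∈ C.word → C.sign = ε →
      w.IsWalk (p + (stepOf x).disp) (C.compl (stepOf x)) → stepOf x ∈ D.word → D.sign = ε →
      w.IsWalk (p + (stepOf x).disp) (D.compl (stepOf x)) → C = D :=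
    fun hε h1 h2 h3 h4 h5 h6 =>
      (w.existsUnique_cell_isWalk hx hε).unique ⟨⟨h1, h2⟩, h3⟩ ⟨⟨h4, h5⟩, h6⟩
  have hFG : F ≠ G := by
    rintro rfl
    rw [hF1] at hG1
    omega
  rw [cyclicDeriv_superpotential, Finset.sum_eq_add F G hFG]
  · rw [if_pos hF, if_pos hG, hF1, hG1]
    push_cast
    rw [one_smul, neg_one_smul, sub_eq_add_neg]
  · intro C _ hC
    split_ifs with hCx
    · by_cases hCw : w.IsWalk (p + (stepOf x).disp) (C.compl (stepOf x))
      · rcases C.sign_eq with h | h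
        · exact absurd (hu (Or.inl rfl) hCx h hCw hF hF1 hFw) hC.1
        · exact absurd (hu (Or.inr rfl) hCx h hCw hG hG1 hGw) hC.2
      · rw [walkElt_of_not_isWalk hCw, smul_zero]
    · rfl
  · simp
  · simp

theorem toSuperpotentialAlgebra_cyclicDeriv (a : Total w.Vertex) :
    toSuperpotentialAlgebra w.superpotential (cyclicDeriv a w.superpotential) = 0 := by
  rw [toSuperpotentialAlgebra, ← map_zero (jacobianIdeal w.superpotential).ringCon.mk']
  refine (RingCon.eq _).2 ?_
  rw [TwoSidedIdeal.rel_iff, sub_zero]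
  exact TwoSidedIdeal.subset_span ⟨a, rfl⟩

variable (w) in
/-- The class of a walk in the superpotential algebra. -/
def walkClass (p : ℤ × ℤ) (L : List Step) : w.QuiverAlgebra :=
  toSuperpotentialAlgebra w.superpotential (w.walkElt p L)

theorem walkClass_append (p : ℤ × ℤ) (L L' : List Step) :
    w.walkClass p (L ++ L') = w.walkClass (p + wordDisp L) L' * w.walkClass p L := by
  rw [walkClass, walkElt_append, map_mul]
  rfl

theorem walkClass_cons (p : ℤ × ℤ) (s : Step) (L : List Step) :
    w.walkClass p (s :: L) = w.walkClass (p + s.disp) L * w.walkClass p [s] := by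
  have := walkClass_append (w := w) p [s] L
  rwa [wordDisp_cons, wordDisp_nil, add_zero] at this

/-- If the two faces have different signs, this is the relation given by the cyclic derivative; if
they have the same sign, the faces coincide. -/
theorem walkClass_compl_eq {p : ℤ × ℤ} {s : Step} (hs : w.IsArrow p s) {F G : Cell}
    (hF : s ∈ F.word) (hG : s ∈ G.word) (hFw : w.IsWalk (p + s.disp) (F.compl s))
    (hGw : w.IsWalk (p + s.disp) (G.compl s)) :
    w.walkClass (p + s.disp) (F.compl s) = w.walkClass (p + s.disp) (G.compl s) := by
  have key : ∀ {F G : Cell}, s ∈ F.word → s ∈ G.word → w.IsWalk (p + s.disp) (F.compl s) →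
      w.IsWalk (p + s.disp) (G.compl s) → F.sign = 1 → G.sign = -1 →
      w.walkClass (p + s.disp) (F.compl s) = w.walkClass (p + s.disp) (G.compl s) := by
    intro F G hF hG hFw hGw hF1 hG1
    have h := toSuperpotentialAlgebra_cyclicDeriv (w := w) ⟨_, _, ⟨s, p, rfl, rfl, hs⟩⟩
    rw [cyclicDeriv_superpotential_eq_sub _ hF hG hF1 hG1 hFw hGw, map_sub, sub_eq_zero] at h
    exact h
  rcases F.sign_eq with hF1 | hF1 <;> rcases G.sign_eq with hG1 | hG1
  · rw [(w.existsUnique_cell_isWalk hs (Or.inl rfl)).unique ⟨⟨hF, hF1⟩, hFw⟩ ⟨⟨hG, hG1⟩, hGw⟩]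
  · exact key hF hG hFw hGw hF1 hG1
  · exact (key hG hF hGw hFw hG1 hF1).symm
  · rw [(w.existsUnique_cell_isWalk hs (Or.inr rfl)).unique ⟨⟨hF, hF1⟩, hFw⟩ ⟨⟨hG, hG1⟩, hGw⟩]

/-! ### Walks with the same exponent are equal in the superpotential algebra -/

theorem label_add_wordDisp {p : ℤ × ℤ} {L : List Step} (h : w.IsWalk p L) :
    w.label (p + wordDisp L) = w.label p + w.expWt (wordExp L) := by
  induction L generalizing p with
  | nil => simp
  | cons s L ih =>
    rw [wordDisp_cons, ← add_assoc, ih h.2, w.label_add_disp p s h.1, wordExp_cons, expWt_add,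
      expWt_exp, add_assoc]

/-- Arrows are split off by `exists_legal_le`, which lowers the degree. This gives both the
surjectivity of the representation and the common continuations in the diamond argument. -/
theorem exists_walk {p : ℤ × ℤ} {e : Var →₀ ℕ} (h0 : 0 ≤ w.label p + w.expWt e)
    (h1 : w.label p + w.expWt e < w.N) : ∃ L, w.IsWalk p L ∧ wordExp L = e := by
  induction hn : e.degree using Nat.strong_induction_on generalizing p e with
  | _ n ih =>
    by_cases he : e = 0
    · exact ⟨[], trivial, he.symm⟩
    · obtain ⟨s, hs, hle⟩ := w.exists_legal_le (w.label_nonneg p) (w.label_lt p) h0 h1 he (by ring)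
      obtain ⟨e', rfl⟩ := exists_add_of_le hle
      have ha := (w.isArrow_iff_legal p s).2 hs
      have hl := w.label_add_disp p s ha
      have hd : 0 < s.exp.degree := Nat.pos_of_ne_zero fun h =>
        s.exp_ne_zero ((Finsupp.degree_eq_zero_iff _).1 h)
      rw [map_add] at hn
      rw [expWt_add, expWt_exp, ← add_assoc, ← hl] at h0 h1
      obtain ⟨L, hL, hLe⟩ := ih e'.degree (by omega) h0 h1 rfl
      exact ⟨s :: L, ⟨ha, hL⟩, by rw [wordExp_cons, hLe]⟩

/-- Two first steps are linked, for walks from `p` with exponent `e`, if they can be extended to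
walks that have the same exponent dividing `e` and that are equal in the superpotential algebra. -/
def Linked (w : Weights) (p : ℤ × ℤ) (e : Var →₀ ℕ) (s t : Step) : Prop :=
  ∃ L M : List Step, w.IsWalk p (s :: L) ∧ w.IsWalk p (t :: M) ∧
    wordExp (s :: L) = wordExp (t :: M) ∧ wordExp (s :: L) ≤ e ∧
    w.walkClass p (s :: L) = w.walkClass p (t :: M)

theorem Linked.symm {p : ℤ × ℤ} {e : Var →₀ ℕ} {s t : Step} (h : Linked w p e s t) :
    Linked w p e t s := by
  obtain ⟨L, M, h1, h2, h3, h4, h5⟩ := h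
  exact ⟨M, L, h2, h1, h3.symm, h3 ▸ h4, h5.symm⟩

theorem Linked.refl {p : ℤ × ℤ} {e : Var →₀ ℕ} {s : Step} (h : w.IsArrow p s) (he : s.exp ≤ e) :
    Linked w p e s s :=
  ⟨[], [], ⟨h, trivial⟩, ⟨h, trivial⟩, rfl, by simpa using he, rfl⟩

/-- Two complements of one arrow `r` ending at `p` are equal in the algebra. The hypothesis `he`
says that their common exponent, that of `αβγδ` without `r`, divides `e`. -/
theorem linked_of_compl {p : ℤ × ℤ} {e : Var →₀ ℕ} {r s t : Step} (hr : w.IsArrow (p - r.disp) r)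
    {F G : Cell} {L M : List Step} (hF : r ∈ F.word) (hG : r ∈ G.word) (hL : F.compl r = s :: L)
    (hM : G.compl r = t :: M) (hs : w.IsWalk p (s :: L)) (ht : w.IsWalk p (t :: M))
    (he : fullExp ≤ e + r.exp) : Linked w p e s t := by
  have h1 := Cell.wordExp_compl hF
  have h2 := Cell.wordExp_compl hG
  have h3 := walkClass_compl_eq hr hF hG (by rwa [sub_add_cancel, hL])
    (by rwa [sub_add_cancel, hM])
  rw [hL] at h1
  rw [hM] at h2
  rw [sub_add_cancel, hL, hM] at h3
  refine ⟨L, M, hs, ht, add_right_cancel (h1.trans h2.symm), ?_, h3⟩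
  rwa [← h1, add_le_add_iff_right] at he

/-- When both variables are legal, the walks `x, y` and `y, x` are the two complements of the
diagonal `x.opp y.opp`, which leads from the opposite corner of the square back to `p`. -/
theorem linked_hor_ver {p : ℤ × ℤ} {e : Var →₀ ℕ} {x : Hor} {y : Ver}
    (hx : w.IsArrow p (.single (.inl x))) (hy : w.IsArrow p (.single (.inr y)))
    (hxe : e (.inl x) ≠ 0) (hye : e (.inr y) ≠ 0) :
    Linked w p e (.single (.inl x)) (.single (.inr y)) := by
  have a1 := w.wt_hor_opp x
  have a2 := w.wt_hor_pos x
  have a3 := w.wt_ver_opp y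
  have a4 := w.wt_ver_neg y
  have hx' := (w.isArrow_iff_legal _ _).1 hx
  have hy' := (w.isArrow_iff_legal _ _).1 hy
  have h1 : w.IsWalk p [.single (.inl x), .single (.inr y)] := by
    rw [isWalk_iff_legalWord]
    simp only [LegalWord, Legal, stepWt, and_true] at *
    omega
  have h2 : w.IsWalk p [.single (.inr y), .single (.inl x)] := by
    rw [isWalk_iff_legalWord]
    simp only [LegalWord, Legal, stepWt, and_true] at *
    omega
  have hd : p - (Step.diag x.opp y.opp).disp =
      p + wordDisp [.single (.inl x), .single (.inr y)] := by
    cases x <;> cases y <;> simp [Step.disp, varDisp, Hor.opp, Ver.opp, wordDisp, sub_eq_add_neg]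
  have hr : w.IsArrow (p - (Step.diag x.opp y.opp).disp) (.diag x.opp y.opp) := by
    rw [hd, isArrow_iff_legal, label_add_wordDisp h1]
    simp only [wordExp_cons, wordExp_nil, add_zero, expWt_add, expWt_exp, Legal, stepWt] at *
    omega
  refine linked_of_compl hr (F := .triHV x.opp y.opp) (G := .triVH x.opp y.opp)
    (L := [.single (.inr y)]) (M := [.single (.inl x)]) ?_ ?_ ?_ ?_ h1 h2 ?_
  · simp [Cell.word]
  · simp [Cell.word]
  · cases x <;> cases y <;> rfl
  · cases x <;> cases y <;> rfl
  · have h4 : (Step.diag x y).exp ≤ e := diag_le_iff.2 ⟨hxe, hye⟩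
    have h5 : fullExp = (Step.diag x y).exp + (Step.diag x.opp y.opp).exp := by
      cases x <;> cases y <;> simp only [fullExp, Step.exp, Hor.opp, Ver.opp] <;> abel
    rw [h5]
    gcongr

/-- If `y` does not start at `p`, then a walk with exponent `xyx'` starts with `x` or `xy`. -/
theorem exists_cell_hor {p : ℤ × ℤ} (x : Hor) {y : Ver} (hy : w.label p + w.wt (.inr y) < 0)
    {s : Step} (hs : s = .single (.inl x) ∨ s = .diag x y) (ha : w.IsArrow p s) :
    ∃ (F : Cell) (L : List Step), .single (.inr y.opp) ∈ F.word ∧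
      F.compl (.single (.inr y.opp)) = s :: L ∧ w.IsWalk p (s :: L) := by
  have a1 := w.wt_hor_opp x
  have a2 := w.wt_hor_pos x
  have b1 := w.label_nonneg p
  have ha' := (w.isArrow_iff_legal _ _).1 ha
  rcases hs with rfl | rfl
  · by_cases hxy : 0 ≤ w.label p + w.wt (.inl x) + w.wt (.inr y)
    · refine ⟨.square (match x with | .α => y | .β => y.opp),
        [.single (.inr y), .single (.inl x.opp)], ?_, ?_, ?_⟩
      · cases x <;> cases y <;> simp [Cell.word, Ver.opp]
      · cases x <;> cases y <;> rfl
      · rw [isWalk_iff_legalWord]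
        simp only [LegalWord, Legal, stepWt, and_true] at *
        omega
    · refine ⟨.triVH x.opp y, [.diag x.opp y], by simp [Cell.word], ?_, ?_⟩
      · cases x <;> cases y <;> rfl
      · rw [isWalk_iff_legalWord]
        simp only [LegalWord, Legal, stepWt, and_true] at *
        omega
  · refine ⟨.triHV x y, [.single (.inl x.opp)], by simp [Cell.word], ?_, ?_⟩
    · cases x <;> cases y <;> rfl
    · rw [isWalk_iff_legalWord]
      simp only [LegalWord, Legal, stepWt, and_true] at *
      omega

/-- If `x` does not start at `p`, then a walk with exponent `yxy'` starts with `y` or `xy`. -/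
theorem exists_cell_ver {p : ℤ × ℤ} (y : Ver) {x : Hor}
    (hx : w.N ≤ w.label p + w.wt (.inl x)) {s : Step}
    (hs : s = .single (.inr y) ∨ s = .diag x y) (ha : w.IsArrow p s) :
    ∃ (F : Cell) (L : List Step), .single (.inl x.opp) ∈ F.word ∧
      F.compl (.single (.inl x.opp)) = s :: L ∧ w.IsWalk p (s :: L) := by
  have a1 := w.wt_ver_opp y
  have a2 := w.wt_ver_neg y
  have b1 := w.label_lt p
  have ha' := (w.isArrow_iff_legal _ _).1 ha
  rcases hs with rfl | rfl
  · by_cases hxy : w.label p + w.wt (.inr y) + w.wt (.inl x) < w.N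
    · refine ⟨.square (match x with | .α => y.opp | .β => y),
        [.single (.inl x), .single (.inr y.opp)], ?_, ?_, ?_⟩
      · cases x <;> cases y <;> simp [Cell.word, Ver.opp, Hor.opp]
      · cases x <;> cases y <;> rfl
      · rw [isWalk_iff_legalWord]
        simp only [LegalWord, Legal, stepWt, and_true] at *
        omega
    · refine ⟨.triHV x y.opp, [.diag x y.opp], by simp [Cell.word], ?_, ?_⟩
      · cases x <;> cases y <;> rfl
      · rw [isWalk_iff_legalWord]
        simp only [LegalWord, Legal, stepWt, and_true] at *
        omega
  · refine ⟨.triVH x y, [.single (.inr y.opp)], by simp [Cell.word], ?_, ?_⟩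
    · cases x <;> cases y <;> rfl
    · rw [isWalk_iff_legalWord]
      simp only [LegalWord, Legal, stepWt, and_true] at *
      omega

theorem fullExp_le_of_single {e : Var →₀ ℕ} (z : Var) (h : ∀ u, u ≠ z → e u ≠ 0) :
    fullExp ≤ e + (Step.single z).exp := by
  intro u
  have h1 : fullExp u = 1 := by
    rcases u with (_ | _) | (_ | _) <;> simp [fullExp]
  rw [h1, Finsupp.add_apply]
  by_cases hu : u = z
  · subst hu
    simp [Step.exp]
  · have := h u hu
    omega

/-- The common arrow is `y.opp` ending at `p`, which exists because `y` wraps around at `p`. Its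
complements have exponent `αβy`, and `exists_cell_hor` finds one for either first step. -/
theorem linked_of_hor {p : ℤ × ℤ} {e : Var →₀ ℕ} (x : Hor) {y : Ver}
    (hy : w.label p + w.wt (.inr y) < 0) {s t : Step}
    (hs : s = .single (.inl x) ∨ s = .diag x y)
    (ht : t = .single (.inl x.opp) ∨ t = .diag x.opp y) (hsa : w.IsArrow p s)
    (hta : w.IsArrow p t) (hx : ∀ x, e (.inl x) ≠ 0) (hye : e (.inr y) ≠ 0) :
    Linked w p e s t := by
  obtain ⟨F, L, hF, hL, hLw⟩ := exists_cell_hor x hy hs hsa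
  obtain ⟨G, M, hG, hM, hMw⟩ := exists_cell_hor x.opp hy ht hta
  refine linked_of_compl ?_ hF hG hL hM hLw hMw (fullExp_le_of_single _ ?_)
  · have hd : p - (Step.single (.inr y.opp)).disp = p + varDisp (.inr y) := by
      cases y <;> simp [Step.disp, varDisp, Ver.opp, sub_eq_add_neg]
    rw [hd, isArrow_iff_legal]
    have a1 := w.wt_ver_opp y
    have b1 := w.label_nonneg p
    have b2 := w.label_nonneg (p + varDisp (.inr y))
    have := w.ver_shift p y
    simp only [Legal]
    omega
  · rintro (u | u) hu
    · exact hx u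
    · rcases y.eq_or_eq_opp u with rfl | rfl
      · exact hye
      · exact absurd rfl hu

theorem linked_of_ver {p : ℤ × ℤ} {e : Var →₀ ℕ} (y : Ver) {x : Hor}
    (hx : w.N ≤ w.label p + w.wt (.inl x)) {s t : Step}
    (hs : s = .single (.inr y) ∨ s = .diag x y)
    (ht : t = .single (.inr y.opp) ∨ t = .diag x y.opp) (hsa : w.IsArrow p s)
    (hta : w.IsArrow p t) (hy : ∀ y, e (.inr y) ≠ 0) (hxe : e (.inl x) ≠ 0) :
    Linked w p e s t := by
  obtain ⟨F, L, hF, hL, hLw⟩ := exists_cell_ver y hx hs hsa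
  obtain ⟨G, M, hG, hM, hMw⟩ := exists_cell_ver y.opp hx ht hta
  refine linked_of_compl ?_ hF hG hL hM hLw hMw (fullExp_le_of_single _ ?_)
  · have hd : p - (Step.single (.inl x.opp)).disp = p + varDisp (.inl x) := by
      cases x <;> simp [Step.disp, varDisp, Hor.opp, sub_eq_add_neg]
    rw [hd, isArrow_iff_legal]
    have a1 := w.wt_hor_opp x
    have b1 := w.label_lt p
    have b2 := w.label_lt (p + varDisp (.inl x))
    have := w.hor_shift p x
    simp only [Legal]
    omega
  · rintro (u | u) hu
    · rcases x.eq_or_eq_opp u with rfl | rfl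
      · exact hxe
      · exact absurd rfl hu
    · exact hy u

theorem Hor.forall_iff (x : Hor) {P : Hor → Prop} : (∀ u, P u) ↔ P x ∧ P x.opp := by
  constructor
  · exact fun h => ⟨h _, h _⟩
  · rintro ⟨h1, h2⟩ u
    rcases x.eq_or_eq_opp u with rfl | rfl
    exacts [h1, h2]

theorem Ver.forall_iff (y : Ver) {P : Ver → Prop} : (∀ u, P u) ↔ P y ∧ P y.opp := by
  constructor
  · exact fun h => ⟨h _, h _⟩
  · rintro ⟨h1, h2⟩ u
    rcases y.eq_or_eq_opp u with rfl | rfl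
    exacts [h1, h2]

/-- The product `αβ` already has weight `N`, so a variable of negative weight is needed to return to
the range. -/
theorem exists_ver_ne_zero {k : ℤ} (hk : 0 ≤ k) {e : Var →₀ ℕ} (h : k + w.expWt e < w.N)
    (hx : ∀ x, e (.inl x) ≠ 0) : ∃ y, e (.inr y) ≠ 0 := by
  by_contra! hc
  rw [expWt_eq, hc, hc] at h
  have h1 : (1 : ℤ) ≤ e (.inl .α) := by have := hx .α; omega
  have h2 : (1 : ℤ) ≤ e (.inl .β) := by have := hx .β; omega
  have hN : (w.N : ℤ) = w.a + w.b := by simp [N]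
  push_cast at h
  nlinarith

theorem exists_hor_ne_zero {k : ℤ} (hk : k < w.N) {e : Var →₀ ℕ} (h : 0 ≤ k + w.expWt e)
    (hy : ∀ y, e (.inr y) ≠ 0) : ∃ x, e (.inl x) ≠ 0 := by
  by_contra! hc
  rw [expWt_eq, hc, hc] at h
  have h1 : (1 : ℤ) ≤ e (.inr .γ) := by have := hy .γ; omega
  have h2 : (1 : ℤ) ≤ e (.inr .δ) := by have := hy .δ; omega
  have hN : (w.N : ℤ) = w.c + w.d := by
    have := w.sum_eq
    simp only [N]
    omega
  push_cast at h
  nlinarith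

/-- Any two arrows that start walks with exponent `e` are linked, possibly through a third one. -/
theorem exists_linked {p : ℤ × ℤ} {e : Var →₀ ℕ} (h0 : 0 ≤ w.label p + w.expWt e)
    (h1 : w.label p + w.expWt e < w.N) {s t : Step} (hs : w.IsArrow p s) (ht : w.IsArrow p t)
    (hse : s.exp ≤ e) (hte : t.exp ≤ e) :
    ∃ r, w.IsArrow p r ∧ r.exp ≤ e ∧ Linked w p e s r ∧ Linked w p e r t := by
  have direct : Linked w p e s t →
      ∃ r, w.IsArrow p r ∧ r.exp ≤ e ∧ Linked w p e s r ∧ Linked w p e r t :=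
    fun h => ⟨s, hs, hse, .refl hs hse, h⟩
  have b1 := w.label_nonneg p
  have b2 := w.label_lt p
  have hsl := (w.isArrow_iff_legal _ _).1 hs
  have htl := (w.isArrow_iff_legal _ _).1 ht
  rcases s with (x | y) | ⟨x, y⟩ <;> rcases t with (x' | y') | ⟨x', y'⟩
  · rcases x.eq_or_eq_opp x' with rfl | rfl
    · exact direct (.refl hs hse)
    · have hx : ∀ x, e (.inl x) ≠ 0 :=
        (Hor.forall_iff x).2 ⟨single_le_iff.1 hse, single_le_iff.1 hte⟩
      obtain ⟨y, hy⟩ := exists_ver_ne_zero b1 h1 hx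
      -- If `y` starts at `p`, it is linked to both variables and serves as the intermediate step.
      -- Otherwise both variables start complements of the arrow `y.opp` ending at `p`.
      by_cases hya : w.IsArrow p (.single (.inr y))
      · exact ⟨_, hya, single_le_iff.2 hy, linked_hor_ver hs hya (hx _) hy,
          (linked_hor_ver ht hya (hx _) hy).symm⟩
      · rw [isArrow_iff_legal, Legal, not_le] at hya
        exact direct (linked_of_hor x hya (.inl rfl) (.inl rfl) hs ht hx hy)
  · exact direct (linked_hor_ver hs ht (single_le_iff.1 hse) (single_le_iff.1 hte))
  · rcases x'.eq_or_eq_opp x with rfl | rfl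
    · exact absurd hsl (not_lt.2 htl.1)
    · obtain ⟨h3, h4⟩ := diag_le_iff.1 hte
      exact direct (linked_of_hor x' htl.2 (.inr rfl) (.inl rfl) ht hs
        ((Hor.forall_iff x').2 ⟨h3, single_le_iff.1 hse⟩) h4).symm
  · exact direct (linked_hor_ver ht hs (single_le_iff.1 hte) (single_le_iff.1 hse)).symm
  · rcases y.eq_or_eq_opp y' with rfl | rfl
    · exact direct (.refl hs hse)
    · have hy : ∀ y, e (.inr y) ≠ 0 :=
        (Ver.forall_iff y).2 ⟨single_le_iff.1 hse, single_le_iff.1 hte⟩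
      obtain ⟨x, hx⟩ := exists_hor_ne_zero b2 h0 hy
      by_cases hxa : w.IsArrow p (.single (.inl x))
      · exact ⟨_, hxa, single_le_iff.2 hx, (linked_hor_ver hxa hs hx (hy _)).symm,
          linked_hor_ver hxa ht hx (hy _)⟩
      · rw [isArrow_iff_legal, Legal, not_lt] at hxa
        exact direct (linked_of_ver y hxa (.inl rfl) (.inl rfl) hs ht hy hx)
  · rcases y'.eq_or_eq_opp y with rfl | rfl
    · exact absurd hsl (not_le.2 htl.2)
    · obtain ⟨h3, h4⟩ := diag_le_iff.1 hte
      exact direct (linked_of_ver y' htl.1 (.inr rfl) (.inl rfl) ht hs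
        ((Ver.forall_iff y').2 ⟨h4, single_le_iff.1 hse⟩) h3).symm
  · rcases x.eq_or_eq_opp x' with rfl | rfl
    · exact absurd htl (not_lt.2 hsl.1)
    · obtain ⟨h3, h4⟩ := diag_le_iff.1 hse
      exact direct (linked_of_hor x hsl.2 (.inr rfl) (.inl rfl) hs ht
        ((Hor.forall_iff x).2 ⟨h3, single_le_iff.1 hte⟩) h4)
  · rcases y.eq_or_eq_opp y' with rfl | rfl
    · exact absurd htl (not_le.2 hsl.2)
    · obtain ⟨h3, h4⟩ := diag_le_iff.1 hse
      exact direct (linked_of_ver y hsl.1 (.inr rfl) (.inl rfl) hs ht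
        ((Ver.forall_iff y).2 ⟨h4, single_le_iff.1 hte⟩) h3)
  · obtain ⟨h3, h4⟩ := diag_le_iff.1 hse
    obtain ⟨h5, h6⟩ := diag_le_iff.1 hte
    rcases x.eq_or_eq_opp x' with rfl | rfl <;> rcases y.eq_or_eq_opp y' with rfl | rfl
    · exact direct (.refl hs hse)
    · exact direct (linked_of_ver y hsl.1 (.inr rfl) (.inr rfl) hs ht
        ((Ver.forall_iff y).2 ⟨h4, h6⟩) h3)
    · exact direct (linked_of_hor x hsl.2 (.inr rfl) (.inr rfl) hs ht
        ((Hor.forall_iff x).2 ⟨h3, h5⟩) h4)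
    -- For the label `k`, the conditions on the two opposite variables `x` add up to `2 k ≥ N`,
    -- those on the two opposite variables `y` to `2 k < N`.
    · exfalso
      have a1 := w.wt_hor_opp x
      have a3 := w.wt_ver_opp y
      simp only [Legal] at hsl htl
      omega

/-- Walks from the same point with the same exponent are equal in the superpotential algebra. -/
theorem walkClass_eq_of_wordExp_eq {p : ℤ × ℤ} {L M : List Step} (hL : w.IsWalk p L)
    (hM : w.IsWalk p M) (h : wordExp L = wordExp M) : w.walkClass p L = w.walkClass p M := by
  induction hn : (wordExp L).degree using Nat.strong_induction_on generalizing p L M with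
  | _ n ih =>
    have hpos : ∀ s : Step, 0 < s.exp.degree := fun s => Nat.pos_of_ne_zero fun h =>
      s.exp_ne_zero ((Finsupp.degree_eq_zero_iff _).1 h)
    have hlab := label_add_wordDisp hL
    have h0 : 0 ≤ w.label p + w.expWt (wordExp L) := hlab ▸ w.label_nonneg _
    have h1 : w.label p + w.expWt (wordExp L) < w.N := hlab ▸ w.label_lt _
    -- After a common first step, the remaining walks have smaller degree, so the induction
    -- hypothesis applies.
    have tails : ∀ {s : Step} {A B : List Step}, w.IsWalk p (s :: A) → w.IsWalk p (s :: B) →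
        wordExp (s :: A) = wordExp L → wordExp (s :: B) = wordExp L →
        w.walkClass p (s :: A) = w.walkClass p (s :: B) := by
      intro s A B hA hB hAe hBe
      rw [walkClass_cons p s A, walkClass_cons p s B]
      congr 1
      rw [wordExp_cons] at hAe hBe
      have := hpos s
      refine ih _ ?_ hA.2 hB.2 (add_left_cancel (hAe.trans hBe.symm)) rfl
      rw [← hn, ← hAe, map_add]
      omega
    have join : ∀ {s t : Step} {A B : List Step}, w.IsWalk p (s :: A) → w.IsWalk p (t :: B) →
        wordExp (s :: A) = wordExp L → wordExp (t :: B) = wordExp L →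
        Linked w p (wordExp L) s t → w.walkClass p (s :: A) = w.walkClass p (t :: B) := by
      rintro s t A B hA hB hAe hBe ⟨A', B', hA', hB', he, hle, hc⟩
      obtain ⟨e, he'⟩ := exists_add_of_le hle
      have hl := label_add_wordDisp hA'
      have hd : wordDisp (s :: A') = wordDisp (t :: B') := by rw [wordDisp_eq, wordDisp_eq, he]
      -- The two linked walks end at the same point, so one walk `T` with the missing exponent
      -- continues both. Comparison with the given walks then only involves common first steps.
      obtain ⟨T, hT, hTe⟩ := exists_walk (w := w) (p := p + wordDisp (s :: A')) (e := e)
        (by rw [hl, add_assoc, ← expWt_add, ← he']; exact h0)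
        (by rw [hl, add_assoc, ← expWt_add, ← he']; exact h1)
      have hAT : w.IsWalk p ((s :: A') ++ T) := (w.isWalk_append _ _ _).2 ⟨hA', hT⟩
      have hBT : w.IsWalk p ((t :: B') ++ T) := (w.isWalk_append _ _ _).2 ⟨hB', hd ▸ hT⟩
      have e1 : wordExp ((s :: A') ++ T) = wordExp L := by rw [wordExp_append, hTe, he']
      have e2 : wordExp ((t :: B') ++ T) = wordExp L := by rw [wordExp_append, hTe, he', he]
      rw [(tails hA hAT hAe e1).trans (walkClass_append p (s :: A') T),
        (tails hB hBT hBe e2).trans (walkClass_append p (t :: B') T), hc, hd]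
    rcases L with _ | ⟨s, A⟩ <;> rcases M with _ | ⟨t, B⟩
    · rfl
    · have h2 := congrArg Finsupp.degree h
      have := hpos t
      rw [wordExp_nil, wordExp_cons, map_add, map_zero] at h2
      omega
    · have h2 := congrArg Finsupp.degree h
      have := hpos s
      rw [wordExp_nil, wordExp_cons, map_add, map_zero] at h2
      omega
    · obtain ⟨r, hr, hre, hsr, hrt⟩ := exists_linked h0 h1 hL.1 hM.1
        (by rw [wordExp_cons]; exact le_self_add) (by rw [h, wordExp_cons]; exact le_self_add)
      obtain ⟨e, he⟩ := exists_add_of_le hre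
      have hl := w.label_add_disp p r hr
      rw [he, expWt_add, expWt_exp, ← add_assoc, ← hl] at h0 h1
      obtain ⟨T, hT, hTe⟩ := exists_walk h0 h1
      have hrT : w.IsWalk p (r :: T) := ⟨hr, hT⟩
      have hrTe : wordExp (r :: T) = wordExp (s :: A) := by rw [wordExp_cons r, hTe, he]
      exact (join hL hrT rfl hrTe hsr).trans (join hrT hM hrTe h.symm hrt)

/-! ### Endomorphisms of the tilting module -/

theorem end_ext {θ θ' : Module.End w.R w.Tilting}
    (h : ∀ (y : w.Tilting) (m : Fin w.N), toPoly (θ y m) = toPoly (θ' y m)) : θ = θ' :=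
  LinearMap.ext fun y => DFinsupp.ext fun m => toPoly_injective (h y m)

theorem IsMulEnd.ext {θ θ' : Module.End w.R w.Tilting} {k l : Fin w.N} {f : S}
    (h : IsMulEnd θ k l f) (h' : IsMulEnd θ' k l f) : θ = θ' :=
  end_ext fun y m => (h y m).trans (h' y m).symm

theorem IsMulEnd.mul {θ θ' : Module.End w.R w.Tilting} {k l m : Fin w.N} {f g : S}
    (h : IsMulEnd θ l m f) (h' : IsMulEnd θ' k l g) : IsMulEnd (θ * θ') k m (f * g) := by
  intro y n
  rw [Module.End.mul_apply, h, h', if_pos rfl, mul_assoc]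

theorem IsMulEnd.mul_eq_zero {θ θ' : Module.End w.R w.Tilting} {k l l' m : Fin w.N} {f g : S}
    (h : IsMulEnd θ l m f) (h' : IsMulEnd θ' k l' g) (hl : l' ≠ l) : θ * θ' = 0 :=
  end_ext fun y n => by
    rw [Module.End.mul_apply, h, h', if_neg hl.symm, mul_zero, ite_self]
    rfl

/-- A morphism between two summands as an endomorphism of the direct sum. -/
def extEnd (k l : Fin w.N) : w.Mor k l →ₗ[ℂ] Module.End w.R w.Tilting where
  toFun φ := DirectSum.lof w.R (Fin w.N) w.Summand l ∘ₗ φ ∘ₗ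
    DirectSum.component w.R (Fin w.N) w.Summand k
  map_add' φ ψ := by ext; simp
  map_smul' c φ := by
    refine end_ext fun y m => ?_
    by_cases hm : l = m
    · subst hm
      simp [DirectSum.component]
    · simp [DirectSum.lof_eq_of]

theorem isMulEnd_extEnd {k l : Fin w.N} {φ : w.Mor k l} {f : S} (h : IsMulBy φ f) :
    IsMulEnd (extEnd k l φ) k l f := by
  intro y m
  have e : extEnd k l φ y = DirectSum.lof w.R (Fin w.N) w.Summand l (φ (y k)) := rfl
  rw [e]
  split_ifs with hm
  · subst hm
    rw [DirectSum.lof_apply, h]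
  · rw [DirectSum.lof_eq_of, DirectSum.of_eq_of_ne _ _ _ hm, toPoly_zero]

/-- The component of an endomorphism of the direct sum between two summands. -/
def compEnd (k l : Fin w.N) : Module.End w.R w.Tilting →ₗ[ℂ] w.Mor k l where
  toFun θ := DirectSum.component w.R (Fin w.N) w.Summand l ∘ₗ θ ∘ₗ
    DirectSum.lof w.R (Fin w.N) w.Summand k
  map_add' _ _ := rfl
  map_smul' _ _ := rfl

theorem compEnd_apply (k l : Fin w.N) (θ : Module.End w.R w.Tilting) (s : w.Summand k) :
    compEnd k l θ s = θ (DirectSum.lof w.R (Fin w.N) w.Summand k s) l := rfl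

theorem multiplier_compEnd {θ : Module.End w.R w.Tilting} {k l : Fin w.N} {f : S}
    (h : IsMulEnd θ k l f) (k' l' : Fin w.N) :
    multiplier k' l' (compEnd k' l' θ) = if k' = k ∧ l' = l then f else 0 := by
  rw [← isMulBy_iff]
  intro s
  rw [compEnd_apply, h]
  by_cases hk : k' = k
  · subst hk
    by_cases hl : l' = l
    · subst hl
      simp [DirectSum.lof_apply]
    · simp [hl]
  · rw [DirectSum.lof_eq_of, DirectSum.of_eq_of_ne _ _ _ (Ne.symm hk)]
    simp [hk]

theorem sum_extEnd_compEnd (θ : Module.End w.R w.Tilting) :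
    ∑ k, ∑ l, extEnd k l (compEnd k l θ) = θ := by
  refine DirectSum.linearMap_ext _ fun k => LinearMap.ext fun s => ?_
  simp only [LinearMap.comp_apply, LinearMap.sum_apply]
  rw [Finset.sum_eq_single k]
  · have : ∀ l, extEnd k l (compEnd k l θ) (DirectSum.lof w.R (Fin w.N) w.Summand k s) =
        DirectSum.of w.Summand l (θ (DirectSum.lof w.R (Fin w.N) w.Summand k s) l) := fun l => by
      change DirectSum.lof w.R (Fin w.N) w.Summand l (compEnd k l θ
        (DirectSum.component w.R (Fin w.N) w.Summand k
          (DirectSum.lof w.R (Fin w.N) w.Summand k s))) = _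
      rw [DirectSum.component.lof_self, compEnd_apply, DirectSum.lof_eq_of]
    simp only [this]
    exact DirectSum.sum_univ_of _
  · intro k' _ hk
    refine Finset.sum_eq_zero fun l _ => ?_
    change DirectSum.lof w.R (Fin w.N) w.Summand l (compEnd k' l θ
        (DirectSum.component w.R (Fin w.N) w.Summand k'
          (DirectSum.lof w.R (Fin w.N) w.Summand k s))) = _
    rw [DirectSum.component.of, dif_neg hk.symm, map_zero, map_zero]
  · simp

/-! ### The representation of the path algebra -/

theorem expWt_pathSteps {k l : w.Vertex} (p : Path k l) :
    w.expWt (wordExp (pathSteps p)) = ((idx l : ℕ) : ℤ) - (idx k : ℕ) := by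
  induction p with
  | nil => simp [pathSteps]
  | cons p x ih =>
    rw [pathSteps, wordExp_cons, expWt_add, expWt_exp, ih, idx_eq_add_stepWt x]
    ring

/-- The endomorphism given by a path: the product of the monomials of its arrows. -/
def pathEnd {k l : w.Vertex} (p : Path k l) : Module.End w.R w.Tilting :=
  extEnd (idx k) (idx l) (mulMor (idx k) (idx l) (MvPolynomial.monomial (wordExp (pathSteps p)) 1)
    (expWt_pathSteps p ▸ w.monomial_mem_semi 1))

theorem isMulEnd_pathEnd {k l : w.Vertex} (p : Path k l) :
    IsMulEnd (pathEnd p) (idx k) (idx l) (MvPolynomial.monomial (wordExp (pathSteps p)) 1) :=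
  isMulEnd_extEnd (isMulBy_mulMor _ _ _ _)

variable (w) in
/-- The linear extension of `pathEnd`. -/
def pathRepLin : PathAlgebra w.Vertex →ₗ[ℂ] Module.End w.R w.Tilting :=
  Finsupp.linearCombination ℂ fun p : (Σ u v : w.Vertex, Path u v) => pathEnd p.2.2

theorem pathRepLin_ofPath {k l : w.Vertex} (p : Path k l) :
    pathRepLin w (ofPath p) = pathEnd p := by
  rw [pathRepLin, ofPath]
  erw [Finsupp.linearCombination_single, one_smul]

theorem pathRepLin_one : pathRepLin w 1 = 1 := by
  rw [one_def', map_sum]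
  have h : ∀ k : w.Vertex, pathRepLin w (ofPath (Path.nil : Path k k)) =
      extEnd (idx k) (idx k) (compEnd (idx k) (idx k) 1) := by
    intro k
    rw [pathRepLin_ofPath]
    refine (isMulEnd_pathEnd _).ext (isMulEnd_extEnd fun s => ?_)
    rw [compEnd_apply, Module.End.one_apply, DirectSum.lof_apply]
    exact (one_mul _).symm
  simp only [h]
  conv_rhs => rw [← sum_extEnd_compEnd (1 : Module.End w.R w.Tilting)]
  refine Finset.sum_congr rfl fun k _ => ?_
  symm
  refine Finset.sum_eq_single (idx k) (fun l _ hl => ?_) (by simp)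
  have : compEnd (idx k) l (1 : Module.End w.R w.Tilting) = 0 := by
    ext s
    rw [compEnd_apply, Module.End.one_apply, DirectSum.lof_eq_of, DirectSum.of_eq_of_ne _ _ _ hl]
    rfl
  exact (congrArg _ this).trans (map_zero _)

theorem pathRepLin_mul (x y : PathAlgebra w.Vertex) :
    pathRepLin w (x * y) = pathRepLin w x * pathRepLin w y := by
  induction x using PathAlg.induction_on with
  | h0 => simp
  | hadd x x' h h' => simp only [add_mul, map_add, h, h']
  | hsmul c u v p =>
    induction y using PathAlg.induction_on with
    | h0 => simp
    | hadd y y' h h' => simp only [mul_add, map_add, h, h']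
    | hsmul c' u' v' q =>
      simp only [map_smul, smul_mul_assoc, mul_smul_comm]
      congr 2
      by_cases hv : v' = u
      · subst hv
        rw [ofPath_mul_comp, pathRepLin_ofPath, pathRepLin_ofPath, pathRepLin_ofPath]
        refine (isMulEnd_pathEnd _).ext ?_
        have h := (isMulEnd_pathEnd p).mul (isMulEnd_pathEnd q)
        rw [MvPolynomial.monomial_mul, mul_one] at h
        rwa [pathSteps_comp, wordExp_append]
      · rw [ofPath_mul_ne _ _ hv, map_zero, pathRepLin_ofPath, pathRepLin_ofPath]
        exact ((isMulEnd_pathEnd p).mul_eq_zero (isMulEnd_pathEnd q) hv).symm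

variable (w) in
/-- The representation of the path algebra on the tilting module. -/
def pathRep : PathAlgebra w.Vertex →ₐ[ℂ] Module.End w.R w.Tilting :=
  AlgHom.ofLinearMap (pathRepLin w) pathRepLin_one pathRepLin_mul

theorem pathRep_ofPath {k l : w.Vertex} (p : Path k l) : pathRep w (ofPath p) = pathEnd p :=
  pathRepLin_ofPath p

theorem isMulEnd_pathEnd_walkPath {p : ℤ × ℤ} {L : List Step} (h : w.IsWalk p L) :
    IsMulEnd (pathEnd (w.walkPath p L h)) (idx (w.vertex p)) (idx (w.vertex (p + wordDisp L)))
      (MvPolynomial.monomial (wordExp L) 1) := by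
  have h1 := isMulEnd_pathEnd (w.walkPath p L h)
  rw [pathSteps_walkPath, wordExp_reverse] at h1
  rwa [← walkEnd_eq]

theorem isMulEnd_walkElt {p : ℤ × ℤ} {L : List Step} (h : w.IsWalk p L) :
    IsMulEnd (pathRep w (w.walkElt p L)) (idx (w.vertex p)) (idx (w.vertex (p + wordDisp L)))
      (MvPolynomial.monomial (wordExp L) 1) := by
  rw [walkElt_of_isWalk h, pathRep_ofPath]
  exact isMulEnd_pathEnd_walkPath h

/-- The two complements of the arrow start and end at the same vertices and multiply by the same
monomial. -/
theorem pathRep_cyclicDeriv (a : Total w.Vertex) :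
    pathRep w (cyclicDeriv a w.superpotential) = 0 := by
  obtain ⟨k, l, x⟩ := a
  obtain ⟨p, rfl⟩ := w.exists_vertex_eq k
  have hx : w.IsArrow p (stepOf x) := by
    rw [isArrow_iff_legal, ← idx_vertex]
    exact legal_stepOf x
  obtain ⟨F, ⟨⟨h1, h2⟩, h3⟩, -⟩ := w.existsUnique_cell_isWalk hx (Or.inl rfl)
  obtain ⟨G, ⟨⟨h4, h5⟩, h6⟩, -⟩ := w.existsUnique_cell_isWalk hx (Or.inr rfl)
  rw [cyclicDeriv_superpotential_eq_sub x h1 h4 h2 h5 h3 h6, map_sub, sub_eq_zero]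
  have hF := isMulEnd_walkElt h3
  have hG := isMulEnd_walkElt h6
  have hFe := Cell.wordExp_compl h1
  rw [← Cell.wordExp_compl h4] at hFe
  rw [Cell.wordDisp_compl h1, add_right_cancel hFe] at hF
  rw [Cell.wordDisp_compl h4] at hG
  exact hF.ext hG

theorem jacobianIdeal_le_ker :
    (jacobianIdeal w.superpotential).ringCon ≤ RingCon.ker (pathRep w).toRingHom := by
  have h : jacobianIdeal w.superpotential ≤ TwoSidedIdeal.ker (pathRep w) := by
    rw [jacobianIdeal, TwoSidedIdeal.span_le]
    rintro _ ⟨a, rfl⟩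
    exact (TwoSidedIdeal.mem_ker _).2 (pathRep_cyclicDeriv a)
  intro x y hxy
  have h2 := h ((TwoSidedIdeal.rel_iff _ _ _).1 hxy)
  rw [TwoSidedIdeal.mem_ker, map_sub, sub_eq_zero] at h2
  exact h2

variable (w) in
/-- The representation of the superpotential algebra on the tilting module. -/
def quiverRep : w.QuiverAlgebra →ₐ[ℂ] Module.End w.R w.Tilting where
  __ := RingCon.lift _ (pathRep w).toRingHom jacobianIdeal_le_ker
  commutes' c := (pathRep w).commutes c

theorem toSuperpotentialAlgebra_smul (c : ℂ) (x : PathAlgebra w.Vertex) :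
    toSuperpotentialAlgebra w.superpotential (c • x) =
      c • toSuperpotentialAlgebra w.superpotential x := rfl

/-! ### Bijectivity -/

/-- Every path of the quiver lifts to a walk from a given point. -/
theorem exists_walkElt_eq {k l : w.Vertex} (P : Path k l) {p : ℤ × ℤ} (hp : w.vertex p = k) :
    ∃ L, w.IsWalk p L ∧ wordExp L = wordExp (pathSteps P) ∧ w.vertex (p + wordDisp L) = l ∧
      ofPath P = w.walkElt p L := by
  induction P with
  | nil => subst hp; exact ⟨[], trivial, rfl, by simp, rfl⟩
  | @cons m l P x ih =>
    obtain ⟨L, h1, h2, rfl, h4⟩ := ih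
    have ha : w.IsArrow (p + wordDisp L) (stepOf x) := by
      rw [isArrow_iff_legal, ← idx_vertex]
      exact legal_stepOf x
    have hl : w.vertex (p + wordDisp L + (stepOf x).disp) = l := w.vertex_ext (by
      rw [idx_vertex, w.label_add_disp _ _ ha, idx_eq_add_stepWt x, idx_vertex])
    refine ⟨L ++ [stepOf x], (w.isWalk_append _ _ _).2 ⟨h1, ha, trivial⟩, ?_, ?_, ?_⟩
    · rw [wordExp_append, h2, pathSteps, wordExp_cons, wordExp_cons, wordExp_nil, add_zero,
        add_comm]
    · rw [wordDisp_append, wordDisp_cons, wordDisp_nil, add_zero, ← add_assoc, hl]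
    · have e1 : ofPath (P.cons x) = ofPath x.toPath * ofPath P := by
        rw [ofPath_mul_comp]; rfl
      rw [e1, walkElt_append, h4]
      congr 1
      rw [walkElt, walkElt, arrElt_of_isArrow ha, ofPath_mul_comp, Path.comp_nil]
      exact ofPath_toPath_congr _ _ rfl hl.symm rfl

theorem pathClass_eq {k l : w.Vertex} {P P' : Path k l}
    (h : wordExp (pathSteps P) = wordExp (pathSteps P')) : w.pathClass P = w.pathClass P' := by
  obtain ⟨p, hp⟩ := w.exists_vertex_eq k
  obtain ⟨L, h1, h2, -, h4⟩ := exists_walkElt_eq P hp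
  obtain ⟨L', h1', h2', -, h4'⟩ := exists_walkElt_eq P' hp
  rw [pathClass, pathClass, h4, h4']
  exact walkClass_eq_of_wordExp_eq h1 h1' (by rw [h2, h2', h])

variable (w) in
/-- The source, the target and the exponent of the paths in an element of the path algebra. -/
def exponents : PathAlgebra w.Vertex →ₗ[ℂ] (w.Vertex × w.Vertex × (Var →₀ ℕ) →₀ ℂ) :=
  Finsupp.lmapDomain ℂ ℂ fun p : (Σ u v : w.Vertex, Path u v) =>
    (p.1, p.2.1, wordExp (pathSteps p.2.2))

theorem exponents_ofPath {k l : w.Vertex} (p : Path k l) :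
    exponents w (ofPath p) = Finsupp.single (k, l, wordExp (pathSteps p)) 1 :=
  Finsupp.mapDomain_single

open Classical in
-- The data recorded by `exponents` are the coefficients of the matrix entries of the endomorphism,
-- so the kernel of `pathRep` is contained in that of `exponents`.
theorem exponents_apply (x : PathAlgebra w.Vertex) (k l : w.Vertex) (e : Var →₀ ℕ) :
    exponents w x (k, l, e) =
      (multiplier (idx k) (idx l) (compEnd (idx k) (idx l) (pathRep w x))).coeff e := by
  induction x using PathAlg.induction_on with
  | h0 => simp
  | hadd x y hx hy =>
    simp only [map_add, Finsupp.add_apply, MvPolynomial.coeff_add, hx, hy]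
  | hsmul c u v p =>
    simp only [map_smul, Finsupp.smul_apply, MvPolynomial.coeff_smul]
    congr 1
    rw [exponents_ofPath, pathRep_ofPath, multiplier_compEnd (isMulEnd_pathEnd p),
      Finsupp.single_apply]
    have : (u, v, wordExp (pathSteps p)) = (k, l, e) ↔
        (idx k = idx u ∧ idx l = idx v) ∧ wordExp (pathSteps p) = e := by
      rw [Prod.mk.injEq, Prod.mk.injEq, and_assoc]
      exact and_congr eq_comm (and_congr_left' eq_comm)
    rw [if_congr this rfl rfl]
    split_ifs with h1 h2 h2
    · rw [MvPolynomial.coeff_monomial, if_pos h1.2]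
    · exact absurd h1.1 h2
    · rw [MvPolynomial.coeff_monomial, if_neg fun h => h1 ⟨h2, h⟩]
    · simp

open Classical in
-- The class of `x` is determined by `exponents w x`, by `pathClass_eq`, and the latter is
-- determined by the endomorphism, by `exponents_apply`.
theorem quiverRep_injective : Function.Injective (quiverRep w) := by
  rw [injective_iff_map_eq_zero]
  intro a ha
  obtain ⟨x, rfl⟩ := RingCon.mk'_surjective _ a
  change pathRep w x = 0 at ha
  -- `G` picks some path for each source, target and exponent; the class does not depend on the
  -- choice. The value zero at triples without a path is harmless, as these never arise from a path.
  let G : (w.Vertex × w.Vertex × (Var →₀ ℕ) →₀ ℂ) →ₗ[ℂ] w.QuiverAlgebra :=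
    Finsupp.linearCombination ℂ fun z =>
      if h : ∃ P : Path z.1 z.2.1, wordExp (pathSteps P) = z.2.2 then w.pathClass h.choose else 0
  have hG : ∀ x, toSuperpotentialAlgebra w.superpotential x = G (exponents w x) := by
    intro x
    induction x using PathAlg.induction_on with
    | h0 => simp
    | hadd x y hx hy => simp only [map_add, hx, hy]
    | hsmul c u v p =>
      rw [toSuperpotentialAlgebra_smul, map_smul, map_smul]
      congr 1
      rw [exponents_ofPath, Finsupp.linearCombination_single, one_smul]
      have h : ∃ P : Path u v, wordExp (pathSteps P) = wordExp (pathSteps p) := ⟨p, rfl⟩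
      rw [dif_pos h]
      exact pathClass_eq h.choose_spec.symm
  have h0 : exponents w x = 0 := by
    ext ⟨k, l, e⟩
    rw [exponents_apply, ha]
    simp
  exact (hG x).trans (by rw [h0, map_zero])

/-- An endomorphism is the sum of its matrix entries, each entry is a combination of multiplications
by monomials, and `exists_walk` realizes every such monomial by a walk. -/
theorem quiverRep_surjective : Function.Surjective (quiverRep w) := by
  intro θ
  suffices h : θ ∈ LinearMap.range (pathRep w).toLinearMap by
    obtain ⟨x, hx⟩ := h
    exact ⟨toSuperpotentialAlgebra w.superpotential x, hx⟩
  rw [← sum_extEnd_compEnd θ]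
  refine Submodule.sum_mem _ fun k _ => Submodule.sum_mem _ fun l _ => ?_
  rw [← Submodule.mem_comap]
  refine mem_of_forall_monomial fun e ψ _ hψ => ?_
  obtain ⟨p, hp⟩ := w.exists_vertex_eq k
  have hk : w.label p = (k : ℕ) := by rw [← idx_vertex, hp]; rfl
  have he : w.expWt e = ((l : ℕ) : ℤ) - (k : ℕ) := w.mem_semi_iff.1 hψ.mem_semi e (by simp)
  obtain ⟨L, hL, rfl⟩ := exists_walk (w := w) (p := p) (e := e)
    (by rw [hk, he]; have := idx_nonneg l; omega) (by rw [hk, he]; have := idx_lt l; omega)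
  have hl : w.vertex (p + wordDisp L) = l := w.vertex_ext (by
    rw [idx_vertex, label_add_wordDisp hL, hk, he, add_sub_cancel]; rfl)
  refine ⟨w.walkElt p L, ?_⟩
  have h1 := isMulEnd_walkElt hL
  rw [hp, hl] at h1
  exact h1.ext (isMulEnd_extEnd hψ)

variable (w) in
/-- The superpotential algebra is the endomorphism algebra of the tilting module. -/
def quiverAlgebraEquiv : w.QuiverAlgebra ≃ₐ[ℂ] Module.End w.R w.Tilting :=
  AlgEquiv.ofBijective (quiverRep w) ⟨quiverRep_injective, quiverRep_surjective⟩

theorem quiverAlgebraEquiv_pathClass {k l : w.Vertex} (p : Path k l) :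
    quiverAlgebraEquiv w (w.pathClass p) = pathEnd p := pathRep_ofPath p

theorem monomial_fullExp : (MvPolynomial.monomial fullExp 1 : S) =
    MvPolynomial.X (.inl .α) * MvPolynomial.X (.inl .β) *
      MvPolynomial.X (.inr .γ) * MvPolynomial.X (.inr .δ) := by
  simp [MvPolynomial.X, MvPolynomial.monomial_mul, fullExp]

end Weights

end

end LabcQuiver

/-! ### The main theorem -/

open LabcQuiver
theorem mainTheorem1 (w : Weights) :
    -- the labels are `0, …, N - 1`, and points have the same label if and only if they differ by
    -- an element of a lattice of rank two, which acts by automorphisms of the quiver on `ℤ²`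
    (∀ k : w.Vertex, ∃ p : ℤ × ℤ, w.vertex p = k) ∧
    (∃ u v : ℤ × ℤ, LinearIndependent ℤ ![u, v] ∧
      ∀ p q : ℤ × ℤ, w.vertex p = w.vertex q ↔ q - p ∈ Submodule.span ℤ {u, v}) ∧
    (∀ p q : ℤ × ℤ, w.vertex p = w.vertex q →
      (∀ r : ℤ × ℤ, w.height (p + r) - w.height p = w.height (q + r) - w.height q) ∧
      ∀ s : Step, w.IsArrow p s ↔ w.IsArrow q s) ∧
    -- a variable `x` gives a morphism from `S(π(i,j))` to a summand exactly when the height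
    -- changes by its height step
    (∀ (p : ℤ × ℤ) (x : Var), (0 ≤ w.label p + w.wt x ∧ w.label p + w.wt x < w.N) ↔
      w.height (p + varDisp x) = w.height p + varStep x) ∧
    (∀ (p : ℤ × ℤ) (s : Step), w.IsArrow p s → w.label (p + s.disp) = w.label p + w.stepWt s) ∧
    -- the arrows from `k` to `l` form a basis of `Irr(S(k), S(l))`
    (∀ k l : w.Vertex, ∃ B : Module.Basis (k ⟶ l) ℂ (w.Irr (Weights.idx k) (Weights.idx l)),
      ∀ x : k ⟶ l, ∃ φ : w.rad (Weights.idx k) (Weights.idx l),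
        Weights.IsMulBy φ.1 (Weights.stepOf x).poly ∧ B x = Submodule.Quotient.mk φ) ∧
    -- a monomial morphism is indecomposable if and only if it is given by an arrow
    (∀ (k l : w.Vertex) (e : Var →₀ ℕ) (φ : w.Mor (Weights.idx k) (Weights.idx l)),
      Weights.IsMulBy φ (MvPolynomial.monomial e 1) →
        (Weights.IndecMor φ ↔
          ∃ x : k ⟶ l, (Weights.stepOf x).poly = MvPolynomial.monomial e 1)) ∧
    -- every arrow lies on exactly one clockwise and exactly one counterclockwise face
    (∀ (p : ℤ × ℤ) (s : Step), w.IsArrow p s → ∀ ε : ℤ, ε = 1 ∨ ε = -1 →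
      ∃! F : (ℤ × ℤ) × Cell, w.IsFace F.1 F.2 ∧ F.2.sign = ε ∧
        (p, s) ∈ Weights.walkArrows F.1 F.2.word) ∧
    -- the superpotential algebra is the endomorphism algebra, and every face word is `αβγδ`
    ∃ Φ : w.QuiverAlgebra ≃ₐ[ℂ] Module.End w.R w.Tilting,
      (∀ k : w.Vertex, Weights.IsMulEnd (Φ (w.pathClass (Quiver.Path.nil : Quiver.Path k k)))
        (Weights.idx k) (Weights.idx k) 1) ∧
      (∀ (k l : w.Vertex) (x : k ⟶ l), Weights.IsMulEnd (Φ (w.pathClass x.toPath))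
        (Weights.idx k) (Weights.idx l) (Weights.stepOf x).poly) ∧
      (∀ (p : ℤ × ℤ) (F : Cell) (h : w.IsFace p F),
        Weights.IsMulEnd (Φ (w.pathClass (w.walkPath p F.word h)))
          (Weights.idx (w.vertex p)) (Weights.idx (w.vertex p))
          (MvPolynomial.X (.inl .α) * MvPolynomial.X (.inl .β) *
            MvPolynomial.X (.inr .γ) * MvPolynomial.X (.inr .δ))) := by
  refine ⟨w.exists_vertex_eq, w.exists_period_lattice,
    fun p q h => ⟨w.height_sub_eq h, w.isArrow_iff_of_vertex_eq h⟩, w.single_iff, w.label_add_disp,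
    Weights.exists_basis_irr, Weights.indecMor_iff_exists_arrow, w.existsUnique_face,
    Weights.quiverAlgebraEquiv w, fun k => ?_, fun k l x => ?_, fun p F h => ?_⟩
  · rw [Weights.quiverAlgebraEquiv_pathClass]
    exact Weights.isMulEnd_pathEnd _
  · rw [Weights.quiverAlgebraEquiv_pathClass, Step.poly_eq]
    have h := Weights.isMulEnd_pathEnd x.toPath
    rwa [show wordExp (Weights.pathSteps x.toPath) = (Weights.stepOf x).exp from add_zero _] at h
  · rw [Weights.quiverAlgebraEquiv_pathClass, ← Weights.monomial_fullExp]
    have h1 := Weights.isMulEnd_pathEnd_walkPath (L := F.word) h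
    rw [Cell.wordExp_word, Cell.wordDisp_word, add_zero] at h1
    exact h1
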